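/- Let $(M^{2n},J)$ be a connected Kaehler manifold of complex dimension $n$ and let $f\colon M^{2n}\to\mathbb{R}^{2n+p}$, $3\le p\le 4$, $n>p$, be an isometric immersion with second fundamental form $\alpha\colon TM\times TM\to N_fM$ and normal connection $\nabla^\perp$. Assume that $f$ is locally substantial (the image of no nonempty open subset of $M$ lies in a proper affine subspace of $\mathbb{R}^{2n+p}$) and, if $p$ is even, that the restriction of $f$ to any nonempty open subset of $M$ is not holomorphic with respect to any orthogonal complex structure on $\mathbb{R}^{2n+p}$. Let $\Delta(x)=\{Y\in T_xM:\alpha(X,Y)=0 \text{ for all } X\in T_xM\}$ and assume that the rank $\varrho_f(x)=\tfrac12\left(2n-\dim(\Delta(x)\cap J\Delta(x))\right)$ satisfies $\varrho_f(x)>p$ at every $x\in M$. Let $N_1(x)=\operatorname{span}\{\alpha(X,Y):X,Y\in T_xM\}$. Let $U\subset M$ be open and let $(L,\mathcal J)$ be a pair along $U$, where $L\subset N_1|_U$ is a smooth normal vector subbundle of rank $2$ and $\mathcal J\in\Gamma(\mathrm{Aut}(L))$ is an isometric complex structure with $$\mathcal J\alpha_L(X,Y)=\alpha_L(X,JY)\quad\text{for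 all } X,Y\in T_xM,\ x\in U,$$ such that the subspaces $D(x)=\mathcal N(\alpha_{L^\perp}(x))\cap J\mathcal N(\alpha_{L^\perp}(x))$ form a tangent vector subbundle $D$ along $U$. Here $\alpha_L$ and $\alpha_{L^\perp}$ are the components of $\alpha$ in $L$ and in its orthogonal complement $L^\perp$ in $N_fM$, and $\mathcal N(\beta)=\{Y:\beta(X,Y)=0\text{ for all }X\}$. Then the following hold along $U$: * $(\mathcal C_1)$ $\mathcal J$ is parallel, that is, $(\nabla^\perp_X\mathcal J\eta)_L=\mathcal J(\nabla^\perp_X\eta)_L$ for all tangent vector fields $X$ and all $\eta\in\Gamma(L)$, and $\mathcal J\alpha_L(X,Y)=\alpha_L(X,JY)$ for all $X,Y$; * $(\mathcal C_2)$ $L$ is parallel along $D$ in the normal connection, that is, $\nabla^\perp_Y\eta\in\Gamma(L)$ for all $Y\in\Gamma(D)$ and $\eta\in\Gamma(L)$; * $(\mathcal C_3)$ $L=\operatorname{span}\{\alpha(X,Y):X,Y\in D\}$ at every point of $U$. Moreover, $D$ is integrable: $[X,Y]\in\Gamma(D)$ for all $X,Y\in\Gamma(D)$. -/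

import Mathlib

open Bundle Manifold Module
open scoped ContDiff Topology

noncomputable section

namespace RealKaehler

section Kaehler

variable {E : Type*} [NormedAddCommGroup E] [NormedSpace ℝ E] [FiniteDimensional ℝ E]
  {H : Type*} [TopologicalSpace H] (I : ModelWithCorners ℝ E H)
  (M : Type*) [TopologicalSpace M] [ChartedSpace H M] [IsManifold I ∞ M]
  [RiemannianBundle (fun x : M ↦ TangentSpace I x)]
  [IsContMDiffRiemannianBundle I ∞ E (fun x : M ↦ TangentSpace I x)]

/-- A Kaehler structure on a Riemannian manifold `M`: a smooth almost complex structure `J` which is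
orthogonal for the metric and parallel for the Levi-Civita connection (the torsion-free connection
compatible with the metric). -/
structure KaehlerStructure where
  /-- the complex structure on the tangent spaces -/
  J : ∀ x : M, TangentSpace I x →L[ℝ] TangentSpace I x
  contMDiff_J : ContMDiff I (I.prod 𝓘(ℝ, E →L[ℝ] E)) ∞
    (fun x : M ↦ TotalSpace.mk' (E →L[ℝ] E)
      (E := fun x : M ↦ TangentSpace I x →L[ℝ] TangentSpace I x) x (J x))
  J_sq : ∀ (x : M) (v : TangentSpace I x), J x (J x v) = -v
  inner_J : ∀ (x : M) (v w : TangentSpace I x), inner ℝ (J x v) (J x w) = inner ℝ v w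
  parallel_J : ∃ cov : CovariantDerivative I E (fun x : M ↦ TangentSpace I x),
    cov.IsMetricCompatible ∧ cov.torsion = 0 ∧
      ∀ (Y : ∀ x : M, TangentSpace I x) (x : M), MDiffAt (T% Y) x →
        ∀ v : TangentSpace I x, cov (fun y ↦ J y (Y y)) x v = J x (cov Y x v)

end Kaehler

section SecondFundamentalForm

variable {E : Type*} [NormedAddCommGroup E] [NormedSpace ℝ E]
  {H : Type*} [TopologicalSpace H] {I : ModelWithCorners ℝ E H}
  {M : Type*} [TopologicalSpace M] [ChartedSpace H M] [IsManifold I ∞ M]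
  {V : Type*} [NormedAddCommGroup V] [InnerProductSpace ℝ V] [FiniteDimensional ℝ V]

/-- The normal space `N_f M(x)`, the orthogonal complement of `f_* T_x M`. -/
def normalSpace (f : C^∞⟮I, M; 𝓘(ℝ, V), V⟯) (x : M) : Submodule ℝ V :=
  (LinearMap.range (mvfderiv I f x).toLinearMap)ᗮ

/-- The normal component `v ↦ (∇̃_v f_* W)^⊥` of the ambient derivative at `x` of the field `f_* W`
along `f`. -/
def normalDeriv (f : C^∞⟮I, M; 𝓘(ℝ, V), V⟯) (W : ∀ y : M, TangentSpace I y) (x : M) :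
    TangentSpace I x →L[ℝ] V :=
  (normalSpace f x).starProjection ∘L mvfderiv I (fun y ↦ mvfderiv I f y (W y)) x

set_option linter.unusedSectionVars false in
theorem mdifferentiableAt_push (f : C^∞⟮I, M; 𝓘(ℝ, V), V⟯)
    {W : ∀ y : M, TangentSpace I y} {x : M} (hW : MDiffAt (T% W) x) :
    MDifferentiableAt I 𝓘(ℝ, V) (fun y ↦ mvfderiv I f y (W y)) x := by
  have h1 : ContMDiff I.tangent 𝓘(ℝ, V).tangent 1 (tangentMap I 𝓘(ℝ, V) f) :=
    f.contMDiff.contMDiff_tangentMap (by norm_cast)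
  have h2 := (h1.mdifferentiable one_ne_zero (⟨x, W x⟩ : TangentBundle I M)).comp x hW
  have h3 : ContMDiff 𝓘(ℝ, V).tangent 𝓘(ℝ, V) 1 (fun q : TangentBundle 𝓘(ℝ, V) V ↦ (q.2 : V)) :=
    contMDiff_snd_tangentBundle_modelSpace V 𝓘(ℝ, V)
  exact (h3.mdifferentiable one_ne_zero _).comp x h2

set_option linter.unusedSectionVars false in
theorem mvfderiv_push_mem (f : C^∞⟮I, M; 𝓘(ℝ, V), V⟯) (x : M) (w : TangentSpace I x) :
    (normalSpace f x).starProjection (mvfderiv I f x w) = 0 := by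
  rw [Submodule.starProjection_apply_eq_zero_iff]
  exact Submodule.le_orthogonal_orthogonal _ (LinearMap.mem_range_self _ w)

theorem tensorialAt_normalDeriv (f : C^∞⟮I, M; 𝓘(ℝ, V), V⟯) (x : M) :
    TensorialAt I E (fun W : ∀ y : M, TangentSpace I y ↦ normalDeriv f W x) x where
  smul {g W} hg hW := by
    have h := mvfderiv_smul hg (mdifferentiableAt_push f hW)
    have e : (fun y ↦ mvfderiv I f y ((g • W) y)) = g • (fun y ↦ mvfderiv I f y (W y)) := by
      ext1 y; simp
    ext v
    simp only [normalDeriv, e, h, ContinuousLinearMap.comp_apply, add_apply,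
      smul_apply, ContinuousLinearMap.smulRight_apply, map_add, map_smul,
      mvfderiv_push_mem, smul_zero, add_zero]
  add {W W'} hW hW' := by
    have h := mvfderiv_add (mdifferentiableAt_push f hW) (mdifferentiableAt_push f hW')
    have e : (fun y ↦ mvfderiv I f y ((W + W') y)) =
        (fun y ↦ mvfderiv I f y (W y)) + (fun y ↦ mvfderiv I f y (W' y)) := by
      ext1 y; simp
    ext v
    simp only [normalDeriv, e, h, ContinuousLinearMap.comp_apply, add_apply,
      map_add]

variable [FiniteDimensional ℝ E]

/-- The second fundamental form at `x`: `α(v, w) = (∇̃_v f_* W)^⊥` for any vector field `W` that is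
differentiable at `x` with `W x = w` (see `secondFundamentalForm_apply`). -/
def secondFundamentalForm (f : C^∞⟮I, M; 𝓘(ℝ, V), V⟯) (x : M) :
    TangentSpace I x →ₗ[ℝ] TangentSpace I x →ₗ[ℝ] V :=
  LinearMap.mk₂ ℝ (fun v w ↦ TensorialAt.mkHom (fun W ↦ normalDeriv f W x) x
      (tensorialAt_normalDeriv f x) w v)
    (by intros; simp) (by intros; simp) (by intros; simp) (by intros; simp)

theorem secondFundamentalForm_apply (f : C^∞⟮I, M; 𝓘(ℝ, V), V⟯) {x : M} (v : TangentSpace I x)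
    {W : ∀ y : M, TangentSpace I y} (hW : MDiffAt (T% W) x) :
    secondFundamentalForm f x v (W x) = (normalSpace f x).starProjection
      (mvfderiv I (fun y ↦ mvfderiv I f y (W y)) x v) :=
  congrArg (fun A : TangentSpace I x →L[ℝ] V ↦ A v)
    (TensorialAt.mkHom_apply (tensorialAt_normalDeriv f x) hW)

end SecondFundamentalForm

section Bilinear

variable {T V : Type*} [AddCommGroup T] [Module ℝ T] [AddCommGroup V] [Module ℝ V]

/-- The (right) nullity `𝒩(β) = {Y | β(X, Y) = 0 for all X}` of a bilinear map. -/
def nullity (β : T →ₗ[ℝ] T →ₗ[ℝ] V) : Submodule ℝ T :=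
  LinearMap.ker β.flip

/-- The complex kernel `𝒩_c(β) = 𝒩(β) ∩ J 𝒩(β)`. -/
def complexKernel (J : T →ₗ[ℝ] T) (β : T →ₗ[ℝ] T →ₗ[ℝ] V) : Submodule ℝ T :=
  nullity β ⊓ (nullity β).map J

/-- The span `𝒮(β|_{D × D})` of the values of a bilinear map on `D × D`. -/
def imageSpan (β : T →ₗ[ℝ] T →ₗ[ℝ] V) (D : Submodule ℝ T) : Submodule ℝ V :=
  Submodule.span ℝ {ξ | ∃ X ∈ D, ∃ Y ∈ D, β X Y = ξ}

end Bilinear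

section Submanifold

variable {E : Type*} [NormedAddCommGroup E] [NormedSpace ℝ E] [FiniteDimensional ℝ E]
  {H : Type*} [TopologicalSpace H] {I : ModelWithCorners ℝ E H}
  {M : Type*} [TopologicalSpace M] [ChartedSpace H M] [IsManifold I ∞ M]
  [RiemannianBundle (fun x : M ↦ TangentSpace I x)]
  [IsContMDiffRiemannianBundle I ∞ E (fun x : M ↦ TangentSpace I x)]
  {V : Type*} [NormedAddCommGroup V] [InnerProductSpace ℝ V] [FiniteDimensional ℝ V]

/-- `f` is holomorphic along `O`: for some identification of the Euclidean space `V` with a complex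
Euclidean space, that is, for some orthogonal complex structure `C` on `V`, the differential of `f`
is complex linear at the points of `O`. -/
def IsHolomorphicOn (K : KaehlerStructure I M) (f : C^∞⟮I, M; 𝓘(ℝ, V), V⟯) (O : Set M) : Prop :=
  ∃ C : V →ₗᵢ[ℝ] V, (∀ ξ, C (C ξ) = -ξ) ∧
    ∀ x ∈ O, ∀ v : TangentSpace I x, mvfderiv I f x (K.J x v) = C (mvfderiv I f x v)

/-- `f` is a real Kaehler submanifold: an isometric immersion of a Kaehler manifold into Euclidean
space which is locally substantial and, in even codimension, holomorphic along no nonempty open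
subset. -/
structure IsRealKaehlerSubmanifold (K : KaehlerStructure I M) (f : C^∞⟮I, M; 𝓘(ℝ, V), V⟯) :
    Prop where
  isometric : ∀ (x : M) (v w : TangentSpace I x),
    inner ℝ (mvfderiv I f x v) (mvfderiv I f x w) = inner ℝ v w
  substantial : ∀ O : Set M, IsOpen O → O.Nonempty → affineSpan ℝ (f '' O) = ⊤
  not_holomorphic : Even (finrank ℝ V - finrank ℝ E) →
    ∀ O : Set M, IsOpen O → O.Nonempty → ¬ IsHolomorphicOn K f O

/-- The rank `ϱ_f(x)`: half the codimension of `Δ(x) ∩ JΔ(x)` in `T_x M`, where `Δ` is the relative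
nullity. As `Δ(x) ∩ JΔ(x)` is `J`-invariant, both dimensions are even and the division is exact. -/
def complexRank (K : KaehlerStructure I M) (f : C^∞⟮I, M; 𝓘(ℝ, V), V⟯) (x : M) : ℕ :=
  (finrank ℝ (TangentSpace I x) -
    finrank ℝ (complexKernel (K.J x).toLinearMap (secondFundamentalForm f x))) / 2

/-- The first normal space `N₁(x) = 𝒮(α(x))`. -/
def firstNormalSpace (f : C^∞⟮I, M; 𝓘(ℝ, V), V⟯) (x : M) : Submodule ℝ V :=
  imageSpan (secondFundamentalForm f x) ⊤

/-- The orthogonal complement `L^⊥(x)` of `L(x)` in the normal space `N_f M(x)`. -/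
def normalCompl (f : C^∞⟮I, M; 𝓘(ℝ, V), V⟯) (L : M → Submodule ℝ V) (x : M) : Submodule ℝ V :=
  normalSpace f x ⊓ (L x)ᗮ

/-- The tangent subspaces `D(x) = 𝒩_c(α_{L^⊥}(x))`. -/
def kernelDistribution (K : KaehlerStructure I M) (f : C^∞⟮I, M; 𝓘(ℝ, V), V⟯)
    (L : M → Submodule ℝ V) (x : M) : Submodule ℝ (TangentSpace I x) :=
  complexKernel (K.J x).toLinearMap
    ((secondFundamentalForm f x).compr₂ (normalCompl f L x).starProjection.toLinearMap)

/-- The normal connection `∇^⊥_v η` at `x`, of a normal field `η`. -/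
def normalConnection (f : C^∞⟮I, M; 𝓘(ℝ, V), V⟯) (η : M → V) (x : M) (v : TangentSpace I x) : V :=
  (normalSpace f x).starProjection (mvfderiv I η x v)

variable (I) in
/-- `L` restricted to the open set `U` is a smooth vector subbundle of rank `k` of the trivial
bundle with fibre `V`: near each point of `U` it has a smooth frame. -/
def IsSubbundleOn (L : M → Submodule ℝ V) (U : Set M) (k : ℕ) : Prop :=
  ∀ x ∈ U, ∃ O : Set M, IsOpen O ∧ x ∈ O ∧ O ⊆ U ∧ ∃ s : Fin k → M → V,
    (∀ i, ContMDiffOn I 𝓘(ℝ, V) ∞ (s i) O) ∧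
    ∀ y ∈ O, LinearIndependent ℝ (fun i ↦ s i y) ∧
      Submodule.span ℝ (Set.range fun i ↦ s i y) = L y

/-- `Y` is a smooth vector field on the open set `O`. -/
def IsSmoothFieldOn (Y : ∀ x : M, TangentSpace I x) (O : Set M) : Prop :=
  ContMDiffOn I I.tangent ∞ (fun x ↦ (⟨x, Y x⟩ : TangentBundle I M)) O

/-- `D` restricted to the open set `U` is a smooth vector subbundle of rank `k` of the tangent
bundle: near each point of `U` it has a smooth frame. -/
def IsTangentSubbundleOn (D : ∀ x : M, Submodule ℝ (TangentSpace I x)) (U : Set M) (k : ℕ) :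
    Prop :=
  ∀ x ∈ U, ∃ O : Set M, IsOpen O ∧ x ∈ O ∧ O ⊆ U ∧ ∃ s : Fin k → ∀ y : M, TangentSpace I y,
    (∀ i, IsSmoothFieldOn (s i) O) ∧
    ∀ y ∈ O, LinearIndependent ℝ (fun i ↦ s i y) ∧
      Submodule.span ℝ (Set.range fun i ↦ s i y) = D y

/-- A local section, over the open set `O`, of the bundle of tangent subspaces `D`. -/
def IsTangentSectionOn (D : ∀ x : M, Submodule ℝ (TangentSpace I x))
    (Y : ∀ x : M, TangentSpace I x) (O : Set M) : Prop :=
  IsSmoothFieldOn Y O ∧ ∀ x ∈ O, Y x ∈ D x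

variable (I) in
/-- A local smooth section, over the open set `O`, of the vector bundle `L`. -/
def IsSectionOn {L : M → Submodule ℝ V} (η : ∀ x : M, L x) (O : Set M) : Prop :=
  ContMDiffOn I 𝓘(ℝ, V) ∞ (fun x ↦ (η x : V)) O

variable (I) in
/-- `𝒥 ∈ Γ(Aut(L))` is, over the open set `U`, a smooth isometric complex structure on the vector
bundle `L`. -/
structure IsIsometricComplexStructureOn (L : M → Submodule ℝ V) (𝒥 : ∀ x : M, L x →ₗ[ℝ] L x)
    (U : Set M) : Prop where
  smooth : ∀ O : Set M, IsOpen O → O ⊆ U → ∀ η : ∀ x : M, L x,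
    IsSectionOn I η O → IsSectionOn I (fun x ↦ 𝒥 x (η x)) O
  inner_map : ∀ x ∈ U, ∀ ξ ζ : L x, inner ℝ (𝒥 x ξ) (𝒥 x ζ) = inner ℝ ξ ζ
  sq : ∀ x ∈ U, ∀ ξ : L x, 𝒥 x (𝒥 x ξ) = -ξ

/-- `𝒥 α_L(X, Y) = α_L(X, JY)` over `U`. -/
def Intertwines (K : KaehlerStructure I M) (f : C^∞⟮I, M; 𝓘(ℝ, V), V⟯) (L : M → Submodule ℝ V)
    (𝒥 : ∀ x : M, L x →ₗ[ℝ] L x) (U : Set M) : Prop :=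
  ∀ x ∈ U, ∀ X Y : TangentSpace I x,
    𝒥 x ((L x).orthogonalProjectionOnto (secondFundamentalForm f x X Y)) =
      (L x).orthogonalProjectionOnto (secondFundamentalForm f x X (K.J x Y))

/-- The pairs `(L, 𝒥)` over the open set `U`: `L ⊆ N₁` is a vector subbundle of rank two, `𝒥` is an
isometric complex structure on `L` with `𝒥 α_L(X, Y) = α_L(X, JY)`, and the subspaces
`D(x) = 𝒩_c(α_{L^⊥}(x))` form a tangent vector subbundle. -/
structure IsPairOn (K : KaehlerStructure I M) (f : C^∞⟮I, M; 𝓘(ℝ, V), V⟯) (L : M → Submodule ℝ V)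
    (𝒥 : ∀ x : M, L x →ₗ[ℝ] L x) (U : Set M) : Prop where
  subbundle : IsSubbundleOn I L U 2
  le_firstNormalSpace : ∀ x ∈ U, L x ≤ firstNormalSpace f x
  complexStructure : IsIsometricComplexStructureOn I L 𝒥 U
  intertwines : Intertwines K f L 𝒥 U
  kernel_subbundle : ∃ d : ℕ, IsTangentSubbundleOn (kernelDistribution K f L) U d

/-- Condition `𝒞₁` over `U`: `𝒥` is parallel in the induced connection of `L`, and
`𝒥 α_L(X, Y) = α_L(X, JY)`. -/
def ConditionC1 (K : KaehlerStructure I M) (f : C^∞⟮I, M; 𝓘(ℝ, V), V⟯) (L : M → Submodule ℝ V)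
    (𝒥 : ∀ x : M, L x →ₗ[ℝ] L x) (U : Set M) : Prop :=
  (∀ O : Set M, IsOpen O → O ⊆ U → ∀ η : ∀ x : M, L x, IsSectionOn I η O →
    ∀ x ∈ O, ∀ X : TangentSpace I x,
      (L x).orthogonalProjectionOnto (normalConnection f (fun y ↦ (𝒥 y (η y) : V)) x X) =
        𝒥 x ((L x).orthogonalProjectionOnto (normalConnection f (fun y ↦ (η y : V)) x X))) ∧
  Intertwines K f L 𝒥 U

/-- Condition `𝒞₂` over `U`: `L` is parallel along `D` in the normal connection. -/
def ConditionC2 (K : KaehlerStructure I M) (f : C^∞⟮I, M; 𝓘(ℝ, V), V⟯) (L : M → Submodule ℝ V)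
    (U : Set M) : Prop :=
  ∀ O : Set M, IsOpen O → O ⊆ U → ∀ Y : ∀ x : M, TangentSpace I x,
    IsTangentSectionOn (kernelDistribution K f L) Y O →
    ∀ η : ∀ x : M, L x, IsSectionOn I η O →
      ∀ x ∈ O, normalConnection f (fun y ↦ (η y : V)) x (Y x) ∈ L x

/-- Condition `𝒞₃` over `U`: `L = 𝒮(α|_{D × D})` at every point. -/
def ConditionC3 (K : KaehlerStructure I M) (f : C^∞⟮I, M; 𝓘(ℝ, V), V⟯) (L : M → Submodule ℝ V)
    (U : Set M) : Prop :=
  ∀ x ∈ U, L x = imageSpan (secondFundamentalForm f x) (kernelDistribution K f L x)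

/-- A tangent subbundle `D` over `U` is integrable: brackets of local sections of `D` are sections
of `D`. -/
def IsIntegrableOn (D : ∀ x : M, Submodule ℝ (TangentSpace I x)) (U : Set M) : Prop :=
  ∀ O : Set M, IsOpen O → O ⊆ U → ∀ X Y : ∀ x : M, TangentSpace I x,
    IsTangentSectionOn D X O → IsTangentSectionOn D Y O →
      ∀ x ∈ O, VectorField.mlieBracket I X Y x ∈ D x

end Submanifold

end RealKaehler

end

open Bundle Manifold Module
open scoped ContDiff Topology

noncomputable section

namespace RealKaehler

set_option linter.unusedSectionVars false

section Algebra

open Complex ComplexConjugate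

variable {T : Type*} [AddCommGroup T] [Module ℝ T]

theorem mem_nullity {V : Type*} [AddCommGroup V] [Module ℝ V] {β : T →ₗ[ℝ] T →ₗ[ℝ] V} {Y : T} :
    Y ∈ nullity β ↔ ∀ X, β X Y = 0 := by
  simp [nullity, LinearMap.ext_iff]

theorem mem_complexKernel {V : Type*} [AddCommGroup V] [Module ℝ V] {J : T →ₗ[ℝ] T}
    (hJ : ∀ v, J (J v) = -v) {β : T →ₗ[ℝ] T →ₗ[ℝ] V} {Y : T} :
    Y ∈ complexKernel J β ↔ (∀ X, β X Y = 0) ∧ ∀ X, β X (J Y) = 0 := by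
  simp only [complexKernel, Submodule.mem_inf, Submodule.mem_map, mem_nullity]
  refine and_congr_right fun hY ↦ ⟨?_, fun h ↦ ⟨-J Y, fun X ↦ by simp [h], by simp [hJ]⟩⟩
  rintro ⟨Z, hZ, rfl⟩ X
  simp [hJ, hZ]

/-- The `(1, 0)`-part in the first variable of a complex valued real bilinear map. -/
def typePart (J : T →ₗ[ℝ] T) (c : T →ₗ[ℝ] T →ₗ[ℝ] ℂ) (X : T) : T →ₗ[ℝ] ℂ :=
  c.flip X - I • (c.flip X ∘ₗ J)

/-- The `(1, 0)`-part in the first variable of the conjugate of a complex valued real bilinear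
map. -/
def conjTypePart (J : T →ₗ[ℝ] T) (c : T →ₗ[ℝ] T →ₗ[ℝ] ℂ) (X : T) : T →ₗ[ℝ] ℂ :=
  conjAe.toLinearMap ∘ₗ c.flip X - I • (conjAe.toLinearMap ∘ₗ c.flip X ∘ₗ J)

theorem typePart_apply (J : T →ₗ[ℝ] T) (c : T →ₗ[ℝ] T →ₗ[ℝ] ℂ) (X Z : T) :
    typePart J c X Z = c Z X - I * c (J Z) X := by
  simp [typePart]

theorem conjTypePart_apply (J : T →ₗ[ℝ] T) (c : T →ₗ[ℝ] T →ₗ[ℝ] ℂ) (X Z : T) :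
    conjTypePart J c X Z = conj (c Z X) - I * conj (c (J Z) X) := by
  simp [conjTypePart]

theorem typePart_add (J : T →ₗ[ℝ] T) (c : T →ₗ[ℝ] T →ₗ[ℝ] ℂ) (X Y Z : T) :
    typePart J c (X + Y) Z = typePart J c X Z + typePart J c Y Z := by
  simp [typePart_apply]; ring

theorem conjTypePart_add (J : T →ₗ[ℝ] T) (c : T →ₗ[ℝ] T →ₗ[ℝ] ℂ) (X Y Z : T) :
    conjTypePart J c (X + Y) Z = conjTypePart J c X Z + conjTypePart J c Y Z := by
  simp [conjTypePart_apply]; ring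

variable {J : T →ₗ[ℝ] T} {c : T →ₗ[ℝ] T →ₗ[ℝ] ℂ}

/-- The curvature type expression of `c` is invariant under `J`. -/
def IsKaehlerForm {V : Type*} [NormedAddCommGroup V] [InnerProductSpace ℝ V] (J : T →ₗ[ℝ] T)
    (β : T →ₗ[ℝ] T →ₗ[ℝ] V) : Prop :=
  ∀ X Y Z W, inner ℝ (β X W) (β Y Z) - inner ℝ (β X Z) (β Y W) =
    inner ℝ (β X (J W)) (β Y (J Z)) - inner ℝ (β X (J Z)) (β Y (J W))

theorem apply_eq_zero_of_typePart {X Z : T} (hu : typePart J c X Z = 0)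
    (hv : conjTypePart J c X Z = 0) : c Z X = 0 ∧ c (J Z) X = 0 := by
  rw [typePart_apply] at hu
  rw [conjTypePart_apply] at hv
  have hv' := congrArg conj hv
  simp only [map_sub, map_mul, conj_conj, conj_I, map_zero] at hv'
  have h1 : c Z X = 0 := by linear_combination (hu + hv') / 2
  refine ⟨h1, ?_⟩
  rw [h1] at hu
  have : I * c (J Z) X = 0 := by linear_combination -hu
  simpa using this

theorem IsKaehlerForm.flat (hK : IsKaehlerForm J c) (hc : ∀ X Y, c X Y = c Y X)
    (hJ : ∀ v, J (J v) = -v) (X Y Z W : T) :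
    typePart J c X Z * conjTypePart J c Y W + conjTypePart J c X Z * typePart J c Y W =
      typePart J c Y Z * conjTypePart J c X W + conjTypePart J c Y Z * typePart J c X W := by
  have h1 := hK X Y Z W
  have h2 := hK X Y (J Z) W
  simp only [Complex.inner, hJ, map_neg] at h1 h2
  simp only [typePart_apply, conjTypePart_apply, hc _ X, hc _ Y]
  simp only [mul_re, neg_re, neg_im, conj_re, conj_im] at h1 h2
  apply Complex.ext
  · simp
    linear_combination (-2) * h1
  · simp
    linear_combination (2) * h2

theorem IsKaehlerForm.trichotomy (hK : IsKaehlerForm J c) (hc : ∀ X Y, c X Y = c Y X)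
    (hJ : ∀ v, J (J v) = -v) :
    (∃ φ : T →ₗ[ℝ] ℂ, ∀ Z, φ Z = 0 → ∀ Y, c Z Y = 0 ∧ c (J Z) Y = 0) ∨
    ((∀ X Y, c (J X) Y = I * c X Y) ∨ (∀ X Y, c (J X) Y = -I * c X Y)) ∨
    ∃ X, (∀ s t : ℂ, (∀ Z, s * typePart J c X Z + t * conjTypePart J c X Z = 0) →
        s = 0 ∧ t = 0) ∧
      ∀ Z, typePart J c X Z = 0 → conjTypePart J c X Z = 0 →
        ∀ Y, c Z Y = 0 ∧ c (J Z) Y = 0 := by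
  by_cases hind : ∃ X, ∀ s t : ℂ, (∀ Z, s * typePart J c X Z + t * conjTypePart J c X Z = 0) →
      s = 0 ∧ t = 0
  · obtain ⟨X, hX⟩ := hind
    refine Or.inr (Or.inr ⟨X, hX, fun Z hu hv Y ↦ ?_⟩)
    have := hX (conjTypePart J c Y Z) (typePart J c Y Z) fun W ↦ by
      have h := hK.flat hc hJ X Y Z W
      rw [hu, hv] at h
      linear_combination -h
    exact apply_eq_zero_of_typePart this.2 this.1
  push Not at hind
  -- the forms `u_X` and `v_X` are dependent for all `X`
  by_cases hu : ∀ X Z, typePart J c X Z = 0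
  · refine Or.inr (Or.inl (Or.inr fun X Y ↦ ?_))
    have h := hu Y X
    rw [typePart_apply] at h
    linear_combination I * h + c (J X) Y * I_sq
  push Not at hu
  obtain ⟨X, Z₀, hX⟩ := hu
  have key : ∀ X Z₀, typePart J c X Z₀ ≠ 0 → ∃ r : ℂ, ∀ Z,
      conjTypePart J c X Z = r * typePart J c X Z := by
    intro X Z₀ hX
    obtain ⟨s, t, h, hst⟩ := hind X
    have ht : t ≠ 0 := by
      rintro rfl
      have := h Z₀
      simp only [zero_mul, add_zero, mul_eq_zero, hX, or_false] at this
      exact hst this rfl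
    refine ⟨-s / t, fun Z ↦ ?_⟩
    field_simp
    linear_combination h Z
  obtain ⟨r, hr⟩ := key X Z₀ hX
  by_cases hall : ∀ Y Z, typePart J c X Z = 0 → typePart J c Y Z = 0
  · refine Or.inl ⟨typePart J c X, fun Z hZ Y ↦ apply_eq_zero_of_typePart (hall Y Z hZ) ?_⟩
    have h := hK.flat hc hJ X Y Z Z₀
    rw [hr Z, hZ, hall Y Z hZ] at h
    have h' : conjTypePart J c Y Z * typePart J c X Z₀ = 0 := by linear_combination -h
    exact (mul_eq_zero.mp h').resolve_right hX
  -- some `u_Y` is not a multiple of `u_X`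
  push Not at hall
  have hv : ∀ X, (∃ Y Z, typePart J c X Z = 0 ∧ typePart J c Y Z ≠ 0) →
      (∃ Z, typePart J c X Z ≠ 0) → ∀ Z, conjTypePart J c X Z = 0 := by
    rintro X ⟨Y, Z₁, h1, h2⟩ ⟨Z₀, h0⟩
    obtain ⟨r, hr⟩ := key X Z₀ h0
    obtain ⟨m, hm⟩ := key Y Z₁ h2
    have e1 := hK.flat hc hJ X Y Z₁ Z₀
    rw [hr Z₁, h1, hr Z₀, hm Z₁] at e1
    have hmr : m + r = 0 := by
      have : (m + r) * (typePart J c Y Z₁ * typePart J c X Z₀) = 0 := by linear_combination -e1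
      exact (mul_eq_zero.mp this).resolve_right (mul_ne_zero h2 h0)
    have h3 : typePart J c (X + Y) Z₁ ≠ 0 := by rw [typePart_add, h1, zero_add]; exact h2
    obtain ⟨k, hk⟩ := key _ _ h3
    have e2 := hk Z₁
    have e3 := hk Z₀
    rw [typePart_add, conjTypePart_add, hr, hm] at e2 e3
    rw [h1] at e2
    have hkm : k = m := by
      have : (k - m) * typePart J c Y Z₁ = 0 := by linear_combination -e2
      exact sub_eq_zero.mp ((mul_eq_zero.mp this).resolve_right h2)
    have hrm : r = m := by
      rw [hkm] at e3
      have : (r - m) * typePart J c X Z₀ = 0 := by linear_combination e3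
      exact sub_eq_zero.mp ((mul_eq_zero.mp this).resolve_right h0)
    have : r = 0 := by linear_combination (hmr + hrm) / 2
    intro Z
    rw [hr, this, zero_mul]
  obtain ⟨Y, Z₁, h1, h2⟩ := hall
  have hvX := hv X ⟨Y, Z₁, h1, h2⟩ ⟨Z₀, hX⟩
  have main : ∀ Y' Z, conjTypePart J c Y' Z = 0 := by
    intro Y'
    by_cases hY' : typePart J c Y' Z₁ = 0
    · by_cases hY'' : ∃ Z, typePart J c Y' Z ≠ 0
      · exact hv Y' ⟨Y, Z₁, hY', h2⟩ hY''
      · push Not at hY''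
        intro Z
        have h := hK.flat hc hJ Y' Y Z Z₁
        rw [hY', hY'' Z] at h
        have hYv : conjTypePart J c Y' Z₁ = 0 := by
          have e := hK.flat hc hJ Y' X Z₁ Z₀
          rw [hY'' Z₁, hY'' Z₀, hvX, hvX, h1] at e
          have : conjTypePart J c Y' Z₁ * typePart J c X Z₀ = 0 := by linear_combination e
          exact (mul_eq_zero.mp this).resolve_right hX
        rw [hYv] at h
        have : conjTypePart J c Y' Z * typePart J c Y Z₁ = 0 := by linear_combination h
        exact (mul_eq_zero.mp this).resolve_right h2
    · intro Z
      obtain ⟨m, hm⟩ := key Y' Z₁ hY'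
      have e1 := hK.flat hc hJ X Y' Z₁ Z₀
      rw [hvX, hvX, h1, hm Z₁] at e1
      have : m * (typePart J c Y' Z₁ * typePart J c X Z₀) = 0 := by linear_combination -e1
      rw [hm, (mul_eq_zero.mp this).resolve_right (mul_ne_zero hY' hX), zero_mul]
  refine Or.inr (Or.inl (Or.inl fun X Y ↦ ?_))
  have h := congrArg conj (main Y X)
  rw [conjTypePart_apply] at h
  simp only [map_sub, map_mul, conj_conj, conj_I, map_zero] at h
  linear_combination -I * h + c (J X) Y * I_sq

end Algebra

section Counting

open Complex ComplexConjugate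

variable {T : Type*} [AddCommGroup T] [Module ℝ T] [FiniteDimensional ℝ T]

/-- A `J`-invariant subspace of real codimension at most `2 * k` is complemented by `k` vectors
over the complex numbers. -/
theorem exists_complex_generators {J : T →ₗ[ℝ] T} (hJ : ∀ v, J (J v) = -v) (k : ℕ)
    (D : Submodule ℝ T) (hD : ∀ v ∈ D, J v ∈ D) (hk : finrank ℝ T ≤ finrank ℝ D + 2 * k) :
    ∃ z : Fin k → T, ∀ P : Submodule ℝ T, D ≤ P → (∀ i, z i ∈ P ∧ J (z i) ∈ P) → P = ⊤ := by
  induction k generalizing D with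
  | zero =>
    refine ⟨Fin.elim0, fun P hP _ ↦ top_le_iff.mp (le_trans (le_of_eq ?_) hP)⟩
    exact (Submodule.eq_top_of_finrank_eq
      (le_antisymm (Submodule.finrank_le D) (by simpa using hk))).symm
  | succ k ih =>
    by_cases hT : D = ⊤
    · exact ⟨fun _ ↦ 0, fun P hP _ ↦ top_le_iff.mp (hT ▸ hP)⟩
    obtain ⟨z₀, hz₀⟩ : ∃ z₀, z₀ ∉ D := by
      by_contra! h
      exact hT (Submodule.eq_top_iff'.mpr h)
    have h1 : D < D ⊔ ℝ ∙ z₀ := by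
      refine lt_of_le_of_ne le_sup_left fun h ↦ hz₀ ?_
      rw [h]
      exact Submodule.mem_sup_right (Submodule.mem_span_singleton_self z₀)
    have h2 : D ⊔ ℝ ∙ z₀ < D ⊔ ℝ ∙ z₀ ⊔ ℝ ∙ (J z₀) := by
      refine lt_of_le_of_ne le_sup_left fun h ↦ hz₀ ?_
      have : J z₀ ∈ D ⊔ ℝ ∙ z₀ := by
        rw [h]
        exact Submodule.mem_sup_right (Submodule.mem_span_singleton_self _)
      obtain ⟨d, hd, w, hw, e⟩ := Submodule.mem_sup.mp this
      obtain ⟨r, rfl⟩ := Submodule.mem_span_singleton.mp hw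
      have e2 : (1 + r ^ 2) • z₀ = -(J d + r • d) := by
        have := congrArg J e
        rw [map_add, map_smul, hJ, ← e] at this
        calc (1 + r ^ 2) • z₀ = -(-z₀) + (r ^ 2) • z₀ := by module
          _ = -(J d + r • d) := by rw [← this]; module
      have e3 : (1 + r ^ 2) • z₀ ∈ D := by
        rw [e2]
        exact D.neg_mem (D.add_mem (hD d hd) (D.smul_mem r hd))
      exact (D.smul_mem_iff (by positivity)).mp e3
    have h1' := Submodule.finrank_lt_finrank_of_lt h1
    have h2' := Submodule.finrank_lt_finrank_of_lt h2
    obtain ⟨z, hz⟩ := ih (D ⊔ ℝ ∙ z₀ ⊔ ℝ ∙ (J z₀)) (by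
      intro v hv
      obtain ⟨w, hw, y, hy, rfl⟩ := Submodule.mem_sup.mp hv
      obtain ⟨d, hd, x, hx, rfl⟩ := Submodule.mem_sup.mp hw
      obtain ⟨r, rfl⟩ := Submodule.mem_span_singleton.mp hx
      obtain ⟨s, rfl⟩ := Submodule.mem_span_singleton.mp hy
      have e : J (d + r • z₀ + s • J z₀) = J d + (-s) • z₀ + r • J z₀ := by
        simp [hJ]; module
      rw [e]
      exact Submodule.add_mem_sup (Submodule.add_mem_sup (hD d hd)
        (Submodule.smul_mem _ _ (Submodule.mem_span_singleton_self _)))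
        (Submodule.smul_mem _ _ (Submodule.mem_span_singleton_self _))) (by omega)
    refine ⟨Fin.cons z₀ z, fun P hP hPz ↦ hz P ?_ fun i ↦ by simpa using hPz i.succ⟩
    have h0 := hPz 0
    simp only [Fin.cons_zero] at h0
    exact sup_le (sup_le hP ((Submodule.span_singleton_le_iff_mem _ _).mpr h0.1))
      ((Submodule.span_singleton_le_iff_mem _ _).mpr h0.2)

variable {L N : Type*} [NormedAddCommGroup L] [InnerProductSpace ℝ L] [FiniteDimensional ℝ L]
  [NormedAddCommGroup N] [InnerProductSpace ℝ N] [FiniteDimensional ℝ N]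

/-- The algebraic data at a point: the components `a` and `b` of the second fundamental form in a
plane `L` with complex structure `j` and in its complement `N`. -/
structure IsSplitForm (J : T →ₗ[ℝ] T) (j : L →ₗ[ℝ] L) (a : T →ₗ[ℝ] T →ₗ[ℝ] L)
    (b : T →ₗ[ℝ] T →ₗ[ℝ] N) : Prop where
  J_sq : ∀ v, J (J v) = -v
  j_sq : ∀ v, j (j v) = -v
  finrank_L : finrank ℝ L = 2
  a_symm : ∀ X Y, a X Y = a Y X
  b_symm : ∀ X Y, b X Y = b Y X
  a_J : ∀ X Y, a X (J Y) = j (a X Y)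
  kaehler : IsKaehlerForm J b
  rank : ∀ S : Submodule ℝ T,
    (∀ Y ∈ S, ∀ Z, a Z Y = 0 ∧ b Z Y = 0 ∧ a Z (J Y) = 0 ∧ b Z (J Y) = 0) →
      finrank ℝ S + 2 * finrank ℝ N + 6 ≤ finrank ℝ T

namespace IsSplitForm

variable {J : T →ₗ[ℝ] T} {j : L →ₗ[ℝ] L} {a : T →ₗ[ℝ] T →ₗ[ℝ] L} {b : T →ₗ[ℝ] T →ₗ[ℝ] N}

/-- The form `b` is complex bilinear for an isometric complex structure. -/
def IsHolomorphic (J : T →ₗ[ℝ] T) (b : T →ₗ[ℝ] T →ₗ[ℝ] N) : Prop :=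
  finrank ℝ N = 2 ∧ (∃ X Y, b X Y ≠ 0) ∧ ∃ j' : N →ₗ[ℝ] N,
    (∀ ξ ζ, inner ℝ (j' ξ) (j' ζ) = inner ℝ ξ ζ) ∧
    (∀ ξ, j' (j' ξ) = -ξ) ∧ ∀ X Y, j' (b X Y) = b X (J Y)

theorem J_mem (h : IsSplitForm J j a b) {v : T} (hv : v ∈ complexKernel J b) :
    J v ∈ complexKernel J b := by
  rw [mem_complexKernel h.J_sq] at hv ⊢
  exact ⟨hv.2, fun X ↦ by simp [h.J_sq, hv.1]⟩

theorem exists_isometry_complex (N : Type*) [NormedAddCommGroup N] [InnerProductSpace ℝ N]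
    [FiniteDimensional ℝ N] (h : finrank ℝ N = 1 ∨ finrank ℝ N = 2) :
    ∃ ρ : N →ₗᵢ[ℝ] ℂ, (finrank ℝ N = 1 → ∀ ξ, conj (ρ ξ) = ρ ξ) := by
  rcases h with h | h
  · let e := ((stdOrthonormalBasis ℝ N).reindex (finCongr h)).equiv
      (OrthonormalBasis.singleton (Fin 1) ℝ) (Equiv.refl _)
    exact ⟨ofRealLI.comp e.toLinearIsometry, fun _ ξ ↦ by simp⟩
  · let e := ((stdOrthonormalBasis ℝ N).reindex (finCongr h)).equiv
      Complex.orthonormalBasisOneI (Equiv.refl _)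
    exact ⟨e.toLinearIsometry, fun h1 ↦ by omega⟩

theorem trichotomy (h : IsSplitForm J j a b) (hN : finrank ℝ N = 1 ∨ finrank ℝ N = 2) :
    finrank ℝ T ≤ finrank ℝ (complexKernel J b) + 2 ∨ IsHolomorphic J b ∨
    (finrank ℝ N = 2 ∧ finrank ℝ T ≤ finrank ℝ (complexKernel J b) + 4 ∧
      ∃ ρ : N →ₗᵢ[ℝ] ℂ, ∃ X, ∀ s t : ℂ, (∀ Z, s * typePart J (b.compr₂ ρ.toLinearMap) X Z +
        t * conjTypePart J (b.compr₂ ρ.toLinearMap) X Z = 0) → s = 0 ∧ t = 0) := by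
  obtain ⟨ρ, hρ⟩ := exists_isometry_complex N hN
  set c : T →ₗ[ℝ] T →ₗ[ℝ] ℂ := b.compr₂ ρ.toLinearMap with hc
  have hcap : ∀ X Y, c X Y = ρ (b X Y) := fun X Y ↦ rfl
  have hc0 : ∀ X Y, c X Y = 0 ↔ b X Y = 0 := fun X Y ↦ by
    rw [hcap, map_eq_zero_iff ρ ρ.injective]
  have hcs : ∀ X Y, c X Y = c Y X := fun X Y ↦ by rw [hcap, hcap, h.b_symm]
  have hcK : IsKaehlerForm J c := fun X Y Z W ↦ by
    simp only [hcap, ρ.inner_map_map]; exact h.kaehler X Y Z W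
  have hker : ∀ Y, (∀ Z, c Y Z = 0 ∧ c (J Y) Z = 0) → Y ∈ complexKernel J b := fun Y hY ↦ by
    rw [mem_complexKernel h.J_sq]
    exact ⟨fun X ↦ by rw [h.b_symm, ← hc0]; exact (hY X).1,
      fun X ↦ by rw [h.b_symm, ← hc0]; exact (hY X).2⟩
  have hdim : ∀ {W : Type} [AddCommGroup W] [Module ℝ W] [FiniteDimensional ℝ W] (φ : T →ₗ[ℝ] W),
      (∀ Y, φ Y = 0 → ∀ Z, c Y Z = 0 ∧ c (J Y) Z = 0) →
      finrank ℝ T ≤ finrank ℝ (complexKernel J b) + finrank ℝ W := by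
    intro W _ _ _ φ hφ
    have h1 := φ.finrank_range_add_finrank_ker
    have h2 := Submodule.finrank_le (LinearMap.range φ)
    have h3 : finrank ℝ (LinearMap.ker φ) ≤ finrank ℝ (complexKernel J b) :=
      Submodule.finrank_mono fun Y hY ↦ hker Y (hφ Y hY)
    omega
  have hbot : (∀ X Y, b X Y = 0) → finrank ℝ T ≤ finrank ℝ (complexKernel J b) + 2 := by
    intro h0
    have := hdim (0 : T →ₗ[ℝ] ℝ) (fun Y _ Z ↦ ⟨(hc0 _ _).mpr (h0 _ _), (hc0 _ _).mpr (h0 _ _)⟩)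
    simp at this
    omega
  rcases hcK.trichotomy hcs h.J_sq with ⟨φ, hφ⟩ | hε | ⟨X, hX, hX'⟩
  · left
    simpa using hdim φ hφ
  · by_cases hb : ∀ X Y, b X Y = 0
    · exact Or.inl (hbot hb)
    rcases hN with hN | hN
    · refine absurd (fun X Y ↦ (hc0 X Y).mp ?_) hb
      have hre := hρ hN
      have him : ∀ X Y, (c X Y).im = 0 := fun X Y ↦ conj_eq_iff_im.mp (hre _)
      rcases hε with hε | hε
      · have := congrArg im (hε X Y)
        rw [him] at this
        exact Complex.ext (by simpa using this.symm) (him X Y)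
      · have := congrArg im (hε X Y)
        rw [him] at this
        exact Complex.ext (by simpa using this.symm) (him X Y)
    · right; left
      push Not at hb
      refine ⟨hN, hb, ?_⟩
      have hs : Function.Surjective ρ := by
        have := LinearMap.injective_iff_surjective_of_finrank_eq_finrank (f := ρ.toLinearMap)
          (by rw [hN, finrank_real_complex])
        exact this.mp ρ.injective
      let e : N ≃ₗᵢ[ℝ] ℂ := LinearIsometryEquiv.ofSurjective ρ hs
      have hrot : ∀ k : ℂ, k * k = -1 → k * conj k = 1 → (∀ X Y, c (J X) Y = k * c X Y) →
          ∃ j' : N →ₗ[ℝ] N, (∀ ξ ζ, inner ℝ (j' ξ) (j' ζ) = inner ℝ ξ ζ) ∧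
            (∀ ξ, j' (j' ξ) = -ξ) ∧ ∀ X Y, j' (b X Y) = b X (J Y) := by
        intro k hk hk' hkc
        refine ⟨e.symm.toLinearEquiv.toLinearMap ∘ₗ LinearMap.mulLeft ℝ k ∘ₗ
          e.toLinearEquiv.toLinearMap, fun ξ ζ ↦ ?_, fun ξ ↦ ?_, fun X Y ↦ ?_⟩
        · have : inner ℝ (k * e ξ) (k * e ζ) = inner ℝ (e ξ) (e ζ) := by
            rw [Complex.inner, Complex.inner]
            congr 1
            rw [map_mul]
            linear_combination (e ζ * conj (e ξ)) * hk'
          simpa [e.symm.inner_map_map, e.inner_map_map] using this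
        · apply e.injective
          simp [← mul_assoc, hk]
        · apply e.injective
          have := hkc Y X
          rw [hcs, hcs Y X] at this
          simp only [LinearMap.comp_apply, LinearMap.mulLeft_apply]
          simpa using! this.symm
      rcases hε with hε | hε
      · exact hrot I I_mul_I (by simp) hε
      · exact hrot (-I) (by simp) (by simp) hε
  · right; right
    have h4 : finrank ℝ T ≤ finrank ℝ (complexKernel J b) + 4 := by
      have := hdim ((typePart J c X).prod (conjTypePart J c X)) (fun Z hZ ↦ by
        simp only [LinearMap.prod_apply, Function.prod_apply, Prod.mk_eq_zero] at hZ
        exact hX' Z hZ.1 hZ.2)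
      simpa [finrank_prod] using this
    refine ⟨?_, h4, ρ, X, hX⟩
    rcases hN with hN | hN
    · exfalso
      have := hX 1 (-1) fun Z ↦ by
        rw [typePart_apply, conjTypePart_apply]
        simp only [hcap, hρ hN]
        ring
      simp at this
    · exact hN

theorem le_finrank_add_or (h : IsSplitForm J j a b) (hN : finrank ℝ N = 1 ∨ finrank ℝ N = 2) :
    finrank ℝ T ≤ finrank ℝ (complexKernel J b) + 2 * finrank ℝ N ∨ IsHolomorphic J b := by
  rcases h.trichotomy hN with h1 | h1 | ⟨h1, h2, -⟩
  · left; omega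
  · exact Or.inr h1
  · left; omega

theorem exists_generators (h : IsSplitForm J j a b) {k : ℕ}
    (hk : finrank ℝ T ≤ finrank ℝ (complexKernel J b) + 2 * k)
    (S : Submodule ℝ T) (hS : S ≤ complexKernel J b)
    (hSD : ∀ Y ∈ S, ∀ Z ∈ complexKernel J b, a Y Z = 0) :
    ∃ z : Fin k → T, (∀ P : Submodule ℝ T, complexKernel J b ≤ P →
        (∀ i, z i ∈ P ∧ J (z i) ∈ P) → P = ⊤) ∧
      finrank ℝ S + 2 * finrank ℝ N + 6 ≤ finrank ℝ T +
        finrank ℝ (S.map (LinearMap.pi fun i ↦ a.flip (z i))) := by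
  obtain ⟨z, hz⟩ := exists_complex_generators h.J_sq k (complexKernel J b) (fun v ↦ h.J_mem) hk
  refine ⟨z, hz, ?_⟩
  set Ψ : T →ₗ[ℝ] (Fin k → L) := LinearMap.pi fun i ↦ a.flip (z i) with hΨ
  have h1 := (Ψ.domRestrict S).finrank_range_add_finrank_ker
  rw [LinearMap.range_domRestrict] at h1
  have h2 := h.rank ((LinearMap.ker (Ψ.domRestrict S)).map S.subtype) (by
    rintro Y ⟨⟨Y, hYS⟩, hY, rfl⟩ Z
    have hY' : ∀ i, a Y (z i) = 0 := fun i ↦ congrFun (LinearMap.mem_ker.mp hY) i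
    have htop : LinearMap.ker (a Y) = ⊤ := hz _ (fun X hX ↦ hSD Y hYS X hX) fun i ↦
      ⟨hY' i, by simp [h.a_J, hY']⟩
    have ha : a Z Y = 0 := by
      rw [h.a_symm]
      have : Z ∈ LinearMap.ker (a Y) := htop ▸ Submodule.mem_top
      exact this
    have hb := (mem_complexKernel h.J_sq).mp (hS hYS)
    exact ⟨ha, hb.1 Z, by simp [h.a_J, ha], hb.2 Z⟩)
  rw [Submodule.finrank_map_subtype_eq] at h2
  omega

theorem exists_apply_ne_zero (h : IsSplitForm J j a b) (hN : finrank ℝ N = 1 ∨ finrank ℝ N = 2)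
    (hk : finrank ℝ T ≤ finrank ℝ (complexKernel J b) + 2 * finrank ℝ N) :
    ∃ X ∈ complexKernel J b, ∃ Y ∈ complexKernel J b, a X Y ≠ 0 := by
  by_contra! h0
  obtain ⟨z, -, hz⟩ := h.exists_generators hk _ le_rfl h0
  have h1 := Submodule.finrank_le
    ((complexKernel J b).map (LinearMap.pi fun i ↦ a.flip (z i)))
  rw [finrank_pi_fintype] at h1
  simp only [h.finrank_L, Finset.sum_const, Finset.card_univ, Fintype.card_fin, smul_eq_mul] at h1
  omega

theorem exists_smul_add_smul {j : L →ₗ[ℝ] L} (hj : ∀ v, j (j v) = -v) (hL : finrank ℝ L = 2) {l : L}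
    (hl : l ≠ 0) (m : L) : ∃ s t : ℝ, m = s • l + t • j l := by
  have hli : LinearIndependent ℝ ![l, j l] := by
    rw [LinearIndependent.pair_iff]
    intro s t hst
    have h2 := congrArg j hst
    rw [map_add, map_smul, map_smul, hj, map_zero] at h2
    have h3 : (s ^ 2 + t ^ 2) • l = 0 := by
      calc (s ^ 2 + t ^ 2) • l = s • (s • l + t • j l) - t • (s • j l + t • -l) := by module
        _ = 0 := by rw [hst, h2]; simp
    have h4 := (smul_eq_zero.mp h3).resolve_right hl
    constructor <;> nlinarith [sq_nonneg s, sq_nonneg t]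
  have := hli.span_eq_top_of_card_eq_finrank (by simp [hL])
  have hm : m ∈ Submodule.span ℝ (Set.range ![l, j l]) := this ▸ Submodule.mem_top
  rw [Matrix.range_cons, Matrix.range_cons, Matrix.range_empty, Set.union_empty,
    Set.singleton_union, Submodule.mem_span_pair] at hm
  obtain ⟨s, t, h⟩ := hm
  exact ⟨s, t, h.symm⟩

theorem finrank_map_add_le {U : Type*} [AddCommGroup U] [Module ℝ U] (f : T →ₗ[ℝ] U)
    {D W : Submodule ℝ T} (hDW : D ≤ W) (hD : D ≤ LinearMap.ker f) :
    finrank ℝ (W.map f) + finrank ℝ D ≤ finrank ℝ W := by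
  have h1 := (f.domRestrict W).finrank_range_add_finrank_ker
  rw [LinearMap.range_domRestrict] at h1
  have h2 : finrank ℝ D ≤ finrank ℝ (LinearMap.ker (f.domRestrict W)) := by
    rw [← (Submodule.comapSubtypeEquivOfLe hDW).finrank_eq]
    exact Submodule.finrank_mono fun x hx ↦ hD hx
  omega

theorem eq_zero_or_isHolomorphic (h : IsSplitForm J j a b)
    (hN : finrank ℝ N = 1 ∨ finrank ℝ N = 2)
    (hk : finrank ℝ T ≤ finrank ℝ (complexKernel J b) + 2 * finrank ℝ N)
    (B : T →ₗ[ℝ] L →ₗ[ℝ] N)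
    (hB : ∀ X ∈ complexKernel J b, ∀ Y ∈ complexKernel J b, ∃ W, ∀ Z,
      B X (a Y Z) - b W Z = B Z (a X Y) ∧ B X (a (J Y) Z) - b (J W) Z = B Z (a X (J Y))) :
    (∀ X ∈ complexKernel J b, B X = 0) ∨ IsHolomorphic J b := by
  by_contra! hcon
  obtain ⟨⟨X₀, hX₀, hne⟩, hhol⟩ := hcon
  obtain ⟨l₁, hl₁⟩ : ∃ l, B X₀ l ≠ 0 := by
    by_contra! h0
    exact hne (LinearMap.ext h0)
  set D := complexKernel J b with hDdef
  have hbD : ∀ W, ∀ Z ∈ D, b W Z = 0 := fun W Z hZ ↦ ((mem_complexKernel h.J_sq).mp hZ).1 W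
  have hsym : ∀ X ∈ D, ∀ Y ∈ D, ∀ Z ∈ D, B X (a Y Z) = B Z (a X Y) := fun X hX Y hY Z hZ ↦ by
    obtain ⟨W, hW⟩ := hB X hX Y hY
    rw [← (hW Z).1, hbD W Z hZ, sub_zero]
  let φ : N →ₗ[ℝ] ℝ := innerₗ N (B X₀ l₁)
  have hφ : φ (B X₀ l₁) ≠ 0 := by
    simpa [φ] using hl₁
  let G : T →ₗ[ℝ] (L →ₗ[ℝ] ℝ) := B.compr₂ φ
  let S := D ⊓ LinearMap.ker G
  have hS : finrank ℝ D ≤ finrank ℝ S + 2 := by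
    have h1 := Submodule.finrank_sup_add_finrank_inf_eq D (LinearMap.ker G)
    have h2 := Submodule.finrank_le (D ⊔ LinearMap.ker G)
    have h3 := G.finrank_range_add_finrank_ker
    have h4 := Submodule.finrank_le (LinearMap.range G)
    rw [finrank_linearMap, h.finrank_L, finrank_self] at h4
    change _ + finrank ℝ S = _ at h1
    omega
  have hlvanish : ∀ l, φ (B X₀ l) = 0 → φ (B X₀ (j l)) = 0 → l = 0 := by
    intro l h1 h2
    by_contra hl
    obtain ⟨s, t, hst⟩ := exists_smul_add_smul h.j_sq h.finrank_L hl l₁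
    refine hφ ?_
    have e : B X₀ l₁ = s • B X₀ l + t • B X₀ (j l) := by
      rw [← map_smul, ← map_smul, ← map_add, ← hst]
    rw [e, map_add, map_smul, map_smul, h1, h2]
    simp
  have hSD : ∀ Y ∈ S, ∀ Z ∈ D, a Y Z = 0 := by
    intro Y hY Z hZ
    have hG : ∀ l, φ (B Y l) = 0 := fun l ↦ LinearMap.congr_fun (LinearMap.mem_ker.mp hY.2) l
    have hz : ∀ Z ∈ D, φ (B X₀ (a Y Z)) = 0 := fun Z hZ ↦ by
      rw [h.a_symm, hsym X₀ hX₀ Z hZ Y hY.1, hG]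
    refine hlvanish _ (hz Z hZ) ?_
    have := hz (J Z) (h.J_mem hZ)
    rwa [h.a_J] at this
  rcases h.trichotomy hN with h1 | h1 | ⟨h1, h2, ρ, X, hX⟩
  · obtain ⟨z, -, hz⟩ := h.exists_generators (k := 1) h1 S inf_le_left hSD
    have h3 := Submodule.finrank_le (S.map (LinearMap.pi fun i ↦ a.flip (z i)))
    rw [finrank_pi_fintype] at h3
    simp only [h.finrank_L, Finset.sum_const, Finset.card_univ, Fintype.card_fin,
      smul_eq_mul] at h3
    omega
  · exact hhol h1
  obtain ⟨z, -, hz⟩ := h.exists_generators (k := 2) h2 S inf_le_left hSD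
  have hL2 : finrank ℝ (Fin 2 → L) = 4 := by
    rw [finrank_pi_fintype]; simp [h.finrank_L]
  have hsurj : S.map (LinearMap.pi fun i ↦ a.flip (z i)) = ⊤ := by
    apply Submodule.eq_top_of_finrank_eq
    have h3 := Submodule.finrank_le (S.map (LinearMap.pi fun i ↦ a.flip (z i)))
    omega
  let mu : L → ℂ := fun l ↦ ρ (B X₀ l) - I * ρ (B X₀ (j l))
  let mv : L → ℂ := fun l ↦ conj (ρ (B X₀ l)) - I * conj (ρ (B X₀ (j l)))
  have hprop : ∀ l, mv l₁ * mu l = mu l₁ * mv l := by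
    intro l
    have hl₁0 : l₁ ≠ 0 := by rintro rfl; simp at hl₁
    obtain ⟨s, t, rfl⟩ := exists_smul_add_smul h.j_sq h.finrank_L hl₁0 l
    simp only [mu, mv, map_add, map_smul, h.j_sq, map_neg, real_smul, map_mul, conj_ofReal]
    ring_nf
    simp only [I_sq]
    ring
  let 𝒲 := LinearMap.ker (mv l₁ • typePart J (b.compr₂ ρ.toLinearMap) X -
    mu l₁ • conjTypePart J (b.compr₂ ρ.toLinearMap) X)
  have hmemW : ∀ W, W ∈ 𝒲 ↔ mv l₁ * (ρ (b W X) - I * ρ (b (J W) X)) =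
      mu l₁ * (conj (ρ (b W X)) - I * conj (ρ (b (J W) X))) := fun W ↦ by
    simp [𝒲, typePart_apply, conjTypePart_apply, sub_eq_zero]
  have hbD' : ∀ W ∈ D, ∀ Z, b W Z = 0 := fun W hW Z ↦ by rw [h.b_symm, hbD Z W hW]
  have hDW : D ≤ 𝒲 := fun W hW ↦ by
    rw [hmemW, hbD' W hW, hbD' _ (h.J_mem hW)]
    simp
  let Θ : T →ₗ[ℝ] (Fin 2 → N × N) :=
    LinearMap.pi fun i ↦ (b.flip (z i)).prod (b.flip (z i) ∘ₗ J)
  have hΘ : ∀ W i, Θ W i = (b W (z i), b (J W) (z i)) := fun W i ↦ rfl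
  have hDΘ : D ≤ LinearMap.ker Θ := fun W hW ↦ by
    rw [LinearMap.mem_ker]
    funext i
    rw [hΘ, hbD' W hW, hbD' _ (h.J_mem hW)]
    rfl
  let Λ : (Fin 2 → L) →ₗ[ℝ] (Fin 2 → N × N) :=
    LinearMap.pi fun i ↦ ((B X₀).prod (B X₀ ∘ₗ j)) ∘ₗ LinearMap.proj i
  have hΛ : ∀ l i, Λ l i = (B X₀ (l i), B X₀ (j (l i))) := fun l i ↦ rfl
  have hΛi : Function.Injective Λ := by
    rw [← LinearMap.ker_eq_bot, LinearMap.ker_eq_bot']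
    intro l hl
    funext i
    have := congrFun hl i
    rw [hΛ] at this
    have e1 : B X₀ (l i) = 0 := congrArg Prod.fst this
    have e2 : B X₀ (j (l i)) = 0 := congrArg Prod.snd this
    exact hlvanish _ (by rw [e1, map_zero]) (by rw [e2, map_zero])
  have hrange : LinearMap.range Λ ≤ 𝒲.map Θ := by
    rintro _ ⟨l, rfl⟩
    have : l ∈ S.map (LinearMap.pi fun i ↦ a.flip (z i)) := hsurj ▸ Submodule.mem_top
    obtain ⟨Y, hY, rfl⟩ := this
    obtain ⟨W, hW⟩ := hB X₀ hX₀ Y hY.1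
    have e1 : ∀ Z, b W Z = B X₀ (a Y Z) := fun Z ↦ by
      have := (hW Z).1
      rw [h.a_symm X₀ Y, hSD Y hY X₀ hX₀, map_zero, sub_eq_zero] at this
      exact this.symm
    have e2 : ∀ Z, b (J W) Z = B X₀ (j (a Y Z)) := fun Z ↦ by
      have := (hW Z).2
      rw [h.a_J, h.a_symm X₀ Y, hSD Y hY X₀ hX₀, map_zero, map_zero, sub_eq_zero,
        h.a_symm (J Y), h.a_J, h.a_symm Z Y] at this
      exact this.symm
    refine ⟨W, (hmemW W).mpr ?_, ?_⟩
    · rw [e1, e2]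
      exact hprop _
    · funext i
      rw [hΘ, hΛ, e1, e2]
      rfl
  have h3 := Submodule.finrank_mono hrange
  rw [LinearMap.finrank_range_of_inj hΛi, hL2] at h3
  have h4 := finrank_map_add_le Θ hDW hDΘ
  have hWtop : 𝒲 = ⊤ := by
    apply Submodule.eq_top_of_finrank_eq
    have := Submodule.finrank_le 𝒲
    omega
  have h5 := hX (mv l₁) (-mu l₁) fun Z ↦ by
    have hZ : Z ∈ 𝒲 := hWtop ▸ Submodule.mem_top
    have := LinearMap.mem_ker.mp hZ
    simp only [LinearMap.sub_apply, LinearMap.smul_apply, smul_eq_mul] at this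
    linear_combination this
  have h6 : ρ (B X₀ l₁) = 0 := by
    have e1 : ρ (B X₀ l₁) - I * ρ (B X₀ (j l₁)) = 0 := neg_eq_zero.mp h5.2
    have e2 := congrArg conj (show conj (ρ (B X₀ l₁)) - I * conj (ρ (B X₀ (j l₁))) = 0 from h5.1)
    simp only [map_sub, map_mul, conj_conj, conj_I, map_zero] at e2
    linear_combination (e1 + e2) / 2
  exact hl₁ ((map_eq_zero_iff ρ ρ.injective).mp h6)

end IsSplitForm

end Counting

section Patch

variable {E V : Type*} [NormedAddCommGroup E] [NormedSpace ℝ E]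
  [NormedAddCommGroup V] [InnerProductSpace ℝ V] [FiniteDimensional ℝ V]

theorem fderiv_clm_apply_apply {G : Type*} [NormedAddCommGroup G] [NormedSpace ℝ G]
    {A : E → V →L[ℝ] G} {u : E → V} {z : E} (hA : DifferentiableAt ℝ A z)
    (hu : DifferentiableAt ℝ u z) (v : E) :
    fderiv ℝ (fun y ↦ A y (u y)) z v = fderiv ℝ A z v (u z) + A z (fderiv ℝ u z v) := by
  rw [fderiv_clm_apply hA hu]
  simp [add_comm]

theorem fderiv_fderiv_apply {G : Type*} [NormedAddCommGroup G] [NormedSpace ℝ G]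
    {A : E → G} {z : E} (hA : ContDiffAt ℝ ∞ A z) (w v : E) :
    fderiv ℝ (fun y ↦ fderiv ℝ A y w) z v = fderiv ℝ (fderiv ℝ A) z v w := by
  have h : DifferentiableAt ℝ (fderiv ℝ A) z :=
    (hA.fderiv_right (m := 1) (by norm_cast)).differentiableAt one_ne_zero
  rw [fderiv_clm_apply h (differentiableAt_const w)]
  simp

theorem differentiableAt_fderiv_apply {G : Type*} [NormedAddCommGroup G] [NormedSpace ℝ G]
    {A : E → G} {z : E} (hA : ContDiffAt ℝ ∞ A z) (w : E) :
    DifferentiableAt ℝ (fun y ↦ fderiv ℝ A y w) z := by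
  have h : DifferentiableAt ℝ (fderiv ℝ A) z :=
    (hA.fderiv_right (m := 1) (by norm_cast)).differentiableAt one_ne_zero
  exact h.clm_apply (differentiableAt_const w)

theorem fderiv_fderiv_symm {G : Type*} [NormedAddCommGroup G] [NormedSpace ℝ G]
    {A : E → G} {z : E} (hA : ContDiffAt ℝ ∞ A z) (w v : E) :
    fderiv ℝ (fderiv ℝ A) z v w = fderiv ℝ (fderiv ℝ A) z w v :=
  (hA.isSymmSndFDerivAt (by simp; norm_cast)) v w

/-- `P` is a smooth family of orthogonal projections on `Ω`. -/
structure IsProjectionFamily (Ω : Set E) (P : E → V →L[ℝ] V) : Prop where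
  contDiffOn : ContDiffOn ℝ ∞ P Ω
  idem : ∀ z ∈ Ω, ∀ ξ, P z (P z ξ) = P z ξ
  symm : ∀ z ∈ Ω, ∀ ξ ζ, inner ℝ (P z ξ) ζ = inner ℝ ξ (P z ζ)

theorem fderiv_skew {Ω : Set E} (hΩ : IsOpen Ω) {C : E → V →L[ℝ] V} (hC : ContDiffOn ℝ ∞ C Ω)
    (h : ∀ z ∈ Ω, ∀ ξ ζ, inner ℝ (C z ξ) ζ = -inner ℝ ξ (C z ζ)) {z : E} (hz : z ∈ Ω) (v : E)
    (ξ ζ : V) : inner ℝ (fderiv ℝ C z v ξ) ζ = -inner ℝ ξ (fderiv ℝ C z v ζ) := by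
  have hd : DifferentiableAt ℝ C z :=
    (hC.contDiffAt (hΩ.mem_nhds hz)).differentiableAt (by simp)
  have e : (fun y ↦ inner ℝ (C y ξ) ζ) =ᶠ[𝓝 z] fun y ↦ -inner ℝ ξ (C y ζ) := by
    filter_upwards [hΩ.mem_nhds hz] with y hy using h y hy ξ ζ
  have e2 := congrArg (fun A : E →L[ℝ] ℝ ↦ A v) e.fderiv_eq
  have hξ := hd.clm_apply (differentiableAt_const ξ)
  have hζ := hd.clm_apply (differentiableAt_const ζ)
  rw [fderiv_fun_neg] at e2
  simp only [neg_apply] at e2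
  rw [fderiv_inner_apply _ hξ (differentiableAt_const ζ),
    fderiv_inner_apply _ (differentiableAt_const ξ) hζ,
    fderiv_clm_apply_apply hd (differentiableAt_const ξ),
    fderiv_clm_apply_apply hd (differentiableAt_const ζ)] at e2
  simpa using e2

namespace IsProjectionFamily

variable {Ω : Set E} {P : E → V →L[ℝ] V} (h : IsProjectionFamily Ω P) (hΩ : IsOpen Ω) {z : E}
  (hz : z ∈ Ω)

include h hΩ hz in
theorem contDiffAt : ContDiffAt ℝ ∞ P z := h.contDiffOn.contDiffAt (hΩ.mem_nhds hz)

include h hΩ hz in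
theorem differentiableAt : DifferentiableAt ℝ P z :=
  (h.contDiffAt hΩ hz).differentiableAt (by simp)

include h hΩ hz in
theorem fderiv_add (v : E) (ξ : V) :
    fderiv ℝ P z v (P z ξ) + P z (fderiv ℝ P z v ξ) = fderiv ℝ P z v ξ := by
  have hd := h.differentiableAt hΩ hz
  have hξ := hd.clm_apply (differentiableAt_const ξ)
  have e : (fun y ↦ P y (P y ξ)) =ᶠ[𝓝 z] fun y ↦ P y ξ := by
    filter_upwards [hΩ.mem_nhds hz] with y hy using h.idem y hy ξ
  have e2 := congrArg (fun A : E →L[ℝ] V ↦ A v) e.fderiv_eq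
  simp only [fderiv_clm_apply_apply hd hξ, fderiv_clm_apply_apply hd (differentiableAt_const ξ)]
    at e2
  simpa using e2

include h hΩ hz in
theorem proj_fderiv_proj (v : E) (ξ : V) : P z (fderiv ℝ P z v (P z ξ)) = 0 := by
  have := h.fderiv_add hΩ hz v (P z ξ)
  rw [h.idem z hz] at this
  simpa using this

include h hΩ hz in
theorem proj_fderiv_of_eq_zero (v : E) {ξ : V} (hξ : P z ξ = 0) :
    P z (fderiv ℝ P z v ξ) = fderiv ℝ P z v ξ := by
  have := h.fderiv_add hΩ hz v ξ
  rwa [hξ, map_zero, zero_add] at this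

include h hz in
theorem inner_eq_zero {ξ ζ : V} (hξ : P z ξ = 0) (hζ : P z ζ = ζ) : inner ℝ ξ ζ = 0 := by
  rw [← hζ, ← h.symm z hz, hξ, inner_zero_left]

end IsProjectionFamily

/-- The coordinate expression `F` of an isometric immersion of a Kaehler manifold, with the
projections `P` to the tangent spaces and the complex structures `C` of the tangent spaces, extended
by zero to the normal spaces. -/
structure IsKaehlerPatch (Ω : Set E) (F : E → V) (P C : E → V →L[ℝ] V) : Prop where
  isOpen : IsOpen Ω
  contDiffOn : ContDiffOn ℝ ∞ F Ω
  proj : IsProjectionFamily Ω P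
  proj_tangent : ∀ z ∈ Ω, ∀ w, P z (fderiv ℝ F z w) = fderiv ℝ F z w
  exists_tangent : ∀ z ∈ Ω, ∀ ξ, ∃ w, fderiv ℝ F z w = P z ξ
  contDiffOn_C : ContDiffOn ℝ ∞ C Ω
  proj_C : ∀ z ∈ Ω, ∀ ξ, P z (C z ξ) = C z ξ
  C_proj : ∀ z ∈ Ω, ∀ ξ, C z (P z ξ) = C z ξ
  C_sq : ∀ z ∈ Ω, ∀ ξ, C z (C z ξ) = -P z ξ
  C_skew : ∀ z ∈ Ω, ∀ ξ ζ, inner ℝ (C z ξ) ζ = -inner ℝ ξ (C z ζ)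
  parallel : ∀ z ∈ Ω, ∀ v w, P z (fderiv ℝ (fun y ↦ C y (fderiv ℝ F y w)) z v) =
    C z (fderiv ℝ (fun y ↦ fderiv ℝ F y w) z v)

namespace IsKaehlerPatch

variable {Ω : Set E} {F : E → V} {P C : E → V →L[ℝ] V} (h : IsKaehlerPatch Ω F P C) {z : E}
  (hz : z ∈ Ω)

include h hz in
theorem contDiffAt : ContDiffAt ℝ ∞ F z := h.contDiffOn.contDiffAt (h.isOpen.mem_nhds hz)

include h hz in
theorem contDiffAt_C : ContDiffAt ℝ ∞ C z := h.contDiffOn_C.contDiffAt (h.isOpen.mem_nhds hz)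

include h hz in
theorem differentiableAt_C : DifferentiableAt ℝ C z :=
  (h.contDiffAt_C hz).differentiableAt (by simp)

include h hz in
theorem fderiv_fderiv_sub (v w : E) :
    fderiv ℝ (fderiv ℝ F) z v w - P z (fderiv ℝ (fderiv ℝ F) z v w) =
      fderiv ℝ P z v (fderiv ℝ F z w) := by
  have hd := h.proj.differentiableAt h.isOpen hz
  have e : (fun y ↦ P y (fderiv ℝ F y w)) =ᶠ[𝓝 z] fun y ↦ fderiv ℝ F y w := by
    filter_upwards [h.isOpen.mem_nhds hz] with y hy using h.proj_tangent y hy w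
  have e2 := congrArg (fun A : E →L[ℝ] V ↦ A v) e.fderiv_eq
  simp only [fderiv_clm_apply_apply hd (differentiableAt_fderiv_apply (h.contDiffAt hz) w),
    fderiv_fderiv_apply (h.contDiffAt hz)] at e2
  exact (eq_sub_of_add_eq e2).symm

include h hz in
theorem sff_symm (v w : E) :
    fderiv ℝ P z v (fderiv ℝ F z w) = fderiv ℝ P z w (fderiv ℝ F z v) := by
  rw [← h.fderiv_fderiv_sub hz, ← h.fderiv_fderiv_sub hz, fderiv_fderiv_symm (h.contDiffAt hz)]

include h hz in
theorem fderiv_C_tangent (v w : E) :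
    fderiv ℝ C z v (fderiv ℝ F z w) = fderiv ℝ P z v (C z (fderiv ℝ F z w)) := by
  have hd := h.differentiableAt_C hz
  have hw := differentiableAt_fderiv_apply (h.contDiffAt hz) w
  have hCw := hd.clm_apply hw
  have e1 := fderiv_clm_apply_apply hd hw v
  have e2 := h.parallel z hz v w
  have e : (fun y ↦ P y (C y (fderiv ℝ F y w))) =ᶠ[𝓝 z] fun y ↦ C y (fderiv ℝ F y w) := by
    filter_upwards [h.isOpen.mem_nhds hz] with y hy using h.proj_C y hy _
  have e3 := congrArg (fun A : E →L[ℝ] V ↦ A v) e.fderiv_eq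
  simp only [fderiv_clm_apply_apply (h.proj.differentiableAt h.isOpen hz) hCw] at e3
  rw [e2] at e3
  rw [e1] at e3
  exact (add_right_cancel e3).symm

include h hz in
theorem proj_fderiv_C_tangent (v w : E) : P z (fderiv ℝ C z v (fderiv ℝ F z w)) = 0 := by
  rw [h.fderiv_C_tangent hz, ← h.proj_C z hz, h.proj.proj_fderiv_proj h.isOpen hz]

include h hz in
theorem inner_fderiv_fderiv {ξ : V} (hξ : P z ξ = 0) (v w : E) :
    inner ℝ (fderiv ℝ (fderiv ℝ F) z v w) ξ = inner ℝ (fderiv ℝ P z v (fderiv ℝ F z w)) ξ := by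
  rw [← h.fderiv_fderiv_sub hz, inner_sub_left, h.proj.symm z hz, hξ, inner_zero_right, sub_zero]

include h hz in
theorem inner_fderiv_fderiv_C (v w a b : E) :
    inner ℝ (fderiv ℝ (fderiv ℝ C) z w v (fderiv ℝ F z a)) (fderiv ℝ F z b) =
      inner ℝ (fderiv ℝ P z w (fderiv ℝ F z a)) (fderiv ℝ P z v (C z (fderiv ℝ F z b))) -
      inner ℝ (fderiv ℝ P z v (C z (fderiv ℝ F z a))) (fderiv ℝ P z w (fderiv ℝ F z b)) := by
  have hCv := differentiableAt_fderiv_apply (h.contDiffAt_C hz) v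
  have ha := differentiableAt_fderiv_apply (h.contDiffAt hz) a
  have hb := differentiableAt_fderiv_apply (h.contDiffAt hz) b
  have e : (fun y ↦ inner ℝ (fderiv ℝ C y v (fderiv ℝ F y a)) (fderiv ℝ F y b))
      =ᶠ[𝓝 z] fun _ ↦ (0 : ℝ) := by
    filter_upwards [h.isOpen.mem_nhds hz] with y hy
    exact h.proj.inner_eq_zero hy (h.proj_fderiv_C_tangent hy v a) (h.proj_tangent y hy b)
  have e2 := congrArg (fun A : E →L[ℝ] ℝ ↦ A w) e.fderiv_eq
  rw [fderiv_inner_apply _ (hCv.clm_apply ha) hb, fderiv_clm_apply_apply hCv ha,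
    fderiv_fderiv_apply (h.contDiffAt_C hz), fderiv_fderiv_apply (h.contDiffAt hz),
    fderiv_fderiv_apply (h.contDiffAt hz), inner_add_left] at e2
  have e3 : inner ℝ (fderiv ℝ C z v (fderiv ℝ (fderiv ℝ F) z w a)) (fderiv ℝ F z b) =
      -inner ℝ (fderiv ℝ P z w (fderiv ℝ F z a)) (fderiv ℝ P z v (C z (fderiv ℝ F z b))) := by
    rw [fderiv_skew h.isOpen h.contDiffOn_C h.C_skew hz,
      h.inner_fderiv_fderiv hz (h.proj_fderiv_C_tangent hz v b), h.fderiv_C_tangent hz]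
  have e4 : inner ℝ (fderiv ℝ C z v (fderiv ℝ F z a)) (fderiv ℝ (fderiv ℝ F) z w b) =
      inner ℝ (fderiv ℝ P z v (C z (fderiv ℝ F z a))) (fderiv ℝ P z w (fderiv ℝ F z b)) := by
    rw [real_inner_comm, h.inner_fderiv_fderiv hz (h.proj_fderiv_C_tangent hz v a),
      h.fderiv_C_tangent hz, real_inner_comm]
  rw [e3, e4] at e2
  simp only [fderiv_fun_const, Pi.zero_apply, zero_apply] at e2
  linarith

include h hz in
/-- The Gauss equation of a Kaehler submanifold: the curvature tensor commutes with the complex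
structure. -/
theorem gauss (v w a b : E) :
    inner ℝ (fderiv ℝ P z w (fderiv ℝ F z a)) (fderiv ℝ P z v (C z (fderiv ℝ F z b))) -
      inner ℝ (fderiv ℝ P z v (C z (fderiv ℝ F z a))) (fderiv ℝ P z w (fderiv ℝ F z b)) =
    inner ℝ (fderiv ℝ P z v (fderiv ℝ F z a)) (fderiv ℝ P z w (C z (fderiv ℝ F z b))) -
      inner ℝ (fderiv ℝ P z w (C z (fderiv ℝ F z a))) (fderiv ℝ P z v (fderiv ℝ F z b)) := by
  rw [← h.inner_fderiv_fderiv_C hz, ← h.inner_fderiv_fderiv_C hz,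
    fderiv_fderiv_symm (h.contDiffAt_C hz)]

include h hz in
/-- The Codazzi equation for a section `u` of the kernel of the component of the second fundamental
form in the complement of the range of `Λ`. -/
theorem codazzi {Λ : E → V →L[ℝ] V} (hΛ : IsProjectionFamily Ω Λ)
    (hPΛ : ∀ y ∈ Ω, ∀ ξ, P y (Λ y ξ) = 0) (hΛP : ∀ y ∈ Ω, ∀ ξ, Λ y (P y ξ) = 0)
    {u : E → V} (hu : DifferentiableAt ℝ u z) (huP : P z (u z) = u z)
    (hker : ∀ᶠ y in 𝓝 z, ∀ c, (1 - P y - Λ y) (fderiv ℝ P y c (u y)) = 0)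
    {X : E} (hX : ∀ ξ, (1 - P z - Λ z) (fderiv ℝ P z X (P z ξ)) = 0) (c : E) :
    (1 - P z - Λ z) (fderiv ℝ Λ z X (fderiv ℝ P z c (u z))) -
      (1 - P z - Λ z) (fderiv ℝ P z c (P z (fderiv ℝ u z X))) =
    (1 - P z - Λ z) (fderiv ℝ Λ z c (fderiv ℝ P z X (u z))) := by
  have hNN : ∀ ξ, (1 - P z - Λ z) ((1 - P z - Λ z) ξ) = (1 - P z - Λ z) ξ := fun ξ ↦ by
    simp [h.proj.idem z hz, hΛ.idem z hz, hPΛ z hz, hΛP z hz]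
  have hNP : ∀ ξ, (1 - P z - Λ z) (P z ξ) = 0 := fun ξ ↦ by
    simp [h.proj.idem z hz, hΛP z hz]
  have hdP := h.proj.differentiableAt h.isOpen hz
  have hdΛ := hΛ.differentiableAt h.isOpen hz
  have key : ∀ c X, (1 - P z - Λ z) (fderiv ℝ (fderiv ℝ P) z X c (u z)) +
      (1 - P z - Λ z) (fderiv ℝ P z c (P z (fderiv ℝ u z X))) =
      (1 - P z - Λ z) (fderiv ℝ Λ z X (fderiv ℝ P z c (u z))) := by
    intro c X
    have hPc := differentiableAt_fderiv_apply (h.proj.contDiffAt h.isOpen hz) c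
    have hN : DifferentiableAt ℝ (fun y ↦ 1 - P y - Λ y) z :=
      ((differentiableAt_const _).sub hdP).sub hdΛ
    have hDN : fderiv ℝ (fun y ↦ 1 - P y - Λ y) z X = -fderiv ℝ P z X - fderiv ℝ Λ z X := by
      have hP1 : DifferentiableAt ℝ (fun y ↦ 1 - P y) z := (differentiableAt_const _).sub hdP
      rw [fderiv_fun_sub hP1 hdΛ, fderiv_fun_sub (differentiableAt_const _) hdP]
      simp
    have e : (fun y ↦ (1 - P y - Λ y) (fderiv ℝ P y c (u y))) =ᶠ[𝓝 z] fun _ ↦ (0 : V) := by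
      filter_upwards [hker] with y hy using hy c
    have e2 := congrArg (fun A : E →L[ℝ] V ↦ A X) e.fderiv_eq
    simp only [fderiv_fun_const, Pi.zero_apply, zero_apply] at e2
    rw [fderiv_clm_apply_apply hN (hPc.clm_apply hu), hDN, fderiv_clm_apply_apply hPc hu,
      fderiv_fderiv_apply (h.proj.contDiffAt h.isOpen hz)] at e2
    have hDNa : ∀ ξ, (-fderiv ℝ P z X - fderiv ℝ Λ z X) ξ =
        -fderiv ℝ P z X ξ - fderiv ℝ Λ z X ξ := fun _ ↦ rfl
    rw [hDNa] at e2
    have e3 := congrArg (fun ξ ↦ (1 - P z - Λ z) ξ) e2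
    have e4 : P z (fderiv ℝ P z c (u z)) = 0 := by
      rw [← huP, h.proj.proj_fderiv_proj h.isOpen hz]
    have e5 : (1 - P z - Λ z) (fderiv ℝ P z X (fderiv ℝ P z c (u z))) = 0 := by
      rw [← h.proj.proj_fderiv_of_eq_zero h.isOpen hz X e4, hNP]
    have e6 : (1 - P z - Λ z) (fderiv ℝ P z c (fderiv ℝ u z X)) =
        (1 - P z - Λ z) (fderiv ℝ P z c (P z (fderiv ℝ u z X))) := by
      rw [← sub_eq_zero, ← map_sub, ← map_sub]
      rw [← h.proj.proj_fderiv_of_eq_zero h.isOpen hz c (by simp [h.proj.idem z hz]), hNP]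
    simp only [map_zero] at e3
    rw [map_add, hNN, map_add, e6, map_sub, map_neg, e5, neg_zero, zero_sub] at e3
    rw [neg_add_eq_zero] at e3
    exact e3.symm
  rw [← key c X, ← key X c, hX, fderiv_fderiv_symm (h.proj.contDiffAt h.isOpen hz)]
  abel

/-- If the second fundamental form is complex bilinear for a complex structure `j` of the normal
spaces, then the complex structure `C + j` of the ambient space is constant. -/
theorem fderiv_add_eq_zero {O : Set E} (hO : IsOpen O) (hOΩ : O ⊆ Ω) {j : E → V →L[ℝ] V}
    (h : IsKaehlerPatch Ω F P C)
    (hj : ContDiffOn ℝ ∞ j O) (hskew : ∀ y ∈ O, ∀ ξ ζ, inner ℝ (j y ξ) ζ = -inner ℝ ξ (j y ζ))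
    (hjP : ∀ y ∈ O, ∀ ξ, j y (P y ξ) = 0)
    (hjα : ∀ y ∈ O, ∀ v ξ, j y (fderiv ℝ P y v (P y ξ)) = fderiv ℝ P y v (C y ξ))
    (hN : ∀ y ∈ O, ∀ ξ, P y ξ = 0 →
      (∀ v w, inner ℝ ξ (fderiv ℝ P y v (fderiv ℝ F y w)) = 0) → ξ = 0)
    {z : E} (hz : z ∈ O) : fderiv ℝ (fun y ↦ C y + j y) z = 0 := by
  set K : E → V →L[ℝ] V := fun y ↦ C y + j y with hKdef
  have hK : ContDiffOn ℝ ∞ K O := (h.contDiffOn_C.mono hOΩ).add hj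
  have hKskew : ∀ y ∈ O, ∀ ξ ζ, inner ℝ (K y ξ) ζ = -inner ℝ ξ (K y ζ) := fun y hy ξ ζ ↦ by
    simp only [hKdef, add_apply, inner_add_left, inner_add_right,
      h.C_skew y (hOΩ hy) ξ ζ, hskew y hy ξ ζ]
    ring
  have hk1 : ∀ y ∈ O, ∀ v w, fderiv ℝ K y v (fderiv ℝ F y w) = 0 := by
    intro y hy v w
    have hdj : DifferentiableAt ℝ j y :=
      (hj.contDiffAt (hO.mem_nhds hy)).differentiableAt (by simp)
    have hw := differentiableAt_fderiv_apply (h.contDiffAt (hOΩ hy)) w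
    have e : (fun x ↦ j x (fderiv ℝ F x w)) =ᶠ[𝓝 y] fun _ ↦ (0 : V) := by
      filter_upwards [hO.mem_nhds hy] with x hx
      rw [← h.proj_tangent x (hOΩ hx), hjP x hx]
    have e2 := congrArg (fun A : E →L[ℝ] V ↦ A v) e.fderiv_eq
    simp only [fderiv_fun_const, Pi.zero_apply, zero_apply] at e2
    rw [fderiv_clm_apply_apply hdj hw, fderiv_fderiv_apply (h.contDiffAt (hOΩ hy))] at e2
    have e3 : j y (fderiv ℝ (fderiv ℝ F) y v w) = fderiv ℝ C y v (fderiv ℝ F y w) := by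
      rw [h.fderiv_C_tangent (hOΩ hy), ← hjα y hy, h.proj_tangent y (hOΩ hy),
        ← h.fderiv_fderiv_sub (hOΩ hy), map_sub, hjP y hy, sub_zero]
    rw [hKdef, fderiv_fun_add (h.differentiableAt_C (hOΩ hy)) hdj]
    rw [e3] at e2
    simp only [add_apply]
    rw [add_comm]
    exact e2
  have hKz : ContDiffAt ℝ ∞ K z := hK.contDiffAt (hO.mem_nhds hz)
  have hFz := h.contDiffAt (hOΩ hz)
  set α : E → E → V := fun v w ↦ fderiv ℝ P z v (fderiv ℝ F z w) with hα
  set k : E → V →L[ℝ] V := fun v ↦ fderiv ℝ K z v with hk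
  have hks : ∀ v ξ ζ, inner ℝ (k v ξ) ζ = -inner ℝ ξ (k v ζ) := fun v ξ ζ ↦
    fderiv_skew hO hK hKskew hz v ξ ζ
  have hkP : ∀ v ξ, k v (P z ξ) = 0 := fun v ξ ↦ by
    obtain ⟨w, hw⟩ := h.exists_tangent z (hOΩ hz) ξ
    rw [← hw]
    exact hk1 z hz v w
  have hPk : ∀ v ξ, P z (k v ξ) = 0 := fun v ξ ↦ by
    apply ext_inner_right ℝ
    intro ζ
    rw [h.proj.symm z (hOΩ hz), hks, hkP, inner_zero_right, neg_zero, inner_zero_left]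
  have s1 : ∀ v w a, k v (α w a) = k w (α v a) := by
    intro v w a
    have key : ∀ v w, fderiv ℝ (fderiv ℝ K) z w v (fderiv ℝ F z a) + k v (α w a) = 0 := by
      intro v w
      have e : (fun x ↦ fderiv ℝ K x v (fderiv ℝ F x a)) =ᶠ[𝓝 z] fun _ ↦ (0 : V) := by
        filter_upwards [hO.mem_nhds hz] with x hx using hk1 x hx v a
      have e2 := congrArg (fun A : E →L[ℝ] V ↦ A w) e.fderiv_eq
      simp only [fderiv_fun_const, Pi.zero_apply, zero_apply] at e2
      rw [fderiv_clm_apply_apply (differentiableAt_fderiv_apply hKz v)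
        (differentiableAt_fderiv_apply hFz a), fderiv_fderiv_apply hKz,
        fderiv_fderiv_apply hFz] at e2
      rw [hα]
      simp only
      rw [← h.fderiv_fderiv_sub (hOΩ hz), map_sub, hkP, sub_zero]
      exact e2
    have e1 := key v w
    have e2 := key w v
    rw [fderiv_fderiv_symm hKz] at e1
    exact add_left_cancel (e1.trans e2.symm)
  have s2 : ∀ w a, α w a = α a w := fun w a ↦ h.sff_symm (hOΩ hz) w a
  have hS : ∀ v w a b c, inner ℝ (k v (α w a)) (α b c) = 0 := by
    intro v w a b c
    set S : E → E → E → E → E → ℝ := fun v w a b c ↦ inner ℝ (k v (α w a)) (α b c) with hSdef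
    have a1 : ∀ v w a b c, S v w a b c = S w v a b c := fun v w a b c ↦ by
      simp only [hSdef]; rw [s1]
    have a2 : ∀ v w a b c, S v w a b c = -S v b c w a := fun v w a b c ↦ by
      simp only [hSdef]; rw [hks, real_inner_comm]
    have a3 : ∀ v w a b c, S v w a b c = S v a w b c := fun v w a b c ↦ by
      simp only [hSdef]; rw [s2]
    have a4 : ∀ v w a b c, S v w a b c = S b w a v c := fun v w a b c ↦ by
      rw [a2, a1, a2, neg_neg]
    have a5 : ∀ v w a b c, S v w a b c = S v w a c b := fun v w a b c ↦ by
      simp only [hSdef]; rw [s2 b c]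
    have a6 : ∀ v w a b c, S v w a b c = S v b a w c := fun v w a b c ↦ by
      rw [a1, a4, a1]
    have a7 : ∀ v w a b c, S v w a b c = S v b c w a := fun v w a b c ↦ by
      rw [a6, a3, a5, a6, a3, a5]
    have e1 := a2 v w a b c
    have e2 := a7 v w a b c
    change S v w a b c = 0
    linarith
  have hkα : ∀ v w a, k v (α w a) = 0 := fun v w a ↦
    hN z hz _ (hPk v _) fun b c ↦ hS v w a b c
  ext v ξ
  refine hN z hz _ (hPk v ξ) fun b c ↦ ?_
  rw [hks, hkα, inner_zero_right, neg_zero]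

end IsKaehlerPatch

end Patch

section Families

variable {E V : Type*} [NormedAddCommGroup E] [NormedSpace ℝ E]
  [NormedAddCommGroup V] [InnerProductSpace ℝ V] [FiniteDimensional ℝ V]

/-- A family of operators which is determined by its values on the columns of a smooth injective
family `S`, and vanishes on the orthogonal complement of the range of `S`, is smooth. -/
theorem contDiffOn_of_frame {G W : Type*} [NormedAddCommGroup G] [InnerProductSpace ℝ G]
    [FiniteDimensional ℝ G] [NormedAddCommGroup W] [NormedSpace ℝ W] {Ω : Set E}
    {S : E → G →L[ℝ] V} {S' : E → G →L[ℝ] W} {A : E → V →L[ℝ] W}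
    (hS : ContDiffOn ℝ ∞ S Ω) (hS' : ContDiffOn ℝ ∞ S' Ω)
    (hinj : ∀ z ∈ Ω, Function.Injective (S z)) (hA : ∀ z ∈ Ω, ∀ c, A z (S z c) = S' z c)
    (hA' : ∀ z ∈ Ω, ∀ ξ, (∀ c, inner ℝ (S z c) ξ = 0) → A z ξ = 0) : ContDiffOn ℝ ∞ A Ω := by
  let adj : (G →L[ℝ] V) →ₗ[ℝ] (V →L[ℝ] G) :=
    { toFun := fun T ↦ ContinuousLinearMap.adjoint T
      map_add' := fun T T' ↦ by simp
      map_smul' := fun r T ↦ by simp }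
  have hadj : ContDiffOn ℝ ∞ (fun z ↦ ContinuousLinearMap.adjoint (S z)) Ω :=
    (LinearMap.toContinuousLinearMap adj).contDiff.comp_contDiffOn hS
  have hgram : ContDiffOn ℝ ∞ (fun z ↦ (ContinuousLinearMap.adjoint (S z)).comp (S z)) Ω :=
    hadj.clm_comp hS
  have hgi : ∀ z ∈ Ω, ∀ c, ContinuousLinearMap.adjoint (S z) (S z c) = 0 → c = 0 := by
    intro z hz c hc
    have : inner ℝ (S z c) (S z c) = 0 := by
      rw [← ContinuousLinearMap.adjoint_inner_left, hc, inner_zero_left]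
    exact (map_eq_zero_iff (S z) (hinj z hz)).mp (inner_self_eq_zero.mp this)
  have hunit : ∀ z ∈ Ω, IsUnit ((ContinuousLinearMap.adjoint (S z)).comp (S z) : G →L[ℝ] G) := by
    intro z hz
    rw [ContinuousLinearMap.isUnit_iff_bijective]
    have hi : Function.Injective
        ((ContinuousLinearMap.adjoint (S z)).comp (S z) : G →L[ℝ] G).toLinearMap := by
      rw [← LinearMap.ker_eq_bot, LinearMap.ker_eq_bot']
      exact fun c hc ↦ hgi z hz c hc
    exact ⟨hi, LinearMap.injective_iff_surjective.mp hi⟩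
  have hinv : ContDiffOn ℝ ∞
      (fun z ↦ Ring.inverse ((ContinuousLinearMap.adjoint (S z)).comp (S z) : G →L[ℝ] G)) Ω := by
    intro z hz
    obtain ⟨x, hx⟩ := hunit z hz
    have := contDiffAt_ringInverse ℝ (n := ∞) x
    rw [hx] at this
    exact this.comp_contDiffWithinAt z (hgram z hz)
  refine ((hS'.clm_comp hinv).clm_comp hadj).congr fun z hz ↦ ?_
  ext ξ
  set g : G →L[ℝ] G := (ContinuousLinearMap.adjoint (S z)).comp (S z) with hg
  have hgg : ∀ c, g (Ring.inverse g c) = c := fun c ↦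
    congrArg (fun B : G →L[ℝ] G ↦ B c) (Ring.mul_inverse_cancel _ (hunit z hz))
  set c := Ring.inverse g (ContinuousLinearMap.adjoint (S z) ξ) with hc
  have h1 : A z (ξ - S z c) = 0 := by
    refine hA' z hz _ fun d ↦ ?_
    rw [← ContinuousLinearMap.adjoint_inner_right, map_sub]
    have : ContinuousLinearMap.adjoint (S z) (S z c) = ContinuousLinearMap.adjoint (S z) ξ :=
      hgg _
    rw [this, sub_self, inner_zero_right]
  rw [map_sub, sub_eq_zero, hA z hz] at h1
  exact h1

/-- The explicit form of an isometric complex structure of a plane. -/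
theorem complexStructure_eq {L : Submodule ℝ V} (hL : finrank ℝ L = 2) {j : V →L[ℝ] V}
    (hjL : ∀ ξ, j ξ ∈ L) (hj0 : ∀ ξ ∈ Lᗮ, j ξ = 0)
    (hsq : ∀ ξ ∈ L, j (j ξ) = -ξ) (hskew : ∀ ξ ζ, inner ℝ (j ξ) ζ = -inner ℝ ξ (j ζ))
    {t : V} (ht : t ∈ L) (ht0 : t ≠ 0) (ξ : V) :
    j ξ = (inner ℝ t t : ℝ)⁻¹ • ((inner ℝ t ξ : ℝ) • j t - (inner ℝ (j t) ξ : ℝ) • t) := by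
  have htt : (inner ℝ t t : ℝ) ≠ 0 := inner_self_ne_zero.mpr ht0
  have htj : (inner ℝ t (j t) : ℝ) = 0 := by
    have := hskew t t
    rw [real_inner_comm] at this
    linarith
  have hjj : (inner ℝ (j t) (j t) : ℝ) = inner ℝ t t := by
    rw [hskew, hsq t ht, inner_neg_right, neg_neg]
  obtain ⟨ξ₁, h1, ξ₂, h2, rfl⟩ := L.exists_add_mem_mem_orthogonal ξ
  obtain ⟨r, s, hrs⟩ := IsSplitForm.exists_smul_add_smul (L := L)
    (j := (j.toLinearMap.domRestrict L).codRestrict L fun ξ ↦ hjL ξ)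
    (fun v ↦ Subtype.ext (hsq v v.2)) hL (l := ⟨t, ht⟩) (by simpa using ht0) ⟨ξ₁, h1⟩
  have hrs' : ξ₁ = r • t + s • j t := congrArg Subtype.val hrs
  rw [map_add, hj0 ξ₂ h2, inner_add_right, inner_add_right, h2 t ht, h2 _ (hjL t), hrs']
  simp only [map_add, map_smul, hsq t ht, inner_add_right, inner_smul_right, htj, hjj,
    real_inner_comm t (j t)]
  simp only [mul_zero, add_zero, zero_add]
  rw [smul_sub, smul_smul, smul_smul]
  field_simp
  module

theorem contDiffAt_complexStructure {L : E → Submodule ℝ V} {j : E → V →L[ℝ] V} {t s : E → V}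
    {z : E} (ht : ContDiffAt ℝ ∞ t z) (hs : ContDiffAt ℝ ∞ s z) (ht0 : t z ≠ 0)
    (h : ∀ᶠ y in 𝓝 z, finrank ℝ (L y) = 2 ∧ (∀ ξ, j y ξ ∈ L y) ∧ (∀ ξ ∈ (L y)ᗮ, j y ξ = 0) ∧
      (∀ ξ ∈ L y, j y (j y ξ) = -ξ) ∧ (∀ ξ ζ, inner ℝ (j y ξ) ζ = -inner ℝ ξ (j y ζ)) ∧
      t y ∈ L y ∧ s y = j y (t y)) : ContDiffAt ℝ ∞ j z := by
  have hev : j =ᶠ[𝓝 z] fun y ↦ (inner ℝ (t y) (t y) : ℝ)⁻¹ •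
      ((innerSL ℝ (t y)).smulRight (s y) - (innerSL ℝ (s y)).smulRight (t y)) := by
    filter_upwards [h, ht.continuousAt.eventually_ne ht0] with y ⟨h1, h2, h3, h4, h5, h6, h7⟩ h0
    ext ξ
    rw [complexStructure_eq h1 h2 h3 h4 h5 h6 h0, h7]
    simp
  refine ContDiffAt.congr_of_eventuallyEq ?_ hev
  have hin : ∀ {w : E → V}, ContDiffAt ℝ ∞ w z → ContDiffAt ℝ ∞ (fun y ↦ innerSL ℝ (w y)) z :=
    fun hw ↦ (innerSL ℝ (E := V)).contDiff.contDiffAt.comp z hw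
  exact ((ht.inner ℝ ht).inv (inner_self_ne_zero.mpr ht0)).smul
    (((hin ht).smulRight hs).sub ((hin hs).smulRight ht))

/-- An isometric complex structure on a bundle of planes is parallel. -/
theorem proj_fderiv_complexStructure {Ω : Set E} (hΩ : IsOpen Ω) {Λ j : E → V →L[ℝ] V}
    {L : Submodule ℝ V} (hΛ : IsProjectionFamily Ω Λ) (hj : ContDiffOn ℝ ∞ j Ω)
    (hskew : ∀ y ∈ Ω, ∀ ξ ζ, inner ℝ (j y ξ) ζ = -inner ℝ ξ (j y ζ))
    (hjΛ : ∀ y ∈ Ω, ∀ ξ, j y (Λ y ξ) = j y ξ) (hΛj : ∀ y ∈ Ω, ∀ ξ, Λ y (j y ξ) = j y ξ)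
    (hsq : ∀ y ∈ Ω, ∀ ξ, j y (j y ξ) = -Λ y ξ) {z : E} (hz : z ∈ Ω) (hL : finrank ℝ L = 2)
    (hLΛ : ∀ ξ, ξ ∈ L ↔ Λ z ξ = ξ) (X : E) {η : V} (hη : η ∈ L) :
    Λ z (fderiv ℝ j z X η) = 0 := by
  have hd : DifferentiableAt ℝ j z := (hj.contDiffAt (hΩ.mem_nhds hz)).differentiableAt (by simp)
  set κ : V → V := fun ξ ↦ Λ z (fderiv ℝ j z X ξ) with hκ
  have hκL : ∀ ξ, κ ξ ∈ L := fun ξ ↦ (hLΛ _).mpr (hΛ.idem z hz _)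
  have hjL : ∀ ξ, j z ξ ∈ L := fun ξ ↦ (hLΛ _).mpr (hΛj z hz ξ)
  have hanti : ∀ ξ ∈ L, κ (j z ξ) = -j z (κ ξ) := by
    intro ξ hξ
    have hξ' := (hLΛ ξ).mp hξ
    have hjξ := hd.clm_apply (differentiableAt_const ξ)
    have hΛξ := (hΛ.differentiableAt hΩ hz).clm_apply (differentiableAt_const ξ)
    have e : (fun y ↦ j y (j y ξ)) =ᶠ[𝓝 z] fun y ↦ -Λ y ξ := by
      filter_upwards [hΩ.mem_nhds hz] with y hy using hsq y hy ξ
    have e2 := congrArg (fun A : E →L[ℝ] V ↦ Λ z (A X)) e.fderiv_eq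
    rw [fderiv_fun_neg] at e2
    simp only [neg_apply] at e2
    rw [fderiv_clm_apply_apply hd hjξ, fderiv_clm_apply_apply hd (differentiableAt_const ξ),
      fderiv_clm_apply_apply (hΛ.differentiableAt hΩ hz) (differentiableAt_const ξ)] at e2
    simp only [fderiv_fun_const, Pi.zero_apply, zero_apply, map_zero, add_zero, map_add,
      map_neg] at e2
    have e3 : Λ z (fderiv ℝ Λ z X ξ) = 0 := by
      rw [← hξ', hΛ.proj_fderiv_proj hΩ hz]
    rw [e3, neg_zero, hΛj z hz, ← hjΛ z hz (fderiv ℝ j z X ξ)] at e2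
    exact eq_neg_of_add_eq_zero_left e2
  have hinner : ∀ ξ ∈ L, ∀ ζ, inner ℝ (κ ζ) ξ = -inner ℝ ζ (fderiv ℝ j z X ξ) := by
    intro ξ hξ ζ
    rw [hκ]
    simp only
    rw [hΛ.symm z hz, (hLΛ ξ).mp hξ, fderiv_skew hΩ hj hskew hz]
  have hinner' : ∀ ξ ∈ L, ∀ ζ ∈ L, inner ℝ (κ ζ) ξ = -inner ℝ ζ (κ ξ) := by
    intro ξ hξ ζ hζ
    rw [hinner ξ hξ, hκ]
    simp only
    rw [← hΛ.symm z hz, (hLΛ ζ).mp hζ]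
  have i1 : inner ℝ (κ η) η = 0 := by
    have := hinner' η hη η hη
    rw [real_inner_comm η] at this
    rw [real_inner_comm]
    linarith
  have i2 : inner ℝ (κ η) (j z η) = 0 := by
    have e1 := hinner' (j z η) (hjL η) η hη
    rw [hanti η hη, inner_neg_right, neg_neg] at e1
    have e2 := hskew z hz (κ η) η
    rw [real_inner_comm] at e2
    linarith
  by_cases hη0 : η = 0
  · rw [hη0, map_zero, map_zero]
  obtain ⟨r, s, hrs⟩ := IsSplitForm.exists_smul_add_smul (L := L)
    (j := ((j z).toLinearMap.domRestrict L).codRestrict L fun ξ ↦ hjL ξ)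
    (fun v ↦ Subtype.ext ((hsq z hz v).trans (by rw [(hLΛ _).mp v.2]; rfl))) hL (l := ⟨η, hη⟩)
    (by simpa using hη0) ⟨κ η, hκL η⟩
  have hrs' : κ η = r • η + s • j z η := congrArg Subtype.val hrs
  have : inner ℝ (κ η) (κ η) = 0 := by
    nth_rw 2 [hrs']
    rw [inner_add_right, inner_smul_right, inner_smul_right, i1, i2]
    ring
  exact inner_self_eq_zero.mp this

end Families

section Chart

open VectorField

variable {E : Type*} [NormedAddCommGroup E] [NormedSpace ℝ E] [FiniteDimensional ℝ E]
  {H : Type*} [TopologicalSpace H] {I : ModelWithCorners ℝ E H} [I.Boundaryless]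
  {M : Type*} [TopologicalSpace M] [ChartedSpace H M] [IsManifold I ∞ M]
  {W : Type*} [NormedAddCommGroup W] [NormedSpace ℝ W]

variable (I) in
/-- The derivative of the chart at `x`. -/
def chartDeriv (x y : M) : TangentSpace I y →L[ℝ] E := mvfderiv I (extChartAt I x) y

theorem mdifferentiableAt_comp_chart_symm {x y : M} (hy : y ∈ (extChartAt I x).source) {h : M → W}
    (hh : MDifferentiableAt I 𝓘(ℝ, W) h y) :
    DifferentiableAt ℝ (h ∘ (extChartAt I x).symm) (extChartAt I x y) := by
  have h1 : MDifferentiableAt 𝓘(ℝ, E) I (extChartAt I x).symm (extChartAt I x y) :=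
    ((contMDiffOn_extChartAt_symm (n := ∞) x).contMDiffAt
      ((isOpen_extChartAt_target x).mem_nhds ((extChartAt I x).map_source hy))).mdifferentiableAt
      (by simp)
  rw [← mdifferentiableAt_iff_differentiableAt]
  refine MDifferentiableAt.comp _ ?_ h1
  rwa [(extChartAt I x).left_inv hy]

theorem mvfderiv_eq_fderiv_comp {x y : M} (hy : y ∈ (extChartAt I x).source) {h : M → W}
    (hh : MDifferentiableAt I 𝓘(ℝ, W) h y) (w : TangentSpace I y) :
    mvfderiv I h y w =
      fderiv ℝ (h ∘ (extChartAt I x).symm) (extChartAt I x y) (chartDeriv I x y w) := by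
  have hd := mdifferentiableAt_comp_chart_symm hy hh
  have hy' : y ∈ (chartAt H x).source := by rwa [← extChartAt_source (I := I)]
  have hφ : MDifferentiableAt I 𝓘(ℝ, E) (extChartAt I x) y := mdifferentiableAt_extChartAt hy'
  have hev : h =ᶠ[𝓝 y] (h ∘ (extChartAt I x).symm) ∘ extChartAt I x := by
    filter_upwards [(isOpen_extChartAt_source x).mem_nhds hy] with y' hy'
    exact congrArg h ((extChartAt I x).left_inv hy').symm
  have e1 : mvfderiv I h y = mvfderiv I ((h ∘ (extChartAt I x).symm) ∘ extChartAt I x) y := by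
    ext w
    simp only [mvfderiv, ContinuousLinearMap.comp_apply]
    rw [hev.mfderiv_eq]
    rfl
  rw [e1]
  have hd' : MDifferentiableAt 𝓘(ℝ, E) 𝓘(ℝ, W) (h ∘ (extChartAt I x).symm) (extChartAt I x y) :=
    mdifferentiableAt_iff_differentiableAt.mpr hd
  refine (mfderiv_comp_apply y hd' hφ w).trans ?_
  have e2 : ∀ v : E, mvfderiv 𝓘(ℝ, E) (h ∘ (extChartAt I x).symm) (extChartAt I x y) v =
      fderiv ℝ (h ∘ (extChartAt I x).symm) (extChartAt I x y) v := fun v ↦ by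
    simp only [mvfderiv, mfderiv_eq_fderiv]
    rfl
  exact e2 _

theorem chartDeriv_bijective {x y : M} (hy : y ∈ (extChartAt I x).source) :
    Function.Bijective (chartDeriv I x y) :=
  (isInvertible_mfderiv_extChartAt (I := I) hy).bijective

/-- A smooth vector field on the domain of the chart at `x`, constant in the chart. -/
theorem exists_constant_field (x : M) (e : E) : ∃ Y : ∀ y : M, TangentSpace I y,
    (∀ y ∈ (extChartAt I x).source, chartDeriv I x y (Y y) = e) ∧
    IsSmoothFieldOn Y (extChartAt I x).source := by
  refine ⟨mpullback I 𝓘(ℝ, E) (extChartAt I x) (fun _ ↦ e), fun y hy ↦ ?_, fun y hy ↦ ?_⟩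
  · exact (isInvertible_mfderiv_extChartAt (I := I) hy).self_apply_inverse e
  · have h1 : ContMDiffAt 𝓘(ℝ, E) 𝓘(ℝ, E).tangent ∞
        (fun z : E ↦ (⟨z, e⟩ : TangentBundle 𝓘(ℝ, E) E)) (extChartAt I x y) := by
      refine contMDiffAt_vectorSpace_iff_contDiffAt (V := fun _ ↦ e).mpr ?_
      exact contDiffAt_const
    exact (h1.mpullback_vectorField_preimage
      ((contMDiffOn_extChartAt (n := ∞)).contMDiffAt ((chartAt H x).open_source.mem_nhds
        (by rwa [← extChartAt_source (I := I)])))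
      (isInvertible_mfderiv_extChartAt hy) (by norm_cast)).contMDiffWithinAt

theorem contMDiffOn_push {O : Set M} (hO : IsOpen O) {h : M → W}
    (hh : ContMDiffOn I 𝓘(ℝ, W) ∞ h O) {Y : ∀ y : M, TangentSpace I y}
    (hY : IsSmoothFieldOn Y O) :
    ContMDiffOn I 𝓘(ℝ, W) ∞ (fun y ↦ mvfderiv I h y (Y y)) O := by
  have h1 := hh.contMDiffOn_tangentMapWithin (m := ∞) (by norm_cast) hO.uniqueMDiffOn
  have h2 : ContMDiffOn I 𝓘(ℝ, W).tangent ∞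
      (fun y ↦ tangentMapWithin I 𝓘(ℝ, W) h O (⟨y, Y y⟩ : TangentBundle I M)) O :=
    h1.comp hY (fun y hy ↦ hy)
  have h3 : ContMDiff 𝓘(ℝ, W).tangent 𝓘(ℝ, W) ∞ (fun q : TangentBundle 𝓘(ℝ, W) W ↦ (q.2 : W)) :=
    contMDiff_snd_tangentBundle_modelSpace W 𝓘(ℝ, W)
  refine (h3.comp_contMDiffOn h2).congr fun y hy ↦ ?_
  have e : mfderivWithin I 𝓘(ℝ, W) h O y = mfderiv I 𝓘(ℝ, W) h y := mfderivWithin_of_isOpen hO hy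
  change mvfderiv I h y (Y y) = (mfderivWithin I 𝓘(ℝ, W) h O y (Y y) : W)
  rw [e]
  rfl

theorem contDiffOn_comp_chart_symm (x : M) {O : Set M} {h : M → W}
    (hh : ContMDiffOn I 𝓘(ℝ, W) ∞ h O) :
    ContDiffOn ℝ ∞ (h ∘ (extChartAt I x).symm)
      ((extChartAt I x).target ∩ (extChartAt I x).symm ⁻¹' O) := by
  rw [← contMDiffOn_iff_contDiffOn]
  exact hh.comp ((contMDiffOn_extChartAt_symm x).mono Set.inter_subset_left) fun z hz ↦ hz.2

theorem isOpen_chart_preimage (x : M) {O : Set M} (hO : IsOpen O) :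
    IsOpen ((extChartAt I x).target ∩ (extChartAt I x).symm ⁻¹' O) :=
  (continuousOn_extChartAt_symm x).isOpen_inter_preimage (isOpen_extChartAt_target x) hO

theorem mvfderiv_mlieBracket {x : M} {h : M → W} (hh : ContMDiffAt I 𝓘(ℝ, W) ∞ h x)
    {X Y : ∀ y : M, TangentSpace I y} (hX : MDiffAt (T% X) x) (hY : MDiffAt (T% Y) x) :
    mvfderiv I h x (mlieBracket I X Y x) =
      mvfderiv I (fun y ↦ mvfderiv I h y (Y y)) x (X x) -
        mvfderiv I (fun y ↦ mvfderiv I h y (X y)) x (Y x) := by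
  have hx := mem_extChartAt_source (I := I) x
  set φ := extChartAt I x with hφ
  obtain ⟨O, hOx, hhO⟩ : ∃ O ∈ 𝓝 x, ∀ y ∈ O, MDifferentiableAt I 𝓘(ℝ, W) h y := by
    have h1 : ContMDiffAt I 𝓘(ℝ, W) 1 h x := hh.of_le (by norm_cast)
    obtain ⟨O, hO, hhO⟩ := ((contMDiffAt_iff_contMDiffAt_nhds (by simp)).1 h1).exists_mem
    exact ⟨O, hO, fun y hy ↦ (hhO y hy).mdifferentiableAt one_ne_zero⟩
  set g : E → W := h ∘ φ.symm with hg
  have hgs : ContDiffAt ℝ ∞ g (φ x) := by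
    rw [← contMDiffAt_iff_contDiffAt]
    refine ContMDiffAt.comp _ ?_ ((contMDiffOn_extChartAt_symm x).contMDiffAt
      ((isOpen_extChartAt_target x).mem_nhds (φ.map_source hx)))
    rwa [φ.left_inv hx]
  have hφx : MDifferentiableAt I 𝓘(ℝ, E) φ x :=
    mdifferentiableAt_extChartAt (mem_chart_source H x)
  let hat : (∀ y : M, TangentSpace I y) → E → E :=
    fun Z ↦ mpullbackWithin 𝓘(ℝ, E) I φ.symm Z (Set.range I)
  have hhat : ∀ Z, ∀ y ∈ φ.source, hat Z (φ y) = chartDeriv I x y (Z y) := by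
    intro Z y hy
    have h1 := isInvertible_mfderivWithin_extChartAt_symm (I := I) (φ.map_source hy)
    have h2 := mfderivWithin_extChartAt_symm_comp_mfderiv_extChartAt' (I := I) hy
    have h3 := congrArg (fun A : TangentSpace I y →L[ℝ] TangentSpace I y ↦ A (Z y)) h2
    have h4 : ∀ y', y' = y → (Z y' : E) = Z y := by rintro _ rfl; rfl
    change (mfderivWithin 𝓘(ℝ, E) I φ.symm (Set.range I) (φ y)).inverse (Z (φ.symm (φ y))) = _
    apply h1.injective
    refine (h1.self_apply_inverse _).trans ?_
    exact (h4 _ (φ.left_inv hy)).trans h3.symm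
  have hset : φ.symm ⁻¹' Set.univ ∩ Set.range I = Set.univ := by
    rw [Set.preimage_univ, I.range_eq_univ, Set.univ_inter]
  have hhatd : ∀ Z : ∀ y : M, TangentSpace I y, MDiffAt (T% Z) x →
      DifferentiableAt ℝ (hat Z) (φ x) := by
    intro Z hZ
    have h1 : DifferentiableWithinAt ℝ (hat Z) (φ.symm ⁻¹' Set.univ ∩ Set.range I) (φ x) :=
      MDifferentiableWithinAt.differentiableWithinAt_mpullbackWithin_vectorField
        (mdifferentiableWithinAt_univ.mpr hZ)
    rwa [hset, differentiableWithinAt_univ] at h1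
  have hbr : chartDeriv I x x (mlieBracket I X Y x) =
      fderiv ℝ (hat Y) (φ x) (hat X (φ x)) - fderiv ℝ (hat X) (φ x) (hat Y (φ x)) := by
    let b : E := lieBracketWithin ℝ (hat X) (hat Y) (φ.symm ⁻¹' Set.univ ∩ Set.range I) (φ x)
    have hb : b = fderiv ℝ (hat Y) (φ x) (hat X (φ x)) - fderiv ℝ (hat X) (φ x) (hat Y (φ x)) := by
      change lieBracketWithin ℝ (hat X) (hat Y) (φ.symm ⁻¹' Set.univ ∩ Set.range I) (φ x) = _
      rw [hset, lieBracketWithin_univ]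
      rfl
    rw [← hb]
    exact (isInvertible_mfderiv_extChartAt (I := I) hx).self_apply_inverse b
  have hpush : ∀ Z : ∀ y : M, TangentSpace I y, MDiffAt (T% Z) x → ∀ w : TangentSpace I x,
      mvfderiv I (fun y ↦ mvfderiv I h y (Z y)) x w =
        fderiv ℝ (fderiv ℝ g) (φ x) (chartDeriv I x x w) (hat Z (φ x)) +
          fderiv ℝ g (φ x) (fderiv ℝ (hat Z) (φ x) (chartDeriv I x x w)) := by
    intro Z hZ w
    have hdg : DifferentiableAt ℝ (fderiv ℝ g) (φ x) :=
      (hgs.fderiv_right (m := 1) (by norm_cast)).differentiableAt one_ne_zero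
    have hd : DifferentiableAt ℝ (fun z ↦ fderiv ℝ g z (hat Z z)) (φ x) :=
      hdg.clm_apply (hhatd Z hZ)
    have hloc : ∀ y ∈ φ.source ∩ O, mvfderiv I h y (Z y) = fderiv ℝ g (φ y) (hat Z (φ y)) :=
      fun y hy ↦ by rw [mvfderiv_eq_fderiv_comp hy.1 (hhO y hy.2), hhat Z y hy.1]
    have hn : φ.source ∩ O ∈ 𝓝 x := Filter.inter_mem (extChartAt_source_mem_nhds x) hOx
    have hmd : MDifferentiableAt I 𝓘(ℝ, W) (fun y ↦ mvfderiv I h y (Z y)) x := by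
      have : MDifferentiableAt I 𝓘(ℝ, W) ((fun z ↦ fderiv ℝ g z (hat Z z)) ∘ φ) x :=
        (mdifferentiableAt_iff_differentiableAt.mpr hd).comp x hφx
      refine this.congr_of_eventuallyEq ?_
      filter_upwards [hn] with y hy using hloc y hy
    rw [mvfderiv_eq_fderiv_comp hx hmd]
    have hev : (fun y ↦ mvfderiv I h y (Z y)) ∘ φ.symm =ᶠ[𝓝 (φ x)]
        fun z ↦ fderiv ℝ g z (hat Z z) := by
      have hc : ContinuousAt φ.symm (φ x) := continuousAt_extChartAt_symm x
      have := hc.preimage_mem_nhds (by rw [φ.left_inv hx]; exact hn)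
      filter_upwards [this, extChartAt_target_mem_nhds (I := I) x] with z hz hz'
      rw [Function.comp_apply, hloc _ hz, φ.right_inv hz']
    rw [← hφ, hev.fderiv_eq, fderiv_clm_apply hdg (hhatd Z hZ)]
    simp [add_comm]
  rw [mvfderiv_eq_fderiv_comp hx (hhO x (mem_of_mem_nhds hOx)), hbr, hpush X hX, hpush Y hY,
    ← hhat X x hx, ← hhat Y x hx, fderiv_fderiv_symm hgs, map_sub]
  abel

end Chart

section Transfer

open VectorField

variable {E : Type*} [NormedAddCommGroup E] [InnerProductSpace ℝ E] [FiniteDimensional ℝ E]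
  {H : Type*} [TopologicalSpace H] {I : ModelWithCorners ℝ E H} [I.Boundaryless]
  {M : Type*} [TopologicalSpace M] [ChartedSpace H M] [IsManifold I ∞ M]
  [RiemannianBundle (fun x : M ↦ TangentSpace I x)]
  [IsContMDiffRiemannianBundle I ∞ E (fun x : M ↦ TangentSpace I x)]
  {V : Type*} [NormedAddCommGroup V] [InnerProductSpace ℝ V] [FiniteDimensional ℝ V]

/-- `f` is isometric. -/
def IsIsometricImmersion (f : C^∞⟮I, M; 𝓘(ℝ, V), V⟯) : Prop :=
  ∀ (x : M) (v w : TangentSpace I x), inner ℝ (mvfderiv I f x v) (mvfderiv I f x w) = inner ℝ v w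

/-- The orthogonal projection of the ambient space to `f_* T_x M`. -/
def tangentProj (f : C^∞⟮I, M; 𝓘(ℝ, V), V⟯) (x : M) : V →L[ℝ] V :=
  (LinearMap.range (mvfderiv I f x).toLinearMap).starProjection

instance (x : M) : FiniteDimensional ℝ (TangentSpace I x) :=
  inferInstanceAs (FiniteDimensional ℝ E)

/-- The transpose of the differential of `f`. -/
def diffAdjoint (f : C^∞⟮I, M; 𝓘(ℝ, V), V⟯) (x : M) : V →ₗ[ℝ] TangentSpace I x :=
  LinearMap.adjoint (mvfderiv I f x).toLinearMap

/-- The complex structure of `f_* T_x M`, extended by zero to the normal space. -/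
def tangentComplex (K : KaehlerStructure I M) (f : C^∞⟮I, M; 𝓘(ℝ, V), V⟯) (x : M) : V →L[ℝ] V :=
  LinearMap.toContinuousLinearMap
    ((mvfderiv I f x).toLinearMap ∘ₗ (K.J x).toLinearMap ∘ₗ diffAdjoint f x)

variable {K : KaehlerStructure I M} {f : C^∞⟮I, M; 𝓘(ℝ, V), V⟯} (hf : IsIsometricImmersion f)

include hf in
theorem diffAdjoint_apply (x : M) (v : TangentSpace I x) :
    diffAdjoint f x (mvfderiv I f x v) = v := by
  apply ext_inner_right ℝ
  intro w
  rw [diffAdjoint, LinearMap.adjoint_inner_left]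
  exact hf x v w

include hf in
theorem mvfderiv_diffAdjoint (x : M) (ξ : V) :
    mvfderiv I f x (diffAdjoint f x ξ) = tangentProj f x ξ := by
  symm
  apply Submodule.eq_starProjection_of_mem_of_inner_eq_zero
  · exact LinearMap.mem_range_self _ _
  · rintro _ ⟨w, rfl⟩
    change inner ℝ _ (mvfderiv I f x w) = 0
    rw [inner_sub_left, hf x, diffAdjoint, LinearMap.adjoint_inner_left, sub_eq_zero]
    rfl

theorem tangentProj_apply (x : M) (v : TangentSpace I x) :
    tangentProj f x (mvfderiv I f x v) = mvfderiv I f x v :=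
  Submodule.starProjection_eq_self_iff.mpr (LinearMap.mem_range_self _ _)

include hf in
theorem tangentComplex_apply (x : M) (v : TangentSpace I x) :
    tangentComplex K f x (mvfderiv I f x v) = mvfderiv I f x (K.J x v) := by
  change mvfderiv I f x (K.J x (diffAdjoint f x (mvfderiv I f x v))) = _
  rw [diffAdjoint_apply hf]

theorem mvfderiv_inner {x : M} {u w : M → V} (hu : MDifferentiableAt I 𝓘(ℝ, V) u x)
    (hw : MDifferentiableAt I 𝓘(ℝ, V) w x) (v : TangentSpace I x) :
    mvfderiv I (fun y ↦ (inner ℝ (u y) (w y) : ℝ)) x v =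
      inner ℝ (mvfderiv I u x v) (w x) + inner ℝ (u x) (mvfderiv I w x v) := by
  have hx := mem_extChartAt_source (I := I) x
  have hu' := mdifferentiableAt_comp_chart_symm hx hu
  have hw' := mdifferentiableAt_comp_chart_symm hx hw
  have hval : ∀ g : M → V, (g ∘ (extChartAt I x).symm) (extChartAt I x x) = g x :=
    fun g ↦ congrArg g ((extChartAt I x).left_inv hx)
  have huw : MDifferentiableAt I 𝓘(ℝ, ℝ) (fun y ↦ (inner ℝ (u y) (w y) : ℝ)) x :=
    (mdifferentiableAt_iff_differentiableAt.mpr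
      ((contDiff_inner (𝕜 := ℝ) (E := V) (n := 1)).differentiable one_ne_zero (u x, w x))).comp
      x (hu.prodMk_space hw)
  have := fderiv_inner_apply ℝ hu' hw' (chartDeriv I x x v)
  rw [hval, hval] at this
  rw [mvfderiv_eq_fderiv_comp hx huw, mvfderiv_eq_fderiv_comp hx hu,
    mvfderiv_eq_fderiv_comp hx hw, add_comm]
  exact this

include hf in
/-- The tangential component of the ambient derivative is a connection for which the complex
structure is parallel. -/
theorem tangentProj_mvfderiv_complex {x : M} {Y : ∀ y : M, TangentSpace I y}
    (hY : MDiffAt (T% Y) x) (v : TangentSpace I x) :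
    tangentProj f x (mvfderiv I (fun y ↦ mvfderiv I f y (K.J y (Y y))) x v) =
      tangentComplex K f x (mvfderiv I (fun y ↦ mvfderiv I f y (Y y)) x v) := by
  obtain ⟨cov, hmet, htor, hpar⟩ := K.parallel_J
  have htor' : ∀ {X Y : ∀ y : M, TangentSpace I y} {x : M}, MDiffAt (T% X) x → MDiffAt (T% Y) x →
      cov Y x (X x) - cov X x (Y x) = mlieBracket I X Y x := cov.torsion_eq_zero_iff.mp htor
  -- the tangential component is the Levi-Civita connection
  have key : ∀ X Y Z : ∀ y : M, TangentSpace I y, MDiffAt (T% X) x → MDiffAt (T% Y) x →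
      MDiffAt (T% Z) x → inner ℝ (mvfderiv I (fun y ↦ mvfderiv I f y (Y y)) x (X x))
        (mvfderiv I f x (Z x)) = inner ℝ (cov Y x (X x)) (Z x) := by
    let t : (X Y Z : ∀ y : M, TangentSpace I y) → ℝ := fun X Y Z ↦
      inner ℝ (mvfderiv I (fun y ↦ mvfderiv I f y (Y y)) x (X x)) (mvfderiv I f x (Z x)) -
        inner ℝ (cov Y x (X x)) (Z x)
    have t1 : ∀ X Y Z : ∀ y : M, TangentSpace I y, MDiffAt (T% X) x → MDiffAt (T% Y) x →
        t X Y Z = t Y X Z := by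
      intro X Y Z hX hY
      have e1 := mvfderiv_mlieBracket (f.contMDiff.contMDiffAt (x := x)) hX hY
      rw [← htor' hX hY, map_sub] at e1
      have e2 := congrArg (fun u ↦ inner ℝ u (mvfderiv I f x (Z x))) e1
      simp only [inner_sub_left, hf x] at e2
      simp only [t]
      linarith
    have t2 : ∀ X Y Z : ∀ y : M, TangentSpace I y, MDiffAt (T% X) x → MDiffAt (T% Y) x →
        MDiffAt (T% Z) x → t X Y Z = -t X Z Y := by
      intro X Y Z hX hY hZ
      have e1 := hmet.mvfderiv_inner_eq X hY hZ
      have e2 : mvfderiv I (fun y ↦ inner ℝ (mvfderiv I f y (Y y)) (mvfderiv I f y (Z y))) x (X x) =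
          inner ℝ (mvfderiv I (fun y ↦ mvfderiv I f y (Y y)) x (X x)) (mvfderiv I f x (Z x)) +
          inner ℝ (mvfderiv I f x (Y x)) (mvfderiv I (fun y ↦ mvfderiv I f y (Z y)) x (X x)) := by
        exact mvfderiv_inner (mdifferentiableAt_push f hY) (mdifferentiableAt_push f hZ) _
      simp only [hf _] at e2
      have e3 : inner ℝ (mvfderiv I (fun y ↦ mvfderiv I f y (Y y)) x (X x)) (mvfderiv I f x (Z x)) +
          inner ℝ (mvfderiv I f x (Y x)) (mvfderiv I (fun y ↦ mvfderiv I f y (Z y)) x (X x)) =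
          inner ℝ (cov Y x (X x)) (Z x) + inner ℝ (Y x) (cov Z x (X x)) := e2.symm.trans e1
      simp only [t]
      have e4 := real_inner_comm (mvfderiv I f x (Y x))
        (mvfderiv I (fun y ↦ mvfderiv I f y (Z y)) x (X x))
      have e5 := real_inner_comm (Y x) (cov Z x (X x))
      linarith
    intro X Y Z hX hY hZ
    have : t X Y Z = 0 := by
      have e1 := t1 X Y Z hX hY
      have e2 := t2 Y X Z hY hX hZ
      have e3 := t1 Y Z X hY hZ
      have e4 := t2 Z Y X hZ hY hX
      have e5 := t1 Z X Y hZ hX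
      have e6 := t2 X Z Y hX hZ hY
      linarith
    exact sub_eq_zero.mp this
  have key' : ∀ Y : ∀ y : M, TangentSpace I y, MDiffAt (T% Y) x → ∀ v : TangentSpace I x,
      diffAdjoint f x (mvfderiv I (fun y ↦ mvfderiv I f y (Y y)) x v) = cov Y x v := by
    intro Y hY v
    apply ext_inner_right ℝ
    intro u
    rw [diffAdjoint, LinearMap.adjoint_inner_left]
    have := key (FiberBundle.extend E v) Y (FiberBundle.extend E u)
      (FiberBundle.mdifferentiableAt_extend I E v) hY (FiberBundle.mdifferentiableAt_extend I E u)
    simpa using this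
  have hJY : MDiffAt (T% (fun y ↦ K.J y (Y y))) x :=
    MDifferentiableAt.clm_bundle_apply
      ((K.contMDiff_J.mdifferentiable (by simp)) x) hY
  rw [← mvfderiv_diffAdjoint hf, key' _ hJY, hpar Y x hY, ← key' Y hY v]
  rfl

end Transfer

section Patch

open VectorField

variable {E : Type*} [NormedAddCommGroup E] [InnerProductSpace ℝ E] [FiniteDimensional ℝ E]
  {H : Type*} [TopologicalSpace H] {I : ModelWithCorners ℝ E H} [I.Boundaryless]
  {M : Type*} [TopologicalSpace M] [ChartedSpace H M] [IsManifold I ∞ M]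
  [RiemannianBundle (fun x : M ↦ TangentSpace I x)]
  [IsContMDiffRiemannianBundle I ∞ E (fun x : M ↦ TangentSpace I x)]
  {V : Type*} [NormedAddCommGroup V] [InnerProductSpace ℝ V] [FiniteDimensional ℝ V]
  {W : Type*} [NormedAddCommGroup W] [NormedSpace ℝ W]

variable {K : KaehlerStructure I M} {f : C^∞⟮I, M; 𝓘(ℝ, V), V⟯}

theorem tangentProj_idem (x : M) (ξ : V) :
    tangentProj f x (tangentProj f x ξ) = tangentProj f x ξ :=
  Submodule.starProjection_eq_self_iff.mpr (Submodule.starProjection_apply_mem _ _)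

theorem tangentProj_symm (x : M) (ξ ζ : V) :
    inner ℝ (tangentProj f x ξ) ζ = inner ℝ ξ (tangentProj f x ζ) :=
  Submodule.inner_starProjection_left_eq_right _ _ _

theorem tangentProj_eq_zero_iff (x : M) (ξ : V) :
    tangentProj f x ξ = 0 ↔ ∀ v : TangentSpace I x, inner ℝ (mvfderiv I f x v) ξ = 0 := by
  rw [tangentProj, Submodule.starProjection_apply_eq_zero_iff, Submodule.mem_orthogonal]
  exact ⟨fun h v ↦ h _ (LinearMap.mem_range_self _ v), by rintro h _ ⟨v, rfl⟩; exact h v⟩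

theorem starProjection_normalSpace (x : M) :
    (normalSpace f x).starProjection = 1 - tangentProj f x :=
  Submodule.starProjection_orthogonal _

theorem inner_J_left (x : M) (v w : TangentSpace I x) :
    inner ℝ (K.J x v) w = -inner ℝ v (K.J x w) := by
  have := K.inner_J x v (K.J x w)
  rw [K.J_sq, inner_neg_right] at this
  linarith

theorem tangentProj_tangentComplex (x : M) (ξ : V) :
    tangentProj f x (tangentComplex K f x ξ) = tangentComplex K f x ξ :=
  tangentProj_apply x _

theorem diffAdjoint_tangentProj (x : M) (ξ : V) :
    diffAdjoint f x (tangentProj f x ξ) = diffAdjoint f x ξ := by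
  apply ext_inner_right ℝ
  intro w
  rw [diffAdjoint, LinearMap.adjoint_inner_left, LinearMap.adjoint_inner_left, tangentProj_symm]
  exact congrArg (inner ℝ ξ) (tangentProj_apply x w)

theorem tangentComplex_tangentProj (x : M) (ξ : V) :
    tangentComplex K f x (tangentProj f x ξ) = tangentComplex K f x ξ :=
  congrArg (fun w ↦ mvfderiv I f x (K.J x w)) (diffAdjoint_tangentProj x ξ)

theorem tangentComplex_skew (x : M) (ξ ζ : V) :
    inner ℝ (tangentComplex K f x ξ) ζ = -inner ℝ ξ (tangentComplex K f x ζ) := by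
  have h1 : inner ℝ (tangentComplex K f x ξ) ζ =
      inner ℝ (K.J x (diffAdjoint f x ξ)) (diffAdjoint f x ζ) := by
    rw [diffAdjoint, LinearMap.adjoint_inner_right]
    rfl
  have h2 : inner ℝ ξ (tangentComplex K f x ζ) =
      inner ℝ (diffAdjoint f x ξ) (K.J x (diffAdjoint f x ζ)) := by
    rw [diffAdjoint, LinearMap.adjoint_inner_left]
    rfl
  rw [h1, h2, inner_J_left]

variable (hf : IsIsometricImmersion f)

include hf in
theorem tangentComplex_sq (x : M) (ξ : V) :
    tangentComplex K f x (tangentComplex K f x ξ) = -tangentProj f x ξ := by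
  have := tangentComplex_apply (K := K) hf x (K.J x (diffAdjoint f x ξ))
  rw [K.J_sq, map_neg, mvfderiv_diffAdjoint hf] at this
  exact this

include hf in
theorem mvfderiv_injective (x : M) {v : TangentSpace I x} (hv : mvfderiv I f x v = 0) : v = 0 := by
  rw [← diffAdjoint_apply hf x v, hv, map_zero]

theorem fderiv_comp_chart_symm {x : M} {z : E} (hz : z ∈ (extChartAt I x).target) {h : M → W}
    (hh : MDifferentiableAt I 𝓘(ℝ, W) h ((extChartAt I x).symm z))
    (w : TangentSpace I ((extChartAt I x).symm z)) :
    fderiv ℝ (h ∘ (extChartAt I x).symm) z (chartDeriv I x _ w) = mvfderiv I h _ w := by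
  rw [mvfderiv_eq_fderiv_comp ((extChartAt I x).map_target hz) hh, (extChartAt I x).right_inv hz]

theorem contDiffOn_comp_chart_symm_target (x : M) {h : M → W}
    (hh : ContMDiffOn I 𝓘(ℝ, W) ∞ h (extChartAt I x).source) :
    ContDiffOn ℝ ∞ (h ∘ (extChartAt I x).symm) (extChartAt I x).target :=
  (contDiffOn_comp_chart_symm x hh).mono fun _ hz ↦ ⟨hz, (extChartAt I x).map_target hz⟩

theorem mdifferentiableAt_of_smooth (x : M) : MDifferentiableAt I 𝓘(ℝ, V) f x :=
  (f.contMDiff.mdifferentiable (by simp)) x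

variable (K) in
include hf in
theorem isKaehlerPatch (x : M) : IsKaehlerPatch (extChartAt I x).target (f ∘ (extChartAt I x).symm)
    (fun z ↦ tangentProj f ((extChartAt I x).symm z))
    (fun z ↦ tangentComplex K f ((extChartAt I x).symm z)) := by
  set φ := extChartAt I x with hφ
  have hO : IsOpen φ.target := isOpen_extChartAt_target x
  have hF : ContDiffOn ℝ ∞ (f ∘ φ.symm) φ.target :=
    contDiffOn_comp_chart_symm_target x f.contMDiff.contMDiffOn
  have hdF : ∀ z ∈ φ.target, ∀ w : TangentSpace I (φ.symm z),
      fderiv ℝ (f ∘ φ.symm) z (chartDeriv I x _ w) = mvfderiv I f _ w := fun z hz w ↦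
    fderiv_comp_chart_symm hz (mdifferentiableAt_of_smooth _) w
  have hsurj : ∀ z ∈ φ.target, ∀ e : E, ∃ w : TangentSpace I (φ.symm z),
      chartDeriv I x _ w = e := fun z hz ↦ (chartDeriv_bijective (φ.map_target hz)).surjective
  have hS : ContDiffOn ℝ ∞ (fderiv ℝ (f ∘ φ.symm)) φ.target :=
    hF.fderiv_of_isOpen hO (by simp)
  have hinj : ∀ z ∈ φ.target, Function.Injective (fderiv ℝ (f ∘ φ.symm) z) := by
    intro z hz
    rw [injective_iff_map_eq_zero]
    intro e he
    obtain ⟨w, rfl⟩ := hsurj z hz e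
    rw [hdF z hz] at he
    rw [mvfderiv_injective hf _ he, map_zero]
  have horth : ∀ z ∈ φ.target, ∀ ξ, (∀ c, inner ℝ (fderiv ℝ (f ∘ φ.symm) z c) ξ = 0) →
      tangentProj f (φ.symm z) ξ = 0 := fun z hz ξ h ↦
    (tangentProj_eq_zero_iff _ ξ).mpr fun w ↦ by rw [← hdF z hz]; exact h _
  have hP : ∀ z ∈ φ.target, ∀ w, tangentProj f (φ.symm z) (fderiv ℝ (f ∘ φ.symm) z w) =
      fderiv ℝ (f ∘ φ.symm) z w := by
    intro z hz e
    obtain ⟨w, rfl⟩ := hsurj z hz e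
    rw [hdF z hz, tangentProj_apply]
  choose Y hY hYs using exists_constant_field (I := I) x
  have hJY : ∀ e, IsSmoothFieldOn (fun y ↦ K.J y (Y e y)) φ.source := fun e ↦
    ContMDiffOn.clm_bundle_apply (K.contMDiff_J.contMDiffOn) (hYs e)
  have hCY : ∀ e, ∀ z ∈ φ.target, tangentComplex K f (φ.symm z) (fderiv ℝ (f ∘ φ.symm) z e) =
      mvfderiv I f (φ.symm z) (K.J _ (Y e (φ.symm z))) := fun e z hz ↦ by
    have h1 := hdF z hz (Y e (φ.symm z))
    rw [hY e _ (φ.map_target hz)] at h1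
    rw [h1, tangentComplex_apply hf]
  have hFY : ∀ e, ∀ z ∈ φ.target, fderiv ℝ (f ∘ φ.symm) z e =
      mvfderiv I f (φ.symm z) (Y e (φ.symm z)) := fun e z hz ↦ by
    have h1 := hdF z hz (Y e (φ.symm z))
    rwa [hY e _ (φ.map_target hz)] at h1
  refine ⟨hO, hF, ⟨?_, fun z _ ↦ tangentProj_idem _, fun z _ ↦ tangentProj_symm _⟩, hP, ?_, ?_,
    fun z _ ↦ tangentProj_tangentComplex _, fun z _ ↦ tangentComplex_tangentProj _,
    fun z _ ↦ tangentComplex_sq hf _, fun z _ ↦ tangentComplex_skew _, ?_⟩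
  · exact contDiffOn_of_frame hS hS hinj hP horth
  · intro z hz ξ
    refine ⟨chartDeriv I x _ (diffAdjoint f (φ.symm z) ξ), ?_⟩
    rw [hdF z hz, mvfderiv_diffAdjoint hf]
  · refine contDiffOn_of_frame
      (S' := fun z ↦ (tangentComplex K f (φ.symm z)).comp (fderiv ℝ (f ∘ φ.symm) z)) hS ?_ hinj
      (fun z _ c ↦ rfl) fun z hz ξ h ↦ ?_
    · rw [contDiffOn_clm_apply]
      intro e
      exact (contDiffOn_comp_chart_symm_target x
        (contMDiffOn_push (isOpen_extChartAt_source x) f.contMDiff.contMDiffOn (hJY e))).congr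
          (hCY e)
    · rw [← tangentComplex_tangentProj, horth z hz ξ h, map_zero]
  · intro z hz e w
    obtain ⟨v, rfl⟩ := hsurj z hz e
    have hYd : MDiffAt (T% (Y w)) (φ.symm z) :=
      ((hYs w).contMDiffAt ((isOpen_extChartAt_source x).mem_nhds
        (φ.map_target hz))).mdifferentiableAt (by simp)
    have hJYd : MDiffAt (T% (fun y ↦ K.J y (Y w y))) (φ.symm z) :=
      ((hJY w).contMDiffAt ((isOpen_extChartAt_source x).mem_nhds
        (φ.map_target hz))).mdifferentiableAt (by simp)
    have e1 : (fun y ↦ tangentComplex K f (φ.symm y) (fderiv ℝ (f ∘ φ.symm) y w)) =ᶠ[𝓝 z]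
        (fun y ↦ mvfderiv I f y (K.J y (Y w y))) ∘ φ.symm := by
      filter_upwards [hO.mem_nhds hz] with y hy using hCY w y hy
    have e2 : (fun y ↦ fderiv ℝ (f ∘ φ.symm) y w) =ᶠ[𝓝 z]
        (fun y ↦ mvfderiv I f y (Y w y)) ∘ φ.symm := by
      filter_upwards [hO.mem_nhds hz] with y hy using hFY w y hy
    rw [e1.fderiv_eq, e2.fderiv_eq, fderiv_comp_chart_symm hz (mdifferentiableAt_push f hJYd),
      fderiv_comp_chart_symm hz (mdifferentiableAt_push f hYd), tangentProj_mvfderiv_complex hf hYd]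

end Patch

section Fundamental

open VectorField

variable {E : Type*} [NormedAddCommGroup E] [InnerProductSpace ℝ E] [FiniteDimensional ℝ E]
  {H : Type*} [TopologicalSpace H] {I : ModelWithCorners ℝ E H} [I.Boundaryless]
  {M : Type*} [TopologicalSpace M] [ChartedSpace H M] [IsManifold I ∞ M]
  [RiemannianBundle (fun x : M ↦ TangentSpace I x)]
  [IsContMDiffRiemannianBundle I ∞ E (fun x : M ↦ TangentSpace I x)]
  {V : Type*} [NormedAddCommGroup V] [InnerProductSpace ℝ V] [FiniteDimensional ℝ V]
  {W : Type*} [NormedAddCommGroup W] [NormedSpace ℝ W]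

variable {K : KaehlerStructure I M} {f : C^∞⟮I, M; 𝓘(ℝ, V), V⟯}

theorem IsKaehlerPatch.mono {Ω Ω' : Set E} {F : E → V} {P C : E → V →L[ℝ] V}
    (h : IsKaehlerPatch Ω F P C) (hΩ : IsOpen Ω') (hs : Ω' ⊆ Ω) : IsKaehlerPatch Ω' F P C :=
  ⟨hΩ, h.contDiffOn.mono hs, ⟨h.proj.contDiffOn.mono hs, fun z hz ↦ h.proj.idem z (hs hz),
    fun z hz ↦ h.proj.symm z (hs hz)⟩, fun z hz ↦ h.proj_tangent z (hs hz),
    fun z hz ↦ h.exists_tangent z (hs hz), h.contDiffOn_C.mono hs, fun z hz ↦ h.proj_C z (hs hz),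
    fun z hz ↦ h.C_proj z (hs hz), fun z hz ↦ h.C_sq z (hs hz), fun z hz ↦ h.C_skew z (hs hz),
    fun z hz ↦ h.parallel z (hs hz)⟩

theorem contMDiffAt_of_comp_chart_symm {x y : M} (hy : y ∈ (extChartAt I x).source) {h : M → W}
    (hh : ContDiffAt ℝ ∞ (h ∘ (extChartAt I x).symm) (extChartAt I x y)) :
    ContMDiffAt I 𝓘(ℝ, W) ∞ h y := by
  have h1 : ContMDiffAt I 𝓘(ℝ, W) ∞ ((h ∘ (extChartAt I x).symm) ∘ extChartAt I x) y :=
    (contMDiffAt_iff_contDiffAt.mpr hh).comp y (contMDiffAt_extChartAt'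
      (by rwa [← extChartAt_source (I := I)]))
  refine h1.congr_of_eventuallyEq ?_
  filter_upwards [(isOpen_extChartAt_source x).mem_nhds hy] with y' hy'
  exact congrArg h ((extChartAt I x).left_inv hy').symm

variable (hf : IsIsometricImmersion f)

variable (K) in
include K hf in
theorem contMDiff_tangentProj : ContMDiff I 𝓘(ℝ, V →L[ℝ] V) ∞ (tangentProj f) := fun x ↦
  contMDiffAt_of_comp_chart_symm (mem_extChartAt_source x)
    ((isKaehlerPatch K hf x).proj.contDiffOn.contDiffAt
      ((isOpen_extChartAt_target x).mem_nhds (mem_extChartAt_target x)))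

theorem fderiv_comp_chart_symm_chartDeriv (x : M) {h : M → W}
    (hh : MDifferentiableAt I 𝓘(ℝ, W) h x) (w : TangentSpace I x) :
    fderiv ℝ (h ∘ (extChartAt I x).symm) (extChartAt I x x) (chartDeriv I x x w) =
      mvfderiv I h x w :=
  (mvfderiv_eq_fderiv_comp (mem_extChartAt_source x) hh w).symm

variable (K) in
include K hf in
/-- The second fundamental form is the derivative of the tangent spaces. -/
theorem secondFundamentalForm_eq (x : M) (v w : TangentSpace I x) :
    secondFundamentalForm f x v w = mvfderiv I (tangentProj f) x v (mvfderiv I f x w) := by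
  have hx := mem_extChartAt_source (I := I) x
  have hz := mem_extChartAt_target (I := I) x
  have h := isKaehlerPatch K hf x
  obtain ⟨Y, hY, hYs⟩ := exists_constant_field (I := I) x (chartDeriv I x x w)
  have hYx : Y x = w := (chartDeriv_bijective hx).injective (hY x hx)
  have hYd : MDiffAt (T% Y) x := ((hYs x hx).contMDiffAt
    ((isOpen_extChartAt_source x).mem_nhds hx)).mdifferentiableAt (by simp)
  have e1 : (fun y ↦ mvfderiv I f y (Y y)) ∘ (extChartAt I x).symm =ᶠ[𝓝 (extChartAt I x x)]
      fun z ↦ fderiv ℝ (f ∘ (extChartAt I x).symm) z (chartDeriv I x x w) := by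
    filter_upwards [h.isOpen.mem_nhds hz] with z hz
    have h1 := fderiv_comp_chart_symm (I := I) hz (mdifferentiableAt_of_smooth (f := f) _)
      (Y ((extChartAt I x).symm z))
    rw [hY _ ((extChartAt I x).map_target hz)] at h1
    exact h1.symm
  have e2 := h.fderiv_fderiv_sub hz (chartDeriv I x x v) (chartDeriv I x x w)
  rw [← fderiv_fderiv_apply (h.contDiffAt hz), ← e1.fderiv_eq,
    fderiv_comp_chart_symm_chartDeriv x (mdifferentiableAt_push f hYd),
    fderiv_comp_chart_symm_chartDeriv x (mdifferentiableAt_of_smooth x)] at e2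
  have e3 := fderiv_comp_chart_symm_chartDeriv x
    (((contMDiff_tangentProj K hf).mdifferentiable (by simp)) x) v
  rw [← e3, ← hYx, secondFundamentalForm_apply f v hYd, starProjection_normalSpace, hYx]
  rw [(extChartAt I x).left_inv hx] at e2
  exact e2

variable (K) in
include K hf in
theorem secondFundamentalForm_symm (x : M) (v w : TangentSpace I x) :
    secondFundamentalForm f x v w = secondFundamentalForm f x w v := by
  have e := (isKaehlerPatch K hf x).sff_symm (mem_extChartAt_target x) (chartDeriv I x x v)
    (chartDeriv I x x w)
  have e3 := fderiv_comp_chart_symm_chartDeriv x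
    (((contMDiff_tangentProj K hf).mdifferentiable (by simp)) x)
  rw [secondFundamentalForm_eq K hf, secondFundamentalForm_eq K hf, ← e3, ← e3]
  rw [fderiv_comp_chart_symm_chartDeriv x (mdifferentiableAt_of_smooth x),
    fderiv_comp_chart_symm_chartDeriv x (mdifferentiableAt_of_smooth x)] at e
  exact e

include hf in
/-- The Gauss equation together with the invariance of the curvature under the complex
structure. -/
theorem isKaehlerForm_secondFundamentalForm (x : M) :
    IsKaehlerForm (K.J x).toLinearMap (secondFundamentalForm f x) := by
  intro X Y Z W
  have e := (isKaehlerPatch K hf x).gauss (mem_extChartAt_target x) (chartDeriv I x x Y)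
    (chartDeriv I x x X) (chartDeriv I x x W) (chartDeriv I x x (-K.J x Z))
  have e3 : ∀ v w : TangentSpace I x, fderiv ℝ (fun z ↦ tangentProj f ((extChartAt I x).symm z))
      (extChartAt I x x) (chartDeriv I x x v) (mvfderiv I f x w) =
      secondFundamentalForm f x v w := fun v w ↦ by
    rw [secondFundamentalForm_eq K hf, ← fderiv_comp_chart_symm_chartDeriv x
      (((contMDiff_tangentProj K hf).mdifferentiable (by simp)) x)]
    rfl
  simp only [fderiv_comp_chart_symm_chartDeriv x (mdifferentiableAt_of_smooth (f := f) x),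
    (extChartAt I x).left_inv (mem_extChartAt_source x), tangentComplex_apply hf, e3, map_neg,
    K.J_sq, neg_neg, inner_neg_right] at e
  have c1 := real_inner_comm (secondFundamentalForm f x X Z) (secondFundamentalForm f x Y W)
  have c2 := real_inner_comm (secondFundamentalForm f x X (K.J x Z))
    (secondFundamentalForm f x Y (K.J x W))
  change inner ℝ (secondFundamentalForm f x X W) (secondFundamentalForm f x Y Z) -
      inner ℝ (secondFundamentalForm f x X Z) (secondFundamentalForm f x Y W) =
      inner ℝ (secondFundamentalForm f x X (K.J x W)) (secondFundamentalForm f x Y (K.J x Z)) -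
      inner ℝ (secondFundamentalForm f x X (K.J x Z)) (secondFundamentalForm f x Y (K.J x W))
  linarith

theorem tangentProj_secondFundamentalForm (x : M) (v w : TangentSpace I x) :
    tangentProj f x (secondFundamentalForm f x v w) = 0 := by
  obtain ⟨Y, hYd, rfl⟩ : ∃ Y : ∀ y : M, TangentSpace I y, MDiffAt (T% Y) x ∧ Y x = w :=
    ⟨FiberBundle.extend E w, FiberBundle.mdifferentiableAt_extend I E w, by simp⟩
  rw [secondFundamentalForm_apply f v hYd, starProjection_normalSpace]
  simp [tangentProj_idem]

variable (K) in
include K hf in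
/-- The Codazzi equation for a section `Y` of the kernel of the component of the second fundamental
form in the complement of the range of `Λ`. -/
theorem codazzi {U : Set M} (hU : IsOpen U) {Λ : M → V →L[ℝ] V}
    (hΛ : ContMDiffOn I 𝓘(ℝ, V →L[ℝ] V) ∞ Λ U) (hid : ∀ y ∈ U, ∀ ξ, Λ y (Λ y ξ) = Λ y ξ)
    (hsymm : ∀ y ∈ U, ∀ ξ ζ, inner ℝ (Λ y ξ) ζ = inner ℝ ξ (Λ y ζ))
    (hPΛ : ∀ y ∈ U, ∀ ξ, tangentProj f y (Λ y ξ) = 0)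
    (hΛP : ∀ y ∈ U, ∀ ξ, Λ y (tangentProj f y ξ) = 0) {x : M} (hx : x ∈ U)
    {Y : ∀ y : M, TangentSpace I y} (hY : MDiffAt (T% Y) x)
    (hker : ∀ y ∈ U, ∀ c, (1 - tangentProj f y - Λ y) (secondFundamentalForm f y c (Y y)) = 0)
    {X : TangentSpace I x}
    (hX : ∀ w, (1 - tangentProj f x - Λ x) (secondFundamentalForm f x X w) = 0)
    (c : TangentSpace I x) :
    (1 - tangentProj f x - Λ x) (mvfderiv I Λ x X (secondFundamentalForm f x c (Y x))) -
      (1 - tangentProj f x - Λ x) (secondFundamentalForm f x c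
        (diffAdjoint f x (mvfderiv I (fun y ↦ mvfderiv I f y (Y y)) x X))) =
    (1 - tangentProj f x - Λ x) (mvfderiv I Λ x c (secondFundamentalForm f x X (Y x))) := by
  have hxs := mem_extChartAt_source (I := I) x
  set φ := extChartAt I x with hφ
  have hΩ := isOpen_chart_preimage (I := I) x hU
  have h := (isKaehlerPatch K hf x).mono hΩ Set.inter_subset_left
  have hz : φ x ∈ φ.target ∩ φ.symm ⁻¹' U :=
    ⟨φ.map_source hxs, by rwa [Set.mem_preimage, φ.left_inv hxs]⟩
  have hval : ∀ {G : Type _} (g : M → G), g (φ.symm (φ x)) = g x :=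
    fun g ↦ congrArg g (φ.left_inv hxs)
  have hPd := ((contMDiff_tangentProj K hf).mdifferentiable (by simp)) x
  have hΛd : MDifferentiableAt I 𝓘(ℝ, V →L[ℝ] V) Λ x :=
    (hΛ.contMDiffAt (hU.mem_nhds hx)).mdifferentiableAt (by simp)
  have hYd := mdifferentiableAt_push f hY
  have e3 : ∀ v, fderiv ℝ (fun z ↦ tangentProj f (φ.symm z)) (φ x) (chartDeriv I x x v) =
      mvfderiv I (tangentProj f) x v := fderiv_comp_chart_symm_chartDeriv x hPd
  have e4 : ∀ v, fderiv ℝ (fun z ↦ Λ (φ.symm z)) (φ x) (chartDeriv I x x v) =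
      mvfderiv I Λ x v := fderiv_comp_chart_symm_chartDeriv x hΛd
  have e5 : ∀ v, fderiv ℝ ((fun y ↦ mvfderiv I f y (Y y)) ∘ φ.symm) (φ x) (chartDeriv I x x v) =
      mvfderiv I (fun y ↦ mvfderiv I f y (Y y)) x v := fderiv_comp_chart_symm_chartDeriv x hYd
  have key := h.codazzi hz (Λ := fun z ↦ Λ (φ.symm z))
    ⟨contDiffOn_comp_chart_symm x hΛ, fun z hz ↦ hid _ hz.2, fun z hz ↦ hsymm _ hz.2⟩
    (fun z hz ↦ hPΛ _ hz.2) (fun z hz ↦ hΛP _ hz.2)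
    (u := (fun y ↦ mvfderiv I f y (Y y)) ∘ φ.symm) (mdifferentiableAt_comp_chart_symm hxs hYd)
    (tangentProj_apply _ _) ?_ (X := chartDeriv I x x X) ?_ (chartDeriv I x x c)
  · have e6 : ((fun y ↦ mvfderiv I f y (Y y)) ∘ φ.symm) (φ x) = mvfderiv I f x (Y x) :=
      hval fun y ↦ mvfderiv I f y (Y y)
    simp only [e4, e5, e6] at key
    rw [hval (tangentProj f), hval Λ] at key
    rw [secondFundamentalForm_eq K hf, secondFundamentalForm_eq K hf,
      secondFundamentalForm_eq K hf, mvfderiv_diffAdjoint hf, ← e3 c, ← e3 X]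
    exact key
  · filter_upwards [hΩ.mem_nhds hz] with z hz e
    obtain ⟨w, rfl⟩ := (chartDeriv_bijective (I := I) (φ.map_target hz.1)).surjective e
    have h1 := hker _ hz.2 w
    rw [secondFundamentalForm_eq K hf, ← fderiv_comp_chart_symm hz.1
      (((contMDiff_tangentProj K hf).mdifferentiable (by simp)) _)] at h1
    exact h1
  · intro ξ
    have h1 := hX (diffAdjoint f x ξ)
    rw [secondFundamentalForm_eq K hf, mvfderiv_diffAdjoint hf] at h1
    rw [e3, hval (tangentProj f), hval Λ]
    exact h1

include hf in
theorem diffAdjoint_mvfderiv_complex {x : M} {Y : ∀ y : M, TangentSpace I y}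
    (hY : MDiffAt (T% Y) x) (v : TangentSpace I x) :
    diffAdjoint f x (mvfderiv I (fun y ↦ mvfderiv I f y (K.J y (Y y))) x v) =
      K.J x (diffAdjoint f x (mvfderiv I (fun y ↦ mvfderiv I f y (Y y)) x v)) := by
  rw [← diffAdjoint_tangentProj, tangentProj_mvfderiv_complex hf hY]
  exact diffAdjoint_apply hf x _

include hf in
theorem mlieBracket_eq {x : M} {X Y : ∀ y : M, TangentSpace I y} (hX : MDiffAt (T% X) x)
    (hY : MDiffAt (T% Y) x) : mlieBracket I X Y x =
      diffAdjoint f x (mvfderiv I (fun y ↦ mvfderiv I f y (Y y)) x (X x)) -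
        diffAdjoint f x (mvfderiv I (fun y ↦ mvfderiv I f y (X y)) x (Y x)) := by
  rw [← map_sub, ← mvfderiv_mlieBracket f.contMDiff.contMDiffAt hX hY, diffAdjoint_apply hf]

end Fundamental

section Pair

open VectorField

variable {E : Type*} [NormedAddCommGroup E] [InnerProductSpace ℝ E] [FiniteDimensional ℝ E]
  {H : Type*} [TopologicalSpace H] {I : ModelWithCorners ℝ E H} [I.Boundaryless]
  {M : Type*} [TopologicalSpace M] [ChartedSpace H M] [IsManifold I ∞ M]
  [RiemannianBundle (fun x : M ↦ TangentSpace I x)]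
  [IsContMDiffRiemannianBundle I ∞ E (fun x : M ↦ TangentSpace I x)]
  {V : Type*} [NormedAddCommGroup V] [InnerProductSpace ℝ V] [FiniteDimensional ℝ V]
  {W : Type*} [NormedAddCommGroup W] [NormedSpace ℝ W]

variable {K : KaehlerStructure I M} {f : C^∞⟮I, M; 𝓘(ℝ, V), V⟯}

variable {L : M → Submodule ℝ V} {𝒥 : ∀ x : M, L x →ₗ[ℝ] L x} {U : Set M}

theorem mem_normalSpace_iff {x : M} {ξ : V} : ξ ∈ normalSpace f x ↔ tangentProj f x ξ = 0 := by
  rw [tangentProj, Submodule.starProjection_apply_eq_zero_iff]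
  rfl

theorem firstNormalSpace_le (x : M) : firstNormalSpace f x ≤ normalSpace f x := by
  refine Submodule.span_le.mpr ?_
  rintro _ ⟨X, -, Y, -, rfl⟩
  exact mem_normalSpace_iff.mpr (tangentProj_secondFundamentalForm x X Y)

theorem tangentProj_starProjection {S : Submodule ℝ V} {x : M} (hS : S ≤ normalSpace f x) (ξ : V) :
    tangentProj f x (S.starProjection ξ) = 0 :=
  mem_normalSpace_iff.mp (hS (Submodule.starProjection_apply_mem _ _))

theorem starProjection_tangentProj {S : Submodule ℝ V} {x : M} (hS : S ≤ normalSpace f x) (ξ : V) :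
    S.starProjection (tangentProj f x ξ) = 0 := by
  apply ext_inner_right ℝ
  intro ζ
  rw [Submodule.inner_starProjection_left_eq_right, tangentProj_symm, tangentProj_starProjection hS]
  simp

theorem starProjection_idem (S : Submodule ℝ V) (ξ : V) :
    S.starProjection (S.starProjection ξ) = S.starProjection ξ :=
  Submodule.starProjection_eq_self_iff.mpr (Submodule.starProjection_apply_mem _ _)

theorem starProjection_normalCompl {x : M} (hS : L x ≤ normalSpace f x) :
    (normalCompl f L x).starProjection = 1 - tangentProj f x - (L x).starProjection := by
  ext ξ
  apply Submodule.eq_starProjection_of_mem_of_inner_eq_zero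
  · refine ⟨mem_normalSpace_iff.mpr ?_, ?_⟩
    · simp [tangentProj_idem, tangentProj_starProjection hS]
    · rw [SetLike.mem_coe, ← Submodule.starProjection_apply_eq_zero_iff]
      simp [starProjection_tangentProj hS, starProjection_idem]
  · intro ζ hζ
    have h1 := mem_normalSpace_iff.mp hζ.1
    have h2 : (L x).starProjection ζ = 0 := by
      rw [Submodule.starProjection_apply_eq_zero_iff]
      exact hζ.2
    have e : ξ - (1 - tangentProj f x - (L x).starProjection) ξ =
        tangentProj f x ξ + (L x).starProjection ξ := by
      change ξ - (ξ - tangentProj f x ξ - (L x).starProjection ξ) = _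
      abel
    rw [e, inner_add_left, tangentProj_symm, Submodule.inner_starProjection_left_eq_right, h1, h2]
    simp

theorem finrank_normalSpace (hf : IsIsometricImmersion f) (x : M) :
    finrank ℝ (normalSpace f x) + finrank ℝ E = finrank ℝ V := by
  have h1 := Submodule.finrank_add_finrank_orthogonal
    (LinearMap.range (mvfderiv I f x).toLinearMap)
  have h2 : finrank ℝ (LinearMap.range (mvfderiv I f x).toLinearMap) = finrank ℝ E :=
    LinearMap.finrank_range_of_inj
      ((injective_iff_map_eq_zero _).mpr fun v hv ↦ mvfderiv_injective hf x hv)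
  rw [h2] at h1
  rw [add_comm]
  exact h1

theorem finrank_normalCompl (hf : IsIsometricImmersion f) {x : M} (hS : L x ≤ normalSpace f x) :
    finrank ℝ (L x) + finrank ℝ (normalCompl f L x) + finrank ℝ E = finrank ℝ V := by
  rw [← finrank_normalSpace hf x, ← Submodule.finrank_add_inf_finrank_orthogonal hS, normalCompl,
    inf_comm]

variable (f L) in
/-- The component of the second fundamental form in `L`. -/
def parallelForm (x : M) : TangentSpace I x →ₗ[ℝ] TangentSpace I x →ₗ[ℝ] L x :=
  (secondFundamentalForm f x).compr₂ (L x).orthogonalProjectionOnto.toLinearMap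

variable (f L) in
/-- The component of the second fundamental form in the complement of `L`. -/
def complForm (x : M) : TangentSpace I x →ₗ[ℝ] TangentSpace I x →ₗ[ℝ] normalCompl f L x :=
  (secondFundamentalForm f x).compr₂ (normalCompl f L x).orthogonalProjectionOnto.toLinearMap

theorem coe_parallelForm (x : M) (X Y : TangentSpace I x) :
    (parallelForm f L x X Y : V) = (L x).starProjection (secondFundamentalForm f x X Y) := rfl

theorem coe_complForm (x : M) (X Y : TangentSpace I x) :
    (complForm f L x X Y : V) =
      (normalCompl f L x).starProjection (secondFundamentalForm f x X Y) := rfl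

theorem parallelForm_add_complForm {x : M} (hS : L x ≤ normalSpace f x) (X Y : TangentSpace I x) :
    (parallelForm f L x X Y : V) + complForm f L x X Y = secondFundamentalForm f x X Y := by
  rw [coe_parallelForm, coe_complForm, starProjection_normalCompl hS]
  simp [tangentProj_secondFundamentalForm]

theorem mem_kernelDistribution {x : M} {Y : TangentSpace I x} : Y ∈ kernelDistribution K f L x ↔
    (∀ X, complForm f L x X Y = 0) ∧ ∀ X, complForm f L x X (K.J x Y) = 0 := by
  rw [kernelDistribution, mem_complexKernel (J := (K.J x).toLinearMap) (K.J_sq x)]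
  simp only [← Submodule.coe_eq_zero, coe_complForm]
  rfl

theorem kernelDistribution_eq (x : M) : kernelDistribution K f L x =
    complexKernel (K.J x).toLinearMap (complForm f L x) := by
  ext Y
  rw [mem_kernelDistribution, mem_complexKernel (J := (K.J x).toLinearMap) (K.J_sq x)]
  rfl

theorem J_mem_kernelDistribution {x : M} {Y : TangentSpace I x}
    (hY : Y ∈ kernelDistribution K f L x) : K.J x Y ∈ kernelDistribution K f L x := by
  rw [mem_kernelDistribution] at hY ⊢
  exact ⟨hY.2, fun X ↦ by rw [K.J_sq, map_neg, hY.1, neg_zero]⟩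

theorem IsSubbundleOn.finrank_eq {k : ℕ} (h : IsSubbundleOn I L U k) {x : M} (hx : x ∈ U) :
    finrank ℝ (L x) = k := by
  obtain ⟨O, -, hxO, -, s, -, hs⟩ := h x hx
  rw [← (hs x hxO).2, finrank_span_eq_card (hs x hxO).1, Fintype.card_fin]

theorem IsTangentSubbundleOn.finrank_eq {D : ∀ x : M, Submodule ℝ (TangentSpace I x)} {k : ℕ}
    (h : IsTangentSubbundleOn D U k) {x : M} (hx : x ∈ U) : finrank ℝ (D x) = k := by
  obtain ⟨O, -, hxO, -, s, -, hs⟩ := h x hx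
  rw [← (hs x hxO).2, finrank_span_eq_card (hs x hxO).1, Fintype.card_fin]

theorem IsTangentSubbundleOn.exists_section {D : ∀ x : M, Submodule ℝ (TangentSpace I x)} {k : ℕ}
    (h : IsTangentSubbundleOn D U k) {x : M} (hx : x ∈ U) {v : TangentSpace I x} (hv : v ∈ D x) :
    ∃ O : Set M, IsOpen O ∧ x ∈ O ∧ O ⊆ U ∧ ∃ Y, IsTangentSectionOn D Y O ∧ Y x = v := by
  obtain ⟨O, hO, hxO, hOU, s, hss, hs⟩ := h x hx
  rw [← (hs x hxO).2, Submodule.mem_span_range_iff_exists_fun] at hv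
  obtain ⟨c, hc⟩ := hv
  refine ⟨O, hO, hxO, hOU, fun y ↦ ∑ i, c i • s i y, ⟨?_, fun y hy ↦ ?_⟩, hc⟩
  · exact ContMDiffOn.sum_section fun i _ ↦ contMDiffOn_const.smul_section (hss i)
  · rw [← (hs y hy).2]
    exact Submodule.sum_mem _ fun i _ ↦ Submodule.smul_mem _ _ (Submodule.subset_span ⟨i, rfl⟩)

theorem IsSmoothFieldOn.mdifferentiableAt {Y : ∀ y : M, TangentSpace I y} {O : Set M}
    (hY : IsSmoothFieldOn Y O) (hO : IsOpen O) {x : M} (hx : x ∈ O) : MDiffAt (T% Y) x :=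
  ((hY x hx).contMDiffAt (hO.mem_nhds hx)).mdifferentiableAt (by simp)

variable (K) in
theorem IsSmoothFieldOn.complex {Y : ∀ y : M, TangentSpace I y} {O : Set M}
    (hY : IsSmoothFieldOn Y O) : IsSmoothFieldOn (fun y ↦ K.J y (Y y)) O :=
  ContMDiffOn.clm_bundle_apply K.contMDiff_J.contMDiffOn hY

/-- A family of endomorphisms is smooth if it is so on a smooth frame of its coimage. -/
theorem contMDiffOn_of_frame {O : Set M} (hO : IsOpen O) {k : ℕ} {s s' : Fin k → M → V}
    {A : M → V →L[ℝ] V} (hs : ∀ i, ContMDiffOn I 𝓘(ℝ, V) ∞ (s i) O)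
    (hs' : ∀ i, ContMDiffOn I 𝓘(ℝ, V) ∞ (s' i) O)
    (hli : ∀ y ∈ O, LinearIndependent ℝ fun i ↦ s i y) (hA : ∀ y ∈ O, ∀ i, A y (s i y) = s' i y)
    (hA' : ∀ y ∈ O, ∀ ξ, (∀ i, inner ℝ (s i y) ξ = 0) → A y ξ = 0) :
    ContMDiffOn I 𝓘(ℝ, V →L[ℝ] V) ∞ A O := by
  intro x hx
  have hΩ := isOpen_chart_preimage (I := I) x hO
  set φ := extChartAt I x with hφ
  let S : (Fin k → M → V) → E → EuclideanSpace ℝ (Fin k) →L[ℝ] V := fun s z ↦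
    ∑ i, (EuclideanSpace.proj (𝕜 := ℝ) i).smulRight (s i (φ.symm z))
  have hS : ∀ (s : Fin k → M → V) z c, S s z c = ∑ i, c i • s i (φ.symm z) := fun s z c ↦ by
    simp [S]
  have hSs : ∀ s : Fin k → M → V, (∀ i, ContMDiffOn I 𝓘(ℝ, V) ∞ (s i) O) →
      ContDiffOn ℝ ∞ (S s) (φ.target ∩ φ.symm ⁻¹' O) := fun s hs ↦
    ContDiffOn.sum fun i _ ↦ contDiffOn_const.smulRight (contDiffOn_comp_chart_symm x (hs i))
  have h1 : ContDiffOn ℝ ∞ (A ∘ φ.symm) (φ.target ∩ φ.symm ⁻¹' O) := by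
    refine contDiffOn_of_frame (hSs s hs) (hSs s' hs') ?_ ?_ ?_
    · intro z hz
      rw [injective_iff_map_eq_zero]
      intro c hc
      rw [hS] at hc
      have := Fintype.linearIndependent_iff.mp (hli _ hz.2) _ hc
      ext i
      simpa using this i
    · intro z hz c
      simp only [hS, Function.comp_apply, map_sum, map_smul, hA _ hz.2]
    · intro z hz ξ h
      refine hA' _ hz.2 ξ fun i ↦ ?_
      have := h (EuclideanSpace.single i 1)
      rw [hS] at this
      simpa [Finset.sum_eq_single i] using this
  refine (contMDiffAt_of_comp_chart_symm (mem_extChartAt_source x)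
    (h1.contDiffAt (hΩ.mem_nhds ⟨mem_extChartAt_target x, ?_⟩))).contMDiffWithinAt
  rwa [Set.mem_preimage, φ.left_inv (mem_extChartAt_source x)]

theorem starProjection_eq_zero_of_span {ι : Type*} {S : Submodule ℝ V} {s : ι → V}
    (hs : Submodule.span ℝ (Set.range s) = S) {ξ : V} (hξ : ∀ i, inner ℝ (s i) ξ = 0) :
    S.starProjection ξ = 0 := by
  rw [Submodule.starProjection_apply_eq_zero_iff, ← hs, Submodule.mem_orthogonal]
  intro ζ hζ
  induction hζ using Submodule.span_induction with
  | mem ζ hζ => obtain ⟨i, rfl⟩ := hζ; exact hξ i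
  | zero => simp
  | add u v _ _ hu hv => rw [inner_add_left, hu, hv, add_zero]
  | smul r u _ hu => rw [inner_smul_left, hu, mul_zero]

theorem IsSubbundleOn.contMDiffOn_starProjection {k : ℕ} (h : IsSubbundleOn I L U k) :
    ContMDiffOn I 𝓘(ℝ, V →L[ℝ] V) ∞ (fun y ↦ (L y).starProjection) U := by
  intro x hx
  obtain ⟨O, hO, hxO, hOU, s, hss, hs⟩ := h x hx
  have hmem : ∀ y ∈ O, ∀ i, s i y ∈ L y := fun y hy i ↦ by
    rw [← (hs y hy).2]
    exact Submodule.subset_span ⟨i, rfl⟩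
  refine ((contMDiffOn_of_frame hO hss hss (fun y hy ↦ (hs y hy).1) (fun y hy i ↦
    Submodule.starProjection_eq_self_iff.mpr (hmem y hy i)) ?_).contMDiffAt
      (hO.mem_nhds hxO)).contMDiffWithinAt
  intro y hy ξ hξ
  exact starProjection_eq_zero_of_span (hs y hy).2 hξ

/-- An endomorphism of a subspace, extended by zero to the orthogonal complement. -/
def extendByZero (S : Submodule ℝ V) (j : S →ₗ[ℝ] S) : V →L[ℝ] V :=
  S.subtypeL ∘L LinearMap.toContinuousLinearMap j ∘L S.orthogonalProjectionOnto

section ExtendByZero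

variable {S : Submodule ℝ V} {j : S →ₗ[ℝ] S}

theorem extendByZero_apply (ξ : V) :
    extendByZero S j ξ = (j (S.orthogonalProjectionOnto ξ) : V) := rfl

theorem extendByZero_coe (ξ : S) : extendByZero S j ξ = j ξ := by
  rw [extendByZero_apply, Submodule.orthogonalProjectionOnto_mem_subspace_eq_self]

theorem extendByZero_mem (ξ : V) : extendByZero S j ξ ∈ S := (j _).2

theorem starProjection_extendByZero (ξ : V) :
    S.starProjection (extendByZero S j ξ) = extendByZero S j ξ :=
  Submodule.starProjection_eq_self_iff.mpr (extendByZero_mem ξ)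

theorem extendByZero_starProjection (ξ : V) :
    extendByZero S j (S.starProjection ξ) = extendByZero S j ξ :=
  extendByZero_coe _

theorem extendByZero_eq_zero {ξ : V} (hξ : S.starProjection ξ = 0) : extendByZero S j ξ = 0 := by
  rw [← extendByZero_starProjection, hξ, map_zero]

theorem extendByZero_sq (hj : ∀ ξ, j (j ξ) = -ξ) (ξ : V) :
    extendByZero S j (extendByZero S j ξ) = -S.starProjection ξ := by
  rw [extendByZero_apply ξ, extendByZero_coe, hj]
  rfl

theorem extendByZero_skew (hj : ∀ ξ, j (j ξ) = -ξ) (hi : ∀ ξ ζ, inner ℝ (j ξ) (j ζ) = inner ℝ ξ ζ)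
    (ξ ζ : V) : inner ℝ (extendByZero S j ξ) ζ = -inner ℝ ξ (extendByZero S j ζ) := by
  have h1 := hi (j (S.orthogonalProjectionOnto ξ)) (S.orthogonalProjectionOnto ζ)
  rw [hj, inner_neg_left] at h1
  have h2 : inner ℝ (extendByZero S j ξ) (S.starProjection ζ) =
      -inner ℝ (S.starProjection ξ) (extendByZero S j ζ) := h1.symm
  rw [← Submodule.inner_starProjection_left_eq_right, starProjection_extendByZero,
    Submodule.inner_starProjection_left_eq_right, starProjection_extendByZero] at h2
  exact h2

end ExtendByZero

theorem IsIsometricComplexStructureOn.contMDiffOn_extendByZero {k : ℕ}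
    (hs : IsSubbundleOn I L U k) (h : IsIsometricComplexStructureOn I L 𝒥 U) :
    ContMDiffOn I 𝓘(ℝ, V →L[ℝ] V) ∞ (fun y ↦ extendByZero (L y) (𝒥 y)) U := by
  intro x hx
  obtain ⟨O, hO, hxO, hOU, s, hss, hs⟩ := hs x hx
  have hmem : ∀ y ∈ O, ∀ i, s i y ∈ L y := fun y hy i ↦ by
    rw [← (hs y hy).2]
    exact Submodule.subset_span ⟨i, rfl⟩
  let η : Fin k → ∀ y : M, L y := fun i y ↦ (L y).orthogonalProjectionOnto (s i y)
  have hη : ∀ i, ∀ y ∈ O, (η i y : V) = s i y := fun i y hy ↦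
    Submodule.starProjection_eq_self_iff.mpr (hmem y hy i)
  have hηs : ∀ i, IsSectionOn I (η i) O := fun i ↦ (hss i).congr (hη i)
  refine ((contMDiffOn_of_frame hO hss (fun i ↦ h.smooth O hO hOU _ (hηs i))
    (fun y hy ↦ (hs y hy).1) (fun y hy i ↦ rfl) ?_).contMDiffAt
      (hO.mem_nhds hxO)).contMDiffWithinAt
  intro y hy ξ hξ
  exact extendByZero_eq_zero (starProjection_eq_zero_of_span (hs y hy).2 hξ)

end Pair

section PairConsequences

open VectorField

variable {E : Type*} [NormedAddCommGroup E] [InnerProductSpace ℝ E] [FiniteDimensional ℝ E]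
  {H : Type*} [TopologicalSpace H] {I : ModelWithCorners ℝ E H} [I.Boundaryless]
  {M : Type*} [TopologicalSpace M] [ChartedSpace H M] [IsManifold I ∞ M]
  [RiemannianBundle (fun x : M ↦ TangentSpace I x)]
  [IsContMDiffRiemannianBundle I ∞ E (fun x : M ↦ TangentSpace I x)]
  {V : Type*} [NormedAddCommGroup V] [InnerProductSpace ℝ V] [FiniteDimensional ℝ V]
  {W : Type*} [NormedAddCommGroup W] [NormedSpace ℝ W]

variable {K : KaehlerStructure I M} {f : C^∞⟮I, M; 𝓘(ℝ, V), V⟯}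

variable {L : M → Submodule ℝ V} {𝒥 : ∀ x : M, L x →ₗ[ℝ] L x} {U : Set M}

theorem mvfderiv_clm_apply {x : M} {A : M → V →L[ℝ] V} {u : M → V}
    (hA : MDifferentiableAt I 𝓘(ℝ, V →L[ℝ] V) A x) (hu : MDifferentiableAt I 𝓘(ℝ, V) u x)
    (v : TangentSpace I x) :
    mvfderiv I (fun y ↦ A y (u y)) x v = mvfderiv I A x v (u x) + A x (mvfderiv I u x v) := by
  have hx := mem_extChartAt_source (I := I) x
  have hA' := mdifferentiableAt_comp_chart_symm hx hA
  have hu' := mdifferentiableAt_comp_chart_symm hx hu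
  have hval : ∀ {G : Type _} (g : M → G), (g ∘ (extChartAt I x).symm) (extChartAt I x x) = g x :=
    fun g ↦ congrArg g ((extChartAt I x).left_inv hx)
  have := fderiv_clm_apply_apply hA' hu' (chartDeriv I x x v)
  rw [hval, hval] at this
  rw [mvfderiv_eq_fderiv_comp hx (hA.clm_apply hu), mvfderiv_eq_fderiv_comp hx hA,
    mvfderiv_eq_fderiv_comp hx hu]
  exact this

namespace IsPairOn

variable (hL : IsPairOn K f L 𝒥 U)

include hL in
theorem le_normalSpace {x : M} (hx : x ∈ U) : L x ≤ normalSpace f x :=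
  (hL.le_firstNormalSpace x hx).trans (firstNormalSpace_le x)

include hL in
theorem parallelForm_J {x : M} (hx : x ∈ U) (X Y : TangentSpace I x) :
    parallelForm f L x X (K.J x Y) = 𝒥 x (parallelForm f L x X Y) :=
  (hL.intertwines x hx X Y).symm

include hL in
theorem contMDiffOn_starProjection :
    ContMDiffOn I 𝓘(ℝ, V →L[ℝ] V) ∞ (fun y ↦ (L y).starProjection) U :=
  hL.subbundle.contMDiffOn_starProjection

variable (hf : IsIsometricImmersion f)

include hL hf in
theorem finrank_normalCompl {x : M} (hx : x ∈ U) :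
    finrank ℝ (normalCompl f L x) + 2 + finrank ℝ E = finrank ℝ V := by
  rw [← RealKaehler.finrank_normalCompl hf (hL.le_normalSpace hx), hL.subbundle.finrank_eq hx]
  ring

include hL hf in
theorem isSplitForm (hrank : ∀ x : M, finrank ℝ V - finrank ℝ E < complexRank K f x) {x : M}
    (hx : x ∈ U) : IsSplitForm (K.J x).toLinearMap (𝒥 x) (parallelForm f L x)
      (complForm f L x) where
  J_sq := K.J_sq x
  j_sq := hL.complexStructure.sq x hx
  finrank_L := hL.subbundle.finrank_eq hx
  a_symm X Y := congrArg (L x).orthogonalProjectionOnto (secondFundamentalForm_symm K hf x X Y)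
  b_symm X Y := congrArg (normalCompl f L x).orthogonalProjectionOnto
    (secondFundamentalForm_symm K hf x X Y)
  a_J := hL.parallelForm_J hx
  kaehler X Y Z W := by
    have hab : ∀ X Y Z W : TangentSpace I x,
        inner ℝ (complForm f L x X Y) (complForm f L x Z W) =
        inner ℝ (secondFundamentalForm f x X Y) (secondFundamentalForm f x Z W) -
        inner ℝ (parallelForm f L x X Y) (parallelForm f L x Z W) := fun X Y Z W ↦ by
      have h1 : ∀ ξ : L x, ∀ ζ : normalCompl f L x, (inner ℝ (ξ : V) (ζ : V) : ℝ) = 0 :=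
        fun ξ ζ ↦ (Submodule.mem_orthogonal _ _).mp ζ.2.2 ξ ξ.2
      have h1' : ∀ ξ : L x, ∀ ζ : normalCompl f L x, (inner ℝ (ζ : V) (ξ : V) : ℝ) = 0 :=
        fun ξ ζ ↦ (Submodule.mem_orthogonal' _ _).mp ζ.2.2 ξ ξ.2
      rw [← parallelForm_add_complForm (hL.le_normalSpace hx) X Y,
        ← parallelForm_add_complForm (hL.le_normalSpace hx) Z W, inner_add_left, inner_add_right,
        inner_add_right, h1, h1']
      simp
    have h2 := isKaehlerForm_secondFundamentalForm (K := K) hf x X Y Z W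
    have h3 := hL.complexStructure.inner_map x hx
    have h4 := hL.parallelForm_J hx
    simp only [ContinuousLinearMap.coe_coe] at h2 ⊢
    rw [hab, hab, hab, hab, h4, h4, h4, h4, h3, h3]
    linarith
  rank S hS := by
    have h1 : S ≤ complexKernel (K.J x).toLinearMap (secondFundamentalForm f x) := by
      intro Y hY
      rw [mem_complexKernel (J := (K.J x).toLinearMap) (K.J_sq x)]
      have h2 := parallelForm_add_complForm (hL.le_normalSpace hx)
      refine ⟨fun X ↦ ?_, fun X ↦ ?_⟩
      · rw [← h2, (hS Y hY X).1, (hS Y hY X).2.1]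
        simp
      · rw [← h2, (hS Y hY X).2.2.1, (hS Y hY X).2.2.2]
        simp
    have h2 := Submodule.finrank_mono h1
    have h3 := hrank x
    rw [complexRank] at h3
    have h4 := hL.finrank_normalCompl hf hx
    omega

variable (f L) in
/-- The component in the complement of `L` of the derivative of sections of `L`. -/
def _root_.RealKaehler.complDeriv (x : M) :
    TangentSpace I x →ₗ[ℝ] L x →ₗ[ℝ] normalCompl f L x :=
  LinearMap.mk₂ ℝ (fun X η ↦ (normalCompl f L x).orthogonalProjectionOnto
      (mvfderiv I (fun y ↦ (L y).starProjection) x X η))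
    (by intros; simp) (by intros; simp) (by intros; simp) (by intros; simp)

omit hL in
theorem coe_complDeriv (x : M) (X : TangentSpace I x) (η : L x) :
    (complDeriv f L x X η : V) = (normalCompl f L x).starProjection
      (mvfderiv I (fun y ↦ (L y).starProjection) x X η) := rfl

include hL in
theorem coe_parallelForm_of_mem {x : M} (hx : x ∈ U) {X Y : TangentSpace I x}
    (hY : Y ∈ kernelDistribution K f L x) :
    (parallelForm f L x X Y : V) = secondFundamentalForm f x X Y := by
  rw [← parallelForm_add_complForm (hL.le_normalSpace hx), (mem_kernelDistribution.mp hY).1]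
  simp

include hL hf in
/-- The Codazzi equation for a section of the kernel distribution. -/
theorem codazzi {O : Set M} (hO : IsOpen O) (hOU : O ⊆ U) {Y : ∀ y : M, TangentSpace I y}
    (hY : IsTangentSectionOn (kernelDistribution K f L) Y O) {x : M} (hx : x ∈ O)
    {X : TangentSpace I x} (hX : X ∈ kernelDistribution K f L x) (c : TangentSpace I x) :
    complDeriv f L x X (parallelForm f L x (Y x) c) - complForm f L x
        (diffAdjoint f x (mvfderiv I (fun y ↦ mvfderiv I f y (Y y)) x X)) c =
      complDeriv f L x c (parallelForm f L x X (Y x)) := by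
  have hs := secondFundamentalForm_symm K hf x
  have h0 : ∀ y ∈ O, (normalCompl f L y).starProjection =
      1 - tangentProj f y - (L y).starProjection := fun y hy ↦
    starProjection_normalCompl (hL.le_normalSpace (hOU hy))
  have key := RealKaehler.codazzi K hf hO (hL.contMDiffOn_starProjection.mono hOU)
    (fun y _ ↦ starProjection_idem _)
    (fun y _ ↦ Submodule.inner_starProjection_left_eq_right _)
    (fun y hy ↦ tangentProj_starProjection (hL.le_normalSpace (hOU hy)))
    (fun y hy ↦ starProjection_tangentProj (hL.le_normalSpace (hOU hy))) hx
    (hY.1.mdifferentiableAt hO hx) (fun y hy c ↦ ?_) (X := X) (fun w ↦ ?_) c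
  · apply Subtype.ext
    rw [Submodule.coe_sub, coe_complDeriv, coe_complDeriv, coe_complForm,
      hL.coe_parallelForm_of_mem (hOU hx) (hY.2 x hx), hs _ c, h0 x hx, ← key]
    congr 3
    have : parallelForm f L x (Y x) c = parallelForm f L x c (Y x) :=
      congrArg (L x).orthogonalProjectionOnto (hs _ _)
    rw [this, hL.coe_parallelForm_of_mem (hOU hx) (hY.2 x hx)]
  · rw [← h0 y hy]
    exact congrArg Subtype.val ((mem_kernelDistribution.mp (hY.2 y hy)).1 c)
  · rw [← h0 x hx, hs]
    exact congrArg Subtype.val ((mem_kernelDistribution.mp hX).1 w)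

omit hL in
theorem isTangentSectionOn_complex {O : Set M} {Y : ∀ y : M, TangentSpace I y}
    (hY : IsTangentSectionOn (kernelDistribution K f L) Y O) :
    IsTangentSectionOn (kernelDistribution K f L) (fun y ↦ K.J y (Y y)) O :=
  ⟨hY.1.complex K, fun y hy ↦ J_mem_kernelDistribution (hY.2 y hy)⟩

include hL hf in
theorem codazzi_complex {O : Set M} (hO : IsOpen O) (hOU : O ⊆ U) {Y : ∀ y : M, TangentSpace I y}
    (hY : IsTangentSectionOn (kernelDistribution K f L) Y O) {x : M} (hx : x ∈ O)
    {X : TangentSpace I x} (hX : X ∈ kernelDistribution K f L x) (c : TangentSpace I x) :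
    complDeriv f L x X (parallelForm f L x (K.J x (Y x)) c) - complForm f L x
        (K.J x (diffAdjoint f x (mvfderiv I (fun y ↦ mvfderiv I f y (Y y)) x X))) c =
      complDeriv f L x c (parallelForm f L x X (K.J x (Y x))) := by
  rw [← diffAdjoint_mvfderiv_complex hf (hY.1.mdifferentiableAt hO hx)]
  exact hL.codazzi hf hO hOU (isTangentSectionOn_complex hY) hx hX c

include hL hf in
theorem complDeriv_eq_zero_or
    (hrank : ∀ x : M, finrank ℝ V - finrank ℝ E < complexRank K f x) {x : M} (hx : x ∈ U)
    (hN : finrank ℝ (normalCompl f L x) = 1 ∨ finrank ℝ (normalCompl f L x) = 2)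
    (hk : finrank ℝ (TangentSpace I x) ≤ finrank ℝ (kernelDistribution K f L x) +
      2 * finrank ℝ (normalCompl f L x)) :
    (∀ X ∈ kernelDistribution K f L x, complDeriv f L x X = 0) ∨
      IsSplitForm.IsHolomorphic (K.J x).toLinearMap (complForm f L x) := by
  rw [kernelDistribution_eq] at hk ⊢
  refine (hL.isSplitForm hf hrank hx).eq_zero_or_isHolomorphic hN hk (complDeriv f L x) ?_
  rw [← kernelDistribution_eq]
  intro X hX Y hY
  obtain ⟨d, hd⟩ := hL.kernel_subbundle
  obtain ⟨O, hO, hxO, hOU, Ys, hYs, rfl⟩ := hd.exists_section hx hY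
  exact ⟨_, fun Z ↦ ⟨hL.codazzi hf hO hOU hYs hxO hX Z,
    hL.codazzi_complex hf hO hOU hYs hxO hX Z⟩⟩

include hL in
theorem normalConnection_sub {O : Set M} (hO : IsOpen O) (hOU : O ⊆ U) {η : ∀ x : M, L x}
    (hη : IsSectionOn I η O) {x : M} (hx : x ∈ O) (X : TangentSpace I x) :
    normalConnection f (fun y ↦ (η y : V)) x X =
      complDeriv f L x X (η x) + (L x).starProjection (mvfderiv I (fun y ↦ (η y : V)) x X) := by
  have hηd : MDifferentiableAt I 𝓘(ℝ, V) (fun y ↦ (η y : V)) x :=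
    (hη.contMDiffAt (hO.mem_nhds hx)).mdifferentiableAt (by simp)
  have hΛd : MDifferentiableAt I 𝓘(ℝ, V →L[ℝ] V) (fun y ↦ (L y).starProjection) x :=
    ((hL.contMDiffOn_starProjection.mono hOU).contMDiffAt (hO.mem_nhds hx)).mdifferentiableAt
      (by simp)
  have h1 := mvfderiv_clm_apply hΛd hηd X
  have h2 : (fun y ↦ (L y).starProjection (η y : V)) = fun y ↦ (η y : V) :=
    funext fun y ↦ Submodule.starProjection_eq_self_iff.mpr (η y).2
  rw [h2] at h1
  have h3 := starProjection_normalCompl (hL.le_normalSpace (hOU hx))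
  have hS := hL.le_normalSpace (hOU hx)
  have h4 : mvfderiv I (fun y ↦ (L y).starProjection) x X (η x) =
      mvfderiv I (fun y ↦ (η y : V)) x X -
        (L x).starProjection (mvfderiv I (fun y ↦ (η y : V)) x X) := eq_sub_of_add_eq h1.symm
  rw [coe_complDeriv, h4, h3, normalConnection, starProjection_normalSpace]
  simp only [sub_apply, map_sub, starProjection_idem, tangentProj_starProjection hS, sub_self,
    sub_zero, one_apply_eq_self]
  abel

end IsPairOn

end PairConsequences

section PairConditions

open VectorField

variable {E : Type*} [NormedAddCommGroup E] [InnerProductSpace ℝ E] [FiniteDimensional ℝ E]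
  {H : Type*} [TopologicalSpace H] {I : ModelWithCorners ℝ E H} [I.Boundaryless]
  {M : Type*} [TopologicalSpace M] [ChartedSpace H M] [IsManifold I ∞ M]
  [RiemannianBundle (fun x : M ↦ TangentSpace I x)]
  [IsContMDiffRiemannianBundle I ∞ E (fun x : M ↦ TangentSpace I x)]
  {V : Type*} [NormedAddCommGroup V] [InnerProductSpace ℝ V] [FiniteDimensional ℝ V]
  {W : Type*} [NormedAddCommGroup W] [NormedSpace ℝ W]

variable {K : KaehlerStructure I M} {f : C^∞⟮I, M; 𝓘(ℝ, V), V⟯}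

variable {L : M → Submodule ℝ V} {𝒥 : ∀ x : M, L x →ₗ[ℝ] L x} {U : Set M}

namespace IsPairOn

variable (hL : IsPairOn K f L 𝒥 U)

include hL in
theorem contMDiffOn_complexStructure :
    ContMDiffOn I 𝓘(ℝ, V →L[ℝ] V) ∞ (fun y ↦ extendByZero (L y) (𝒥 y)) U :=
  hL.complexStructure.contMDiffOn_extendByZero hL.subbundle

include hL in
theorem starProjection_mvfderiv_complexStructure (hU : IsOpen U) {x : M} (hx : x ∈ U)
    (X : TangentSpace I x) (η : L x) :
    (L x).starProjection (mvfderiv I (fun y ↦ extendByZero (L y) (𝒥 y)) x X η) = 0 := by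
  have hxs := mem_extChartAt_source (I := I) x
  have hΩ := isOpen_chart_preimage (I := I) x hU
  set φ := extChartAt I x with hφ
  have hz : φ x ∈ φ.target ∩ φ.symm ⁻¹' U :=
    ⟨φ.map_source hxs, by rwa [Set.mem_preimage, φ.left_inv hxs]⟩
  have hjd : MDifferentiableAt I 𝓘(ℝ, V →L[ℝ] V) (fun y ↦ extendByZero (L y) (𝒥 y)) x :=
    (hL.contMDiffOn_complexStructure.contMDiffAt (hU.mem_nhds hx)).mdifferentiableAt (by simp)
  have hval : ∀ {G : Type _} (g : M → G), g (φ.symm (φ x)) = g x :=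
    fun g ↦ congrArg g (φ.left_inv hxs)
  have key := proj_fderiv_complexStructure (L := L x) hΩ
    (Λ := fun z ↦ (L (φ.symm z)).starProjection)
    (j := fun z ↦ extendByZero (L (φ.symm z)) (𝒥 (φ.symm z)))
    ⟨contDiffOn_comp_chart_symm x hL.contMDiffOn_starProjection, fun z _ ↦ starProjection_idem _,
      fun z _ ↦ Submodule.inner_starProjection_left_eq_right _⟩
    (contDiffOn_comp_chart_symm x hL.contMDiffOn_complexStructure)
    (fun z hz ↦ extendByZero_skew (hL.complexStructure.sq _ hz.2)
      (hL.complexStructure.inner_map _ hz.2))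
    (fun z _ ↦ extendByZero_starProjection) (fun z _ ↦ starProjection_extendByZero)
    (fun z hz ↦ extendByZero_sq (hL.complexStructure.sq _ hz.2)) hz
    (hL.subbundle.finrank_eq hx)
    (fun ξ ↦ by
      rw [hval fun y ↦ (L y).starProjection]
      exact Submodule.starProjection_eq_self_iff.symm) (chartDeriv I x x X) η.2
  rw [hval fun y ↦ (L y).starProjection] at key
  rw [mvfderiv_eq_fderiv_comp hxs hjd]
  exact key

include hL in
theorem conditionC1 (hU : IsOpen U) : ConditionC1 K f L 𝒥 U := by
  refine ⟨fun O hO hOU η hη x hx X ↦ ?_, hL.intertwines⟩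
  have hS := hL.le_normalSpace (hOU hx)
  have hηd : MDifferentiableAt I 𝓘(ℝ, V) (fun y ↦ (η y : V)) x :=
    (hη.contMDiffAt (hO.mem_nhds hx)).mdifferentiableAt (by simp)
  have hjs := hL.contMDiffOn_complexStructure.mono hOU
  have hjd : MDifferentiableAt I 𝓘(ℝ, V →L[ℝ] V) (fun y ↦ extendByZero (L y) (𝒥 y)) x :=
    (hjs.contMDiffAt (hO.mem_nhds hx)).mdifferentiableAt (by simp)
  have h1 := mvfderiv_clm_apply hjd hηd X
  have h2 : (fun y ↦ extendByZero (L y) (𝒥 y) (η y : V)) = fun y ↦ (𝒥 y (η y) : V) :=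
    funext fun y ↦ extendByZero_coe _
  rw [h2] at h1
  have h3 : ∀ ξ : V, (L x).starProjection ((normalSpace f x).starProjection ξ) =
      (L x).starProjection ξ := fun ξ ↦ by
    rw [starProjection_normalSpace]
    simp [starProjection_tangentProj hS]
  have h4 : ∀ ξ : V, (L x).orthogonalProjectionOnto ((normalSpace f x).starProjection ξ) =
      (L x).orthogonalProjectionOnto ξ := fun ξ ↦ Subtype.ext (h3 ξ)
  rw [normalConnection, normalConnection, h4, h4, h1]
  apply Subtype.ext
  rw [map_add, Submodule.coe_add]
  have h5 := hL.starProjection_mvfderiv_complexStructure hU (hOU hx) X (η x)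
  have h6 : ∀ ξ : V, (((L x).orthogonalProjectionOnto (extendByZero (L x) (𝒥 x) ξ) : L x) : V) =
      𝒥 x ((L x).orthogonalProjectionOnto ξ) := starProjection_extendByZero
  rw [h6]
  exact (congrArg (· + _) h5).trans (zero_add _)

variable (hf : IsIsometricImmersion f)

include hL in
theorem imageSpan_eq {x : M} (hx : x ∈ U) {X Y : TangentSpace I x}
    (hX : X ∈ kernelDistribution K f L x) (hY : Y ∈ kernelDistribution K f L x)
    (hne : parallelForm f L x X Y ≠ 0) :
    L x = imageSpan (secondFundamentalForm f x) (kernelDistribution K f L x) := by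
  apply le_antisymm
  · intro ξ hξ
    obtain ⟨s, t, hst⟩ := IsSplitForm.exists_smul_add_smul (hL.complexStructure.sq x hx)
      (hL.subbundle.finrank_eq hx) hne ⟨ξ, hξ⟩
    have h1 := congrArg Subtype.val hst
    rw [← hL.parallelForm_J hx, Submodule.coe_add, Submodule.coe_smul, Submodule.coe_smul,
      hL.coe_parallelForm_of_mem hx hY,
      hL.coe_parallelForm_of_mem hx (J_mem_kernelDistribution hY)] at h1
    change ξ = _ at h1
    rw [h1]
    exact Submodule.add_mem _
      (Submodule.smul_mem _ _ (Submodule.subset_span ⟨X, hX, Y, hY, rfl⟩))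
      (Submodule.smul_mem _ _
        (Submodule.subset_span ⟨X, hX, _, J_mem_kernelDistribution hY, rfl⟩))
  · refine Submodule.span_le.mpr ?_
    rintro _ ⟨X, -, Y, hY, rfl⟩
    rw [← hL.coe_parallelForm_of_mem hx hY]
    exact (parallelForm f L x X Y).2

include hL in
theorem conditionC2 (hB : ∀ x ∈ U, ∀ X ∈ kernelDistribution K f L x, complDeriv f L x X = 0) :
    ConditionC2 K f L U := by
  intro O hO hOU Y hY η hη x hx
  rw [hL.normalConnection_sub hO hOU hη hx, hB x (hOU hx) _ (hY.2 x hx)]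
  simp [Submodule.starProjection_apply_mem]

include hL hf in
theorem isIntegrableOn
    (hB : ∀ x ∈ U, ∀ X ∈ kernelDistribution K f L x, complDeriv f L x X = 0) :
    IsIntegrableOn (kernelDistribution K f L) U := by
  intro O hO hOU X Y hX hY x hx
  have hs : ∀ X Y, complForm f L x X Y = complForm f L x Y X := fun X Y ↦
    congrArg (normalCompl f L x).orthogonalProjectionOnto (secondFundamentalForm_symm K hf x X Y)
  have hs' : ∀ X Y, parallelForm f L x X Y = parallelForm f L x Y X := fun X Y ↦
    congrArg (L x).orthogonalProjectionOnto (secondFundamentalForm_symm K hf x X Y)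
  rw [mlieBracket_eq hf (hX.1.mdifferentiableAt hO hx) (hY.1.mdifferentiableAt hO hx),
    mem_kernelDistribution]
  constructor
  · intro c
    have h1 := hL.codazzi hf hO hOU hY hx (hX.2 x hx) c
    have h2 := hL.codazzi hf hO hOU hX hx (hY.2 x hx) c
    rw [hB x (hOU hx) _ (hX.2 x hx)] at h1
    rw [hB x (hOU hx) _ (hY.2 x hx), hs' (Y x) (X x), ← h1] at h2
    rw [map_sub, hs c, hs c, sub_eq_zero]
    simpa using h2.symm
  · intro c
    have h1 := hL.codazzi_complex hf hO hOU hY hx (hX.2 x hx) c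
    have h2 := hL.codazzi_complex hf hO hOU hX hx (hY.2 x hx) c
    rw [hB x (hOU hx) _ (hX.2 x hx), hL.parallelForm_J (hOU hx)] at h1
    rw [hB x (hOU hx) _ (hY.2 x hx), hL.parallelForm_J (hOU hx),
      hs' (Y x) (X x), ← h1] at h2
    rw [map_sub, map_sub, hs c, hs c, sub_eq_zero]
    simpa using h2.symm

end IsPairOn

end PairConditions

section Holomorphic

open VectorField

variable {E : Type*} [NormedAddCommGroup E] [InnerProductSpace ℝ E] [FiniteDimensional ℝ E]
  {H : Type*} [TopologicalSpace H] {I : ModelWithCorners ℝ E H} [I.Boundaryless]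
  {M : Type*} [TopologicalSpace M] [ChartedSpace H M] [IsManifold I ∞ M]
  [RiemannianBundle (fun x : M ↦ TangentSpace I x)]
  [IsContMDiffRiemannianBundle I ∞ E (fun x : M ↦ TangentSpace I x)]
  {V : Type*} [NormedAddCommGroup V] [InnerProductSpace ℝ V] [FiniteDimensional ℝ V]
  {W : Type*} [NormedAddCommGroup W] [NormedSpace ℝ W]

variable {K : KaehlerStructure I M} {f : C^∞⟮I, M; 𝓘(ℝ, V), V⟯}

/-- If the second fundamental form is complex bilinear for a smooth complex structure `j` of the
normal spaces, which it spans, then the immersion is holomorphic. -/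
theorem exists_isHolomorphicOn (hf : IsIsometricImmersion f) {O : Set M} (hO : IsOpen O) {x : M}
    (hx : x ∈ O) {j : M → V →L[ℝ] V} (hj : ContMDiffOn I 𝓘(ℝ, V →L[ℝ] V) ∞ j O)
    (hskew : ∀ y ∈ O, ∀ ξ ζ, inner ℝ (j y ξ) ζ = -inner ℝ ξ (j y ζ))
    (hjP : ∀ y ∈ O, ∀ ξ, j y (tangentProj f y ξ) = 0)
    (hPj : ∀ y ∈ O, ∀ ξ, tangentProj f y (j y ξ) = 0)
    (hsq : ∀ y ∈ O, ∀ ξ, j y (j y ξ) = tangentProj f y ξ - ξ)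
    (hjα : ∀ y ∈ O, ∀ v w, j y (secondFundamentalForm f y v w) =
      secondFundamentalForm f y v (K.J y w))
    (hN : ∀ y ∈ O, ∀ ξ, tangentProj f y ξ = 0 →
      (∀ v w, inner ℝ ξ (secondFundamentalForm f y v w) = 0) → ξ = 0) :
    ∃ O' : Set M, IsOpen O' ∧ x ∈ O' ∧ IsHolomorphicOn K f O' := by
  have hxs := mem_extChartAt_source (I := I) x
  have hΩ := isOpen_chart_preimage (I := I) x hO
  have h := isKaehlerPatch K hf x
  set φ := extChartAt I x with hφ
  have hz : φ x ∈ φ.target ∩ φ.symm ⁻¹' O :=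
    ⟨φ.map_source hxs, by rwa [Set.mem_preimage, φ.left_inv hxs]⟩
  have hPd := (contMDiff_tangentProj K hf).mdifferentiable (by simp)
  have hα : ∀ z ∈ φ.target, ∀ v w : TangentSpace I (φ.symm z),
      fderiv ℝ (fun z ↦ tangentProj f (φ.symm z)) z (chartDeriv I x _ v) (mvfderiv I f _ w) =
        secondFundamentalForm f (φ.symm z) v w := fun z hz v w ↦ by
    rw [secondFundamentalForm_eq K hf, ← fderiv_comp_chart_symm hz (hPd _)]
    rfl
  have hsurj : ∀ z ∈ φ.target, ∀ e : E, ∃ w : TangentSpace I (φ.symm z),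
      chartDeriv I x _ w = e := fun z hz ↦ (chartDeriv_bijective (φ.map_target hz)).surjective
  set A : M → V →L[ℝ] V := fun y ↦ tangentComplex K f y + j y with hA
  have key : ∀ z ∈ φ.target ∩ φ.symm ⁻¹' O, fderiv ℝ (fun z ↦ A (φ.symm z)) z = 0 := by
    intro z hz
    refine IsKaehlerPatch.fderiv_add_eq_zero hΩ Set.inter_subset_left h
      (j := fun z ↦ j (φ.symm z)) (contDiffOn_comp_chart_symm x hj) (fun z hz ↦ hskew _ hz.2)
      (fun z hz ↦ hjP _ hz.2) ?_ ?_ hz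
    · intro z hz v ξ
      obtain ⟨v, rfl⟩ := hsurj z hz.1 v
      rw [← tangentComplex_tangentProj, ← mvfderiv_diffAdjoint hf, tangentComplex_apply hf,
        hα z hz.1, hα z hz.1, hjα _ hz.2]
    · intro z hz ξ hξ h0
      refine hN _ hz.2 ξ hξ fun v w ↦ ?_
      have := h0 (chartDeriv I x _ v) (chartDeriv I x _ w)
      rwa [fderiv_comp_chart_symm hz.1 (mdifferentiableAt_of_smooth (f := f) _), hα z hz.1] at this
  obtain ⟨r, hr, hball⟩ := Metric.isOpen_iff.mp hΩ _ hz
  have hconst : ∀ z ∈ Metric.ball (φ x) r, A (φ.symm z) = A x := by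
    intro z hz'
    have hd : DifferentiableOn ℝ (fun z ↦ A (φ.symm z)) (Metric.ball (φ x) r) := fun z hz ↦
      (((h.contDiffOn_C.contDiffAt (h.isOpen.mem_nhds (hball hz).1)).add
        ((contDiffOn_comp_chart_symm x hj).contDiffAt (hΩ.mem_nhds (hball hz)))).differentiableAt
          (by simp)).differentiableWithinAt
    have h1 := Metric.isOpen_ball.is_const_of_fderiv_eq_zero
      (convex_ball (φ x) r).isPreconnected hd (fun z hz ↦ key z (hball hz)) hz'
      (Metric.mem_ball_self hr)
    simpa [φ.left_inv hxs] using h1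
  have hjC : ∀ ξ, j x (tangentComplex K f x ξ) = 0 := fun ξ ↦ by
    rw [← tangentProj_tangentComplex, hjP x hx]
  have hCj : ∀ ξ, tangentComplex K f x (j x ξ) = 0 := fun ξ ↦ by
    rw [← tangentComplex_tangentProj, hPj x hx, map_zero]
  have hAsq : ∀ ξ, A x (A x ξ) = -ξ := fun ξ ↦ by
    simp only [hA, add_apply, map_add, hjC, hCj, hsq x hx, tangentComplex_sq hf]
    abel
  have hAskew : ∀ ξ ζ, inner ℝ (A x ξ) ζ = -inner ℝ ξ (A x ζ) := fun ξ ζ ↦ by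
    simp only [hA, add_apply, inner_add_left, inner_add_right, hskew x hx ξ,
      tangentComplex_skew x ξ]
    ring
  let C : V →ₗᵢ[ℝ] V := (A x).toLinearMap.isometryOfInner fun ξ ζ ↦ by
    change inner ℝ (A x ξ) (A x ζ) = inner ℝ ξ ζ
    rw [hAskew, hAsq, inner_neg_right, neg_neg]
  refine ⟨φ.source ∩ φ ⁻¹' Metric.ball (φ x) r,
    (continuousOn_extChartAt x).isOpen_inter_preimage (isOpen_extChartAt_source x)
      Metric.isOpen_ball, ⟨hxs, Metric.mem_ball_self hr⟩, C, hAsq, fun y hy v ↦ ?_⟩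
  have hyO : y ∈ O := by
    have := (hball hy.2).2
    rwa [Set.mem_preimage, φ.left_inv hy.1] at this
  have h1 := hconst _ hy.2
  rw [φ.left_inv hy.1] at h1
  change _ = A x _
  rw [← h1]
  change _ = tangentComplex K f y _ + j y _
  rw [tangentComplex_apply hf, ← tangentProj_apply y v, hjP y hyO, add_zero]

theorem contMDiffOn_secondFundamentalForm (hf : IsIsometricImmersion f) (K : KaehlerStructure I M)
    {O : Set M} (hO : IsOpen O) {X Y : ∀ y : M, TangentSpace I y} (hX : IsSmoothFieldOn X O)
    (hY : IsSmoothFieldOn Y O) :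
    ContMDiffOn I 𝓘(ℝ, V) ∞ (fun y ↦ secondFundamentalForm f y (X y) (Y y)) O := by
  simp only [secondFundamentalForm_eq K hf]
  exact (contMDiffOn_push hO (contMDiff_tangentProj K hf).contMDiffOn hX).clm_apply
    (contMDiffOn_push hO f.contMDiff.contMDiffOn hY)

variable {L : M → Submodule ℝ V} {𝒥 : ∀ x : M, L x →ₗ[ℝ] L x} {U : Set M}

namespace IsPairOn

variable (hL : IsPairOn K f L 𝒥 U) (hf : IsIsometricImmersion f)

include hL hf in
theorem contMDiffAt_extendByZero_normalCompl {O : Set M} (hO : IsOpen O) (hOU : O ⊆ U)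
    (hN : ∀ y ∈ O, finrank ℝ (normalCompl f L y) = 2)
    {j : ∀ y, normalCompl f L y →ₗ[ℝ] normalCompl f L y}
    (hji : ∀ y ∈ O, ∀ ξ ζ, inner ℝ (j y ξ) (j y ζ) = inner ℝ ξ ζ)
    (hjsq : ∀ y ∈ O, ∀ ξ, j y (j y ξ) = -ξ)
    (hj : ∀ y ∈ O, ∀ X Y, j y (complForm f L y X Y) = complForm f L y X (K.J y Y)) {x : M}
    (hx : x ∈ O) {X Y : TangentSpace I x} (hXY : complForm f L x X Y ≠ 0) :
    ContMDiffAt I 𝓘(ℝ, V →L[ℝ] V) ∞ (fun y ↦ extendByZero (normalCompl f L y) (j y)) x := by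
  have hxs := mem_extChartAt_source (I := I) x
  obtain ⟨Xs, hXs, hXss⟩ := exists_constant_field (I := I) x (chartDeriv I x x X)
  obtain ⟨Ys, hYs, hYss⟩ := exists_constant_field (I := I) x (chartDeriv I x x Y)
  have hXx : Xs x = X := (chartDeriv_bijective hxs).injective (hXs x hxs)
  have hYx : Ys x = Y := (chartDeriv_bijective hxs).injective (hYs x hxs)
  set O' := O ∩ (extChartAt I x).source with hO'def
  have hO' : IsOpen O' := hO.inter (isOpen_extChartAt_source x)
  have hXo : IsSmoothFieldOn Xs O' := hXss.mono Set.inter_subset_right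
  have hYo : IsSmoothFieldOn Ys O' := hYss.mono Set.inter_subset_right
  have hQ : ContMDiffOn I 𝓘(ℝ, V →L[ℝ] V) ∞ (fun y ↦ (normalCompl f L y).starProjection) O' := by
    have h1 : ContMDiffOn I 𝓘(ℝ, V →L[ℝ] V) ∞
        (fun y ↦ 1 - tangentProj f y - (L y).starProjection) O' :=
      (contMDiffOn_const.sub (contMDiff_tangentProj K hf).contMDiffOn).sub
        (hL.contMDiffOn_starProjection.mono (Set.inter_subset_left.trans hOU))
    exact h1.congr fun y hy ↦ starProjection_normalCompl (hL.le_normalSpace (hOU hy.1))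
  have ht := hQ.clm_apply (contMDiffOn_secondFundamentalForm hf K hO' hXo hYo)
  have hs := hQ.clm_apply (contMDiffOn_secondFundamentalForm hf K hO' hXo (hYo.complex K))
  have hΩ := isOpen_chart_preimage (I := I) x hO'
  set φ := extChartAt I x with hφ
  have hz : φ x ∈ φ.target ∩ φ.symm ⁻¹' O' :=
    ⟨φ.map_source hxs, by rw [Set.mem_preimage, φ.left_inv hxs]; exact ⟨hx, hxs⟩⟩
  refine contMDiffAt_of_comp_chart_symm hxs (contDiffAt_complexStructure
    (L := fun z ↦ normalCompl f L (φ.symm z))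
    ((contDiffOn_comp_chart_symm x ht).contDiffAt (hΩ.mem_nhds hz))
    ((contDiffOn_comp_chart_symm x hs).contDiffAt (hΩ.mem_nhds hz)) ?_ ?_)
  · have h1 := φ.left_inv hxs
    simp only [Function.comp_apply]
    rw [← hφ, h1, hXx, hYx]
    exact fun h0 ↦ hXY (Subtype.ext h0)
  · filter_upwards [hΩ.mem_nhds hz] with z hz
    have hzO := hz.2.1
    refine ⟨hN _ hzO, fun ξ ↦ extendByZero_mem _, fun ξ hξ ↦ extendByZero_eq_zero ?_,
      fun ξ hξ ↦ ?_, extendByZero_skew (hjsq _ hzO) (hji _ hzO),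
      Submodule.starProjection_apply_mem _ _, ?_⟩
    · rwa [Submodule.starProjection_apply_eq_zero_iff]
    · refine (extendByZero_sq (hjsq _ hzO) ξ).trans ?_
      rw [Submodule.starProjection_eq_self_iff.mpr hξ]
    · have := congrArg Subtype.val (hj _ hzO (Xs (φ.symm z)) (Ys (φ.symm z)))
      rw [← extendByZero_coe] at this
      exact this.symm

include hL hf in
theorem exists_isHolomorphicOn {O : Set M} (hO : IsOpen O) (hOU : O ⊆ U) {x : M} (hx : x ∈ O)
    (h : ∀ y ∈ O, IsSplitForm.IsHolomorphic (K.J y).toLinearMap (complForm f L y)) :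
    ∃ O' : Set M, IsOpen O' ∧ x ∈ O' ∧ IsHolomorphicOn K f O' := by
  have h' : ∀ y, ∃ j : normalCompl f L y →ₗ[ℝ] normalCompl f L y, y ∈ O →
      (∀ ξ ζ, inner ℝ (j ξ) (j ζ) = inner ℝ ξ ζ) ∧ (∀ ξ, j (j ξ) = -ξ) ∧
        ∀ X Y, j (complForm f L y X Y) = complForm f L y X (K.J y Y) := fun y ↦ by
    by_cases hy : y ∈ O
    · obtain ⟨-, -, j, hj⟩ := h y hy
      exact ⟨j, fun _ ↦ hj⟩
    · exact ⟨0, fun h ↦ absurd h hy⟩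
  choose j hj using h'
  have hLN : ∀ y ∈ O, L y ≤ normalSpace f y := fun y hy ↦ hL.le_normalSpace (hOU hy)
  have hNN : ∀ y, normalCompl f L y ≤ normalSpace f y := fun y ↦ inf_le_left
  have hLN0 : ∀ y ξ, ξ ∈ L y → (normalCompl f L y).starProjection ξ = 0 := fun y ξ hξ ↦ by
    rw [Submodule.starProjection_apply_eq_zero_iff]
    exact fun ζ hζ ↦ (Submodule.mem_orthogonal' _ _).mp hζ.2 ξ hξ
  have hNL0 : ∀ y ξ, ξ ∈ normalCompl f L y → (L y).starProjection ξ = 0 := fun y ξ hξ ↦ by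
    rw [Submodule.starProjection_apply_eq_zero_iff]
    exact hξ.2
  have hz1 : ∀ y ξ, extendByZero (normalCompl f L y) (j y) (extendByZero (L y) (𝒥 y) ξ) = 0 :=
    fun y ξ ↦ extendByZero_eq_zero (hLN0 y _ (extendByZero_mem ξ))
  have hz2 : ∀ y ξ, extendByZero (L y) (𝒥 y) (extendByZero (normalCompl f L y) (j y) ξ) = 0 :=
    fun y ξ ↦ extendByZero_eq_zero (hNL0 y _ (extendByZero_mem ξ))
  have hP : ∀ y {S : Submodule ℝ V}, S ≤ normalSpace f y → ∀ ξ ∈ S, tangentProj f y ξ = 0 :=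
    fun y S hS ξ hξ ↦ mem_normalSpace_iff.mp (hS hξ)
  refine RealKaehler.exists_isHolomorphicOn hf hO hx (j := fun y ↦ extendByZero (L y) (𝒥 y) +
    extendByZero (normalCompl f L y) (j y)) ?_ ?_ ?_ ?_ ?_ ?_ ?_
  · refine (hL.contMDiffOn_complexStructure.mono hOU).add fun y hy ↦ ?_
    obtain ⟨-, ⟨X, Y, hXY⟩, -⟩ := h y hy
    exact (hL.contMDiffAt_extendByZero_normalCompl hf hO hOU (fun y hy ↦ (h y hy).1)
      (fun y hy ↦ (hj y hy).1) (fun y hy ↦ (hj y hy).2.1) (fun y hy ↦ (hj y hy).2.2) hy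
      hXY).contMDiffWithinAt
  · intro y hy ξ ζ
    rw [add_apply, add_apply, inner_add_left, inner_add_right,
      extendByZero_skew (hL.complexStructure.sq y (hOU hy))
        (hL.complexStructure.inner_map y (hOU hy)),
      extendByZero_skew (hj y hy).2.1 (hj y hy).1]
    ring
  · intro y hy ξ
    rw [add_apply, extendByZero_eq_zero (starProjection_tangentProj (hLN y hy) ξ),
      extendByZero_eq_zero (starProjection_tangentProj (hNN y) ξ), add_zero]
  · intro y hy ξ
    rw [add_apply, map_add, hP y (hLN y hy) _ (extendByZero_mem ξ),
      hP y (hNN y) _ (extendByZero_mem ξ), add_zero]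
  · intro y hy ξ
    simp only [add_apply, map_add, hz1, hz2, add_zero, zero_add]
    rw [extendByZero_sq (hL.complexStructure.sq y (hOU hy)), extendByZero_sq (hj y hy).2.1,
      starProjection_normalCompl (hLN y hy)]
    simp only [sub_apply, one_apply_eq_self]
    abel
  · intro y hy X Y
    have h1 := parallelForm_add_complForm (hLN y hy)
    have h2 := hL.parallelForm_J (hOU hy) X Y
    have h3 := (hj y hy).2.2 X Y
    rw [← h1 X (K.J y Y), h2, ← h3, add_apply, ← extendByZero_coe, ← extendByZero_coe]
    exact congrArg₂ (· + ·) (extendByZero_starProjection _).symm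
      (extendByZero_starProjection _).symm
  · intro y hy ξ hξ h0
    have h1 : ξ ∈ (L y)ᗮ := by
      rw [Submodule.mem_orthogonal']
      intro ζ hζ
      have h2 := hL.le_firstNormalSpace y (hOU hy) hζ
      rw [firstNormalSpace, imageSpan] at h2
      clear hζ
      induction h2 using Submodule.span_induction with
      | mem ζ h => obtain ⟨X, -, Y, -, rfl⟩ := h; exact h0 X Y
      | zero => simp
      | add u v _ _ hu hv => rw [inner_add_right, hu, hv, add_zero]
      | smul r u _ hu => rw [inner_smul_right, hu, mul_zero]
    have h2 : ξ ∈ normalCompl f L y := ⟨mem_normalSpace_iff.mpr hξ, h1⟩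
    have h3 : ∀ X Y, inner ℝ (⟨ξ, h2⟩ : normalCompl f L y) (complForm f L y X Y) = 0 := by
      intro X Y
      have h4 := h0 X Y
      rw [← parallelForm_add_complForm (hLN y hy), inner_add_right,
        (Submodule.mem_orthogonal' _ _).mp h1 _ (parallelForm f L y X Y).2, zero_add] at h4
      exact h4
    obtain ⟨hN2, ⟨X, Y, hXY⟩, -⟩ := h y hy
    obtain ⟨s, t, hst⟩ := IsSplitForm.exists_smul_add_smul (hj y hy).2.1 hN2 hXY ⟨ξ, h2⟩
    rw [(hj y hy).2.2] at hst
    have h5 : inner ℝ (⟨ξ, h2⟩ : normalCompl f L y) (⟨ξ, h2⟩ : normalCompl f L y) = (0 : ℝ) := by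
      refine (congrArg (inner ℝ (⟨ξ, h2⟩ : normalCompl f L y)) hst).trans ?_
      rw [inner_add_right, inner_smul_right, inner_smul_right, h3, h3]
      simp
    exact congrArg Subtype.val (inner_self_eq_zero.mp h5)

end IsPairOn

end Holomorphic

section Main

open VectorField

variable {E : Type*} [NormedAddCommGroup E] [InnerProductSpace ℝ E] [FiniteDimensional ℝ E]
  {H : Type*} [TopologicalSpace H] {I : ModelWithCorners ℝ E H} [I.Boundaryless]
  {M : Type*} [TopologicalSpace M] [ChartedSpace H M] [IsManifold I ∞ M]
  [RiemannianBundle (fun x : M ↦ TangentSpace I x)]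
  [IsContMDiffRiemannianBundle I ∞ E (fun x : M ↦ TangentSpace I x)]
  {V : Type*} [NormedAddCommGroup V] [InnerProductSpace ℝ V] [FiniteDimensional ℝ V]
  {W : Type*} [NormedAddCommGroup W] [NormedSpace ℝ W]

variable {K : KaehlerStructure I M} {f : C^∞⟮I, M; 𝓘(ℝ, V), V⟯}

variable {L : M → Submodule ℝ V} {𝒥 : ∀ x : M, L x →ₗ[ℝ] L x} {U : Set M}

namespace IsPairOn

variable (hL : IsPairOn K f L 𝒥 U)

include hL in
/-- The second fundamental form of a real Kaehler submanifold of codimension three or four has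
no complex bilinear component in the complement of `L` over an open set. -/
theorem exists_not_isHolomorphic (hf : IsRealKaehlerSubmanifold K f) {O : Set M} (hO : IsOpen O)
    (hOU : O ⊆ U) (hne : O.Nonempty) :
    ∃ y ∈ O, ¬ IsSplitForm.IsHolomorphic (K.J y).toLinearMap (complForm f L y) := by
  by_contra! h
  obtain ⟨x, hx⟩ := hne
  have h1 := (h x hx).1
  have h2 := hL.finrank_normalCompl hf.isometric (hOU hx)
  obtain ⟨O', hO', hxO', hol⟩ := hL.exists_isHolomorphicOn hf.isometric hO hOU hx h
  exact hf.not_holomorphic ⟨2, by omega⟩ O' hO' ⟨x, hxO'⟩ hol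

variable (hf : IsRealKaehlerSubmanifold K f)
  (hcodim : finrank ℝ V = finrank ℝ E + 3 ∨ finrank ℝ V = finrank ℝ E + 4)
  (hrank : ∀ x : M, finrank ℝ V - finrank ℝ E < complexRank K f x) (hU : IsOpen U)

include hL hf hcodim in
theorem finrank_normalCompl_eq {x : M} (hx : x ∈ U) :
    finrank ℝ (normalCompl f L x) = 1 ∨ finrank ℝ (normalCompl f L x) = 2 := by
  have := hL.finrank_normalCompl hf.isometric hx
  omega

include hL hf hcodim hrank hU in
theorem finrank_le_finrank_kernelDistribution {x : M} (hx : x ∈ U) :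
    finrank ℝ (TangentSpace I x) ≤ finrank ℝ (kernelDistribution K f L x) +
      2 * finrank ℝ (normalCompl f L x) := by
  obtain ⟨d, hd⟩ := hL.kernel_subbundle
  obtain ⟨y, hy, hhol⟩ := hL.exists_not_isHolomorphic hf hU subset_rfl ⟨x, hx⟩
  have h1 := ((hL.isSplitForm hf.isometric hrank hy).le_finrank_add_or
    (hL.finrank_normalCompl_eq hf hcodim hy)).resolve_right hhol
  rw [← kernelDistribution_eq, hd.finrank_eq hy] at h1
  have h2 := hL.finrank_normalCompl hf.isometric hx
  have h3 := hL.finrank_normalCompl hf.isometric hy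
  rw [hd.finrank_eq hx]
  have h4 : finrank ℝ (TangentSpace I x) = finrank ℝ (TangentSpace I y) := rfl
  omega

include hL hf hcodim hrank hU in
theorem conditionC3 : ConditionC3 K f L U := by
  intro x hx
  have hk := hL.finrank_le_finrank_kernelDistribution hf hcodim hrank hU hx
  rw [kernelDistribution_eq] at hk
  obtain ⟨X, hX, Y, hY, hne⟩ := (hL.isSplitForm hf.isometric hrank hx).exists_apply_ne_zero
    (hL.finrank_normalCompl_eq hf hcodim hx) hk
  rw [← kernelDistribution_eq] at hX hY
  exact hL.imageSpan_eq hx hX hY hne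

include hL hf hcodim hrank hU in
theorem complDeriv_eq_zero {x : M} (hx : x ∈ U) {X : TangentSpace I x}
    (hX : X ∈ kernelDistribution K f L x) : complDeriv f L x X = 0 := by
  by_contra hne
  obtain ⟨d, hd⟩ := hL.kernel_subbundle
  obtain ⟨O, hO, hxO, hOU, Y, hY, rfl⟩ := hd.exists_section hx hX
  let A : M → V →L[ℝ] V := fun y ↦ ((1 - tangentProj f y - (L y).starProjection).comp
    (mvfderiv I (fun y ↦ (L y).starProjection) y (Y y))).comp (L y).starProjection
  have hLs := hL.contMDiffOn_starProjection.mono hOU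
  have hA : ContMDiffOn I 𝓘(ℝ, V →L[ℝ] V) ∞ A O :=
    (((contMDiffOn_const.sub (contMDiff_tangentProj K hf.isometric).contMDiffOn).sub hLs).clm_comp
      (contMDiffOn_push hO hLs hY.1)).clm_comp hLs
  have hA0 : ∀ y ∈ O, complDeriv f L y (Y y) = 0 ↔ A y = 0 := by
    intro y hy
    have h1 : ∀ η : L y, (complDeriv f L y (Y y) η : V) = A y η := fun η ↦ by
      rw [coe_complDeriv, starProjection_normalCompl (hL.le_normalSpace (hOU hy))]
      simp only [A, ContinuousLinearMap.comp_apply]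
      rw [Submodule.starProjection_eq_self_iff.mpr η.2]
    constructor
    · intro h0
      ext ξ
      have h2 := h1 ((L y).orthogonalProjectionOnto ξ)
      rw [h0] at h2
      have h3 : A y ((L y).starProjection ξ) = A y ξ := by
        simp only [A, ContinuousLinearMap.comp_apply, starProjection_idem]
      exact h3.symm.trans h2.symm
    · intro h0
      ext η
      rw [h1, h0]
      simp
  have hAO : IsOpen (O ∩ A ⁻¹' {0}ᶜ) :=
    hA.continuousOn.isOpen_inter_preimage hO isOpen_compl_singleton
  obtain ⟨y, hy, hhol⟩ := hL.exists_not_isHolomorphic hf hAO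
    (Set.inter_subset_left.trans hOU) ⟨x, hxO, fun h0 ↦ hne ((hA0 x hxO).mpr h0)⟩
  have h1 := (hL.complDeriv_eq_zero_or hf.isometric hrank (hOU hy.1)
    (hL.finrank_normalCompl_eq hf hcodim (hOU hy.1))
    (hL.finrank_le_finrank_kernelDistribution hf hcodim hrank hU (hOU hy.1))).resolve_right hhol
  exact hy.2 ((hA0 y hy.1).mp (h1 _ (hY.2 y hy.1)))

end IsPairOn

end Main

end RealKaehler

end

theorem mainTheorem7 {n p : ℕ} (hp₃ : 3 ≤ p) (hp₄ : p ≤ 4) (hn : p < n)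
    {M : Type*} [TopologicalSpace M] [T2Space M] [SecondCountableTopology M] [ConnectedSpace M]
    [ChartedSpace (EuclideanSpace ℝ (Fin (2 * n))) M] [IsManifold (𝓡 (2 * n)) ∞ M]
    [RiemannianBundle (fun x : M ↦ TangentSpace (𝓡 (2 * n)) x)]
    [IsContMDiffRiemannianBundle (𝓡 (2 * n)) ∞ (EuclideanSpace ℝ (Fin (2 * n)))
      (fun x : M ↦ TangentSpace (𝓡 (2 * n)) x)]
    (K : RealKaehler.KaehlerStructure (𝓡 (2 * n)) M)
    (f : C^∞⟮𝓡 (2 * n), M; 𝓡 (2 * n + p), EuclideanSpace ℝ (Fin (2 * n + p))⟯)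
    (hf : RealKaehler.IsRealKaehlerSubmanifold K f)
    (hrank : ∀ x : M, p < RealKaehler.complexRank K f x)
    {U : Set M} (hU : IsOpen U)
    (L : M → Submodule ℝ (EuclideanSpace ℝ (Fin (2 * n + p)))) (𝒥 : ∀ x : M, L x →ₗ[ℝ] L x)
    (hL : RealKaehler.IsPairOn K f L 𝒥 U) :
    RealKaehler.ConditionC1 K f L 𝒥 U ∧
    RealKaehler.ConditionC2 K f L U ∧
    RealKaehler.ConditionC3 K f L U ∧
    RealKaehler.IsIntegrableOn (RealKaehler.kernelDistribution K f L) U := by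
  have hV : finrank ℝ (EuclideanSpace ℝ (Fin (2 * n + p))) = 2 * n + p := by simp
  have hE : finrank ℝ (EuclideanSpace ℝ (Fin (2 * n))) = 2 * n := by simp
  have hcodim : finrank ℝ (EuclideanSpace ℝ (Fin (2 * n + p))) =
      finrank ℝ (EuclideanSpace ℝ (Fin (2 * n))) + 3 ∨
      finrank ℝ (EuclideanSpace ℝ (Fin (2 * n + p))) =
      finrank ℝ (EuclideanSpace ℝ (Fin (2 * n))) + 4 := by omega
  have hrank' : ∀ x : M, finrank ℝ (EuclideanSpace ℝ (Fin (2 * n + p))) -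
      finrank ℝ (EuclideanSpace ℝ (Fin (2 * n))) < RealKaehler.complexRank K f x := fun x ↦ by
    have := hrank x
    omega
  have hB := fun x (hx : x ∈ U) X ↦ hL.complDeriv_eq_zero hf hcodim hrank' hU (x := x) hx (X := X)
  exact ⟨hL.conditionC1 hU, hL.conditionC2 hB, hL.conditionC3 hf hcodim hrank' hU,
    hL.isIntegrableOn hf.isometric hB⟩
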